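/- Let $n\ge 0$, $T\in\mathbb R$, $a\ge T$, and put $\tau=\tau(t)=a-t$. Let $\Omega\subset\mathbb R^{n+1}$ be a bounded open set with smooth boundary and let $\phi_t:\bar\Omega\to\mathbb R^{n+1}$, $t\in(0,T)$, be a smooth one-parameter family of diffeomorphisms onto their images. Put $\Omega_t=\phi_t(\Omega)$ and $M_t=\partial\Omega_t$, let $\nu$ be the outer unit normal of $\Omega_t$ along $M_t$, and let $\beta=-\frac{\partial x}{\partial t}\cdot\nu$, i.e. $\beta(\phi_t(p),t)=-\frac{\partial\phi_t}{\partial t}(p)\cdot\nu$ for $p\in\partial\Omega$, be the normal speed of $M_t$ with respect to the inward normal. Let $f$ be a real function, smooth up to the boundary on $\{(x,t):t\in(0,T),\,x\in\bar\Omega_t\}$, such that for all $t\in(0,T)$ $$\frac{\partial\phi_t}{\partial t}(p)=-\nabla f(\phi_t(p),t)\quad(p\in\Omega),\qquad \frac{\partial f}{\partial t}+\Delta f=|\nabla f|^2+\frac{n+1}{2\tau}\ \text{ in }\Omega_t,\qquad \nabla f\cdot\nu=\beta\ \text{ on }M_t.$$ Put $u=(4\pi\tau)^{-\frac{n+1}2}e^{-f}$,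 $W=\tau(2\Delta f-|\nabla f|^2)+f-(n+1)$ and $$\mathcal W_\beta(\Omega_t,f(t),\tau(t))=\int_{\Omega_t}\big(\tau|\nabla f|^2+f-(n+1)\big)u\,dx+2\tau\int_{M_t}\beta u\,dS .$$ Let $\nabla^M$ denote the tangential gradient on $M_t$, let $A(X,Y)=D_X\nu\cdot Y$ be the second fundamental form of $M_t$ (positive on round spheres), and let $\frac{\partial\beta}{\partial t}$ denote the time derivative of $\beta$ along the normal motion $\frac{\partial x}{\partial t}=-\beta\nu$ of $M_t$. Then for all $t\in(0,T)$ $$-\nabla W\cdot\nu=2\tau\Big(\frac{\partial\beta}{\partial t}-2\,\nabla^M\beta\cdot\nabla^M f+A(\nabla^M f,\nabla^M f)-\frac{\beta}{2\tau}\Big)\quad\text{on }M_t .$$ Moreover all the integrals above and below converge absolutely, $t\mapsto\mathcal W_\beta(\Omega_t,f(t),\tau(t))$ is differentiable on $(0,T)$, and $$\frac{d}{dt}\mathcal W_\beta(\Omega_t,f(t),\tau(t))\ \ge\ 2\tau\int_{M_t}\Big(\frac{\partial\beta}{\partial t}-2\,\nabla^M\beta\cdot\nabla^M f+A(\nabla^M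 f,\nabla^M f)-\frac{\beta}{2\tau}\Big)u\,dS .$$ -/

import Mathlib

open Set MeasureTheory
open scoped ContDiff Gradient RealInnerProductSpace

noncomputable section

namespace EvolvingDomain

/-- The ambient Euclidean space of dimension `n + 1`. -/
abbrev Space (n : ℕ) : Type := EuclideanSpace ℝ (Fin (n + 1))

/-- `g` is smooth on the (not necessarily open) set `A`, derivatives up to the boundary included:
it is smooth on an open neighbourhood of `A`. Only the values of `g` on `A` matter below, since on
the closure of a domain they determine all derivatives on that closure. -/
def SmoothUpTo {X Y : Type*} [NormedAddCommGroup X] [NormedSpace ℝ X]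
    [NormedAddCommGroup Y] [NormedSpace ℝ Y] (g : X → Y) (A : Set X) : Prop :=
  ∃ U : Set X, IsOpen U ∧ A ⊆ U ∧ ContDiffOn ℝ ∞ g U

variable {n : ℕ}

/-- `ρ` is a smooth defining function of `Ω` near `x`: `Ω = {ρ < 0}` there, and `∇ρ(x) ≠ 0`. -/
def IsLocalDefiningFunction (Ω : Set (Space n)) (x : Space n) (ρ : Space n → ℝ) : Prop :=
  ∇ ρ x ≠ 0 ∧ ∃ U : Set (Space n), IsOpen U ∧ x ∈ U ∧ ContDiffOn ℝ ∞ ρ U ∧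
    ∀ y ∈ U, y ∈ Ω ↔ ρ y < 0

/-- A bounded open set with smooth boundary (lying locally on one side of its boundary). -/
structure IsBoundedSmoothDomain (Ω : Set (Space n)) : Prop where
  isOpen : IsOpen Ω
  isBounded : Bornology.IsBounded Ω
  smooth_boundary : ∀ x ∈ frontier Ω, ∃ ρ : Space n → ℝ, IsLocalDefiningFunction Ω x ρ

open Classical in
/-- The outer unit normal `∇ρ / |∇ρ|` of `Ω` at a boundary point, for any local defining function
`ρ`; see `outerUnitNormal_eq` for the independence of `ρ`. -/
def outerUnitNormal (Ω : Set (Space n)) (x : Space n) : Space n :=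
  if h : ∃ ρ : Space n → ℝ, IsLocalDefiningFunction Ω x ρ then
    ‖∇ (Classical.choose h) x‖⁻¹ • ∇ (Classical.choose h) x
  else 0

/-- The tangential gradient `∇^M g` on `M = ∂Ω`: the tangential part of the gradient of `g` along
`M`. It depends only on the restriction of `g` to `M`. -/
def tangentialGradient (Ω : Set (Space n)) (g : Space n → ℝ) (x : Space n) : Space n :=
  gradientWithin g (frontier Ω) x -
    ⟪gradientWithin g (frontier Ω) x, outerUnitNormal Ω x⟫ • outerUnitNormal Ω x

/-- The second fundamental form `A(X, Y) = D_X ν · Y` of `M = ∂Ω` with respect to the outer unit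
normal `ν`, for `X`, `Y` tangent to `M` at `x`; it is positive on round spheres. -/
def secondFundamentalForm (Ω : Set (Space n)) (x X Y : Space n) : ℝ :=
  ⟪fderivWithin ℝ (outerUnitNormal Ω) (frontier Ω) x X, Y⟫

/-- `φ t`, for `0 < t < T`, is a smooth one-parameter family of diffeomorphisms from the closure of
`Ω₀` onto its images. -/
structure IsSmoothDiffeoFamily (T : ℝ) (Ω₀ : Set (Space n)) (φ : ℝ → Space n → Space n) :
    Prop where
  smooth : SmoothUpTo (fun z : ℝ × Space n => φ z.1 z.2) (Ioo 0 T ×ˢ closure Ω₀)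
  smooth_inverse : ∀ t ∈ Ioo 0 T, ∃ ψ : Space n → Space n,
    SmoothUpTo ψ (φ t '' closure Ω₀) ∧ ∀ p ∈ closure Ω₀, ψ (φ t p) = p

/-- The moving domain `Ω_t = φ_t(Ω₀)`; its boundary is `M_t = frontier (domainAt Ω₀ φ t)`. -/
def domainAt (Ω₀ : Set (Space n)) (φ : ℝ → Space n → Space n) (t : ℝ) : Set (Space n) :=
  φ t '' Ω₀

/-- The normal speed `β(t, x) = -(∂φ/∂t)(p, t) · ν` of `M_t` at `x = φ_t(p)`, with respect to the
inward normal `-ν`. -/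
def normalSpeed (Ω₀ : Set (Space n)) (φ : ℝ → Space n → Space n) (t : ℝ) (x : Space n) : ℝ :=
  -⟪deriv (fun s => φ s (Function.invFunOn (φ t) (closure Ω₀) x)) t,
    outerUnitNormal (domainAt Ω₀ φ t) x⟫

/-- The time derivative `∂g/∂t` at `(t, x)`, `x ∈ M_t`, of a function `g(t, ·)` on the hypersurfaces
`M_t = ∂Ω_t` moving with normal speed `β`: the derivative along the normal motion `∂x/∂t = -β ν`,
that is, the derivative of `g` along the space-time track `{(s, y) : y ∈ M_s}` in the direction
`(1, -β ν)`, which is tangent to this track. -/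
def normalTimeDeriv (Ω : ℝ → Set (Space n)) (β g : ℝ → Space n → ℝ) (t : ℝ) (x : Space n) : ℝ :=
  fderivWithin ℝ (fun z : ℝ × Space n => g z.1 z.2) {z | z.2 ∈ frontier (Ω z.1)} (t, x)
    (1, -(β t x) • outerUnitNormal (Ω t) x)

/-- `u = e^{-f} / (4πτ)^{(n+1)/2}`. -/
def density (f : Space n → ℝ) (τ : ℝ) (x : Space n) : ℝ :=
  Real.exp (-f x) / (4 * Real.pi * τ) ^ (((n : ℝ) + 1) / 2)

/-- `(τ |∇f|² + f - (n+1)) u`. -/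
def entropyIntegrand (f : Space n → ℝ) (τ : ℝ) (x : Space n) : ℝ :=
  (τ * ‖∇ f x‖ ^ 2 + f x - (n + 1)) * density f τ x

/-- `𝒲_β(Ω, f, τ) = ∫_Ω (τ |∇f|² + f - (n+1)) u dx + 2τ ∫_{∂Ω} β u dS`, with `dS` the
`n`-dimensional Hausdorff measure, normalized to agree with Lebesgue measure on `n`-planes. -/
def entropy (β : Space n → ℝ) (Ω : Set (Space n)) (f : Space n → ℝ) (τ : ℝ) : ℝ :=
  (∫ x in Ω, entropyIntegrand f τ x) + 2 * τ * ∫ x in frontier Ω, β x * density f τ x ∂μHE[n]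

/-- `W = τ (2 Δf - |∇f|²) + f - (n+1)`. -/
def perelmanW (f : Space n → ℝ) (τ : ℝ) (x : Space n) : ℝ :=
  τ * (2 * Laplacian.laplacian f x - ‖∇ f x‖ ^ 2) + f x - (n + 1)

/-- `∂β/∂t - 2 ∇^M β · ∇^M f + A(∇^M f, ∇^M f) - β / (2τ)` at the point `x` of `M_t = ∂Ω_t`. -/
def harnackExpr (Ω : ℝ → Set (Space n)) (β f : ℝ → Space n → ℝ) (τ t : ℝ) (x : Space n) : ℝ :=
  normalTimeDeriv Ω β β t x
    - 2 * ⟪tangentialGradient (Ω t) (β t) x, tangentialGradient (Ω t) (f t) x⟫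
    + secondFundamentalForm (Ω t) x (tangentialGradient (Ω t) (f t) x)
        (tangentialGradient (Ω t) (f t) x)
    - β t x / (2 * τ)

theorem IsLocalDefiningFunction.inner_nonpos {Ω : Set (Space n)} {x : Space n}
    {ρ₁ ρ₂ : Space n → ℝ} (h₁ : IsLocalDefiningFunction Ω x ρ₁)
    (h₂ : IsLocalDefiningFunction Ω x ρ₂) (hx₁ : ρ₁ x = 0) (hx₂ : ρ₂ x = 0) {v : Space n}
    (hv : ⟪∇ ρ₁ x, v⟫ < 0) : ⟪∇ ρ₂ x, v⟫ ≤ 0 := by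
  by_contra! hc
  have key : ∀ ρ : Space n → ℝ, IsLocalDefiningFunction Ω x ρ →
      HasDerivAt (fun s : ℝ => ρ (x + s • v)) ⟪∇ ρ x, v⟫ 0 := by
    rintro ρ ⟨_, U, hU, hxU, hρ, _⟩
    have hd : DifferentiableAt ℝ ρ x :=
      (hρ.contDiffAt (hU.mem_nhds hxU)).differentiableAt (by simp)
    have hl : HasDerivAt (fun s : ℝ => x + s • v) v 0 := by
      simpa using ((hasDerivAt_id (0 : ℝ)).smul_const v).const_add x
    have hg : HasFDerivAt ρ (InnerProductSpace.toDual ℝ (Space n) (∇ ρ x))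
        (x + (0 : ℝ) • v) := by
      simpa using hd.hasGradientAt.hasFDerivAt
    simpa [Function.comp_def] using hg.comp_hasDerivAt (0 : ℝ) hl
  have k₁ := key ρ₁ h₁
  have k₂ := key ρ₂ h₂
  obtain ⟨_, U₁, hU₁, hxU₁, _, e₁⟩ := h₁
  obtain ⟨_, U₂, hU₂, hxU₂, _, e₂⟩ := h₂
  have hcont : Filter.Tendsto (fun s : ℝ => x + s • v) (nhdsWithin 0 (Ioi 0)) (nhds x) := by
    have : Continuous (fun s : ℝ => x + s • v) := by fun_prop
    simpa using (this.tendsto 0).mono_left nhdsWithin_le_nhds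
  have hU := (hcont.eventually (hU₁.mem_nhds hxU₁)).and (hcont.eventually (hU₂.mem_nhds hxU₂))
  have s₁ := (hasDerivAt_iff_tendsto_slope_zero.1 k₁).mono_left
    (nhdsWithin_mono (0 : ℝ) (fun s (hs : 0 < s) => ne_of_gt hs))
  have s₂ := (hasDerivAt_iff_tendsto_slope_zero.1 k₂).mono_left
    (nhdsWithin_mono (0 : ℝ) (fun s (hs : 0 < s) => ne_of_gt hs))
  have n₁ := s₁.eventually (gt_mem_nhds hv)
  have n₂ := s₂.eventually (lt_mem_nhds hc)
  obtain ⟨s, ⟨⟨⟨hs₁, hs₂⟩, m₁⟩, m₂⟩, hs⟩ :=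
    (((hU.and n₁).and n₂).and self_mem_nhdsWithin).exists
  have hs : 0 < s := hs
  simp only [zero_add, zero_smul, add_zero, hx₁, hx₂, sub_zero, smul_eq_mul] at m₁ m₂
  have p₁ : ρ₁ (x + s • v) < 0 := by
    by_contra! h
    exact absurd m₁ (not_lt.2 (mul_nonneg (inv_nonneg.2 hs.le) h))
  have p₂ : 0 < ρ₂ (x + s • v) := by
    by_contra! h
    exact absurd m₂ (not_lt.2 (mul_nonpos_of_nonneg_of_nonpos (inv_nonneg.2 hs.le) h))
  exact absurd ((e₂ _ hs₂).1 ((e₁ _ hs₁).2 p₁)) (not_lt.2 p₂.le)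

theorem IsLocalDefiningFunction.eq_zero {Ω : Set (Space n)} {x : Space n} {ρ : Space n → ℝ}
    (hΩ : IsOpen Ω) (hx : x ∈ frontier Ω) (h : IsLocalDefiningFunction Ω x ρ) : ρ x = 0 := by
  obtain ⟨_, U, hU, hxU, hρ, e⟩ := h
  rw [hΩ.frontier_eq] at hx
  refine le_antisymm ?_ (not_lt.1 fun h => hx.2 ((e x hxU).2 h))
  by_contra! hpos
  have hc : ContinuousAt ρ x := (hρ.continuousOn).continuousAt (hU.mem_nhds hxU)
  have hev := (hc.eventually (lt_mem_nhds hpos)).and (hU.mem_nhds hxU)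
  obtain ⟨y, ⟨hy, hyU⟩, hyΩ⟩ := mem_closure_iff_nhds.1 hx.1 _ hev
  exact absurd ((e y hyU).1 hyΩ) (not_lt.2 (le_of_lt hy))

/-- The outer unit normal does not depend on the defining function. -/
theorem outerUnitNormal_eq {Ω : Set (Space n)} {x : Space n} {ρ : Space n → ℝ} (hΩ : IsOpen Ω)
    (hx : x ∈ frontier Ω) (h : IsLocalDefiningFunction Ω x ρ) :
    outerUnitNormal Ω x = ‖∇ ρ x‖⁻¹ • ∇ ρ x := by
  have hex : ∃ ρ : Space n → ℝ, IsLocalDefiningFunction Ω x ρ := ⟨ρ, h⟩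
  rw [outerUnitNormal, dif_pos hex]
  set σ := Classical.choose hex with hσ
  have h' : IsLocalDefiningFunction Ω x σ := Classical.choose_spec hex
  have na : 0 < ‖∇ σ x‖ := norm_pos_iff.2 h'.1
  have nb : 0 < ‖∇ ρ x‖ := norm_pos_iff.2 h.1
  set a := ‖∇ σ x‖⁻¹ • ∇ σ x with ha
  set b := ‖∇ ρ x‖⁻¹ • ∇ ρ x with hb
  have ea : ∇ σ x = ‖∇ σ x‖ • a := by rw [ha, smul_smul, mul_inv_cancel₀ na.ne', one_smul]
  have eb : ∇ ρ x = ‖∇ ρ x‖ • b := by rw [hb, smul_smul, mul_inv_cancel₀ nb.ne', one_smul]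
  have ua : ‖a‖ = 1 := by rw [ha, norm_smul, norm_inv, norm_norm, inv_mul_cancel₀ na.ne']
  have ub : ‖b‖ = 1 := by rw [hb, norm_smul, norm_inv, norm_norm, inv_mul_cancel₀ nb.ne']
  by_contra hne
  have hlt : ⟪a, b⟫ < 1 := (inner_lt_one_iff_real_of_norm_eq_one ua ub).2 hne
  have h1 : ⟪∇ σ x, b - a⟫ < 0 := by
    rw [ea, real_inner_smul_left, inner_sub_right, real_inner_self_eq_norm_sq, ua]
    nlinarith
  have h2 := h'.inner_nonpos h (h'.eq_zero hΩ hx) (h.eq_zero hΩ hx) h1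
  rw [eb, real_inner_smul_left, inner_sub_right, real_inner_self_eq_norm_sq, ub,
    real_inner_comm] at h2
  nlinarith

/-- `β(t, φ_t(p)) = -(∂φ/∂t)(p, t) · ν(φ_t(p))`. -/
theorem normalSpeed_apply {Ω₀ : Set (Space n)} {φ : ℝ → Space n → Space n} {t : ℝ}
    (hφ : InjOn (φ t) (closure Ω₀)) {p : Space n} (hp : p ∈ closure Ω₀) :
    normalSpeed Ω₀ φ t (φ t p) =
      -⟪deriv (fun s => φ s p) t, outerUnitNormal (domainAt Ω₀ φ t) (φ t p)⟫ := by
  have h : Function.invFunOn (φ t) (closure Ω₀) (φ t p) = p :=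
    hφ.leftInvOn_invFunOn hp
  rw [normalSpeed, h]

end EvolvingDomain

end

open EvolvingDomain

/-!
Perelman's monotonicity formula for the entropy, localized to a domain that moves with the
trajectories of `-∇f` and has the Neumann boundary condition `∇f · ν = β`.

Boundary identity. By the Neumann condition, `β` is the restriction to the track of the moving
boundary of `B = ∇f · N`, where `N` is a field on space-time that extends the outer unit normals
(`exists_normal_field`). Tangential derivatives of a function on a hypersurface can be computed with
any extension (`fderivWithin_apply_of_levelSet`), so every term of the Harnack expression becomes a
derivative of `B` or of `N`. Trajectories have velocity `-∇f`, hence `N` changes along them by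
`Y · N' = ∇²f(Y, N)` for tangential `Y`, and the second fundamental form cancels: what is left is
`D²f((1, -∇f), (0, ν)) - β / (2τ)`, with `D²f` the Hessian in space-time (`harnackExpr_eq`). The
same expression appears in `-∇W · ν` when the normal derivative of the heat equation, valid up to
the boundary, is used to eliminate `∇Δf` (`perelmanW_normal_derivative`).

Monotonicity. As `∇u = -u ∇f` and `β = ∇f · ν`, the divergence theorem turns the boundary term of
the entropy into `2τ ∫ (Δf - |∇f|²) u`, so that the entropy is `∫ W u` over the domain
(`entropy_slice_eq`). The measure `u dx` is transported without change by the motion, so the time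
derivative is the integral of `(W_t - ∇W · ∇f) u` (`hasDerivAt_integral_domainAt`). Perelman's
computation `W_t + ΔW = 2τ |∇²f - I / (2τ)|² + 2 ∇W · ∇f` (`spaceTimeW_evolution`, a consequence of
Bochner's formula) makes this `2τ ∫ |∇²f - I / (2τ)|² u - ∫ div (u ∇W)`. The first integral is
nonnegative, and the second is the boundary integral of `∇W · ν u`, given by the boundary identity.

The divergence theorem for smooth bounded domains with Hausdorff measure on the boundary
(`integral_fderiv_eq_integral_frontier`) is obtained without parametrized surface integrals. Near a
boundary point the domain lies below the graph of an `ε`-Lipschitz function over the tangent plane.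
For `g ≥ 0` the integral of `∂_w g` over such a subgraph is the integral of `g` over the graph, in
base coordinates, times the vertical part of `w`, up to a relative error `ε`: this holds exactly for
vertical `w` by Fubini, and `∫ ∂_w g ≥ 0` if translation along `w` enlarges the subgraph. Projection
and parametrization of the graph are Lipschitz with constants `1` and `1 + ε`, which compares
Hausdorff measure with Lebesgue measure of the base. A partition of unity and `ε → 0` give the
formula. The transport theorem follows from the change of variables formula and Jacobi's formula.
-/

namespace EvolvingDomain

variable {n : ℕ}

/-! ### Subgraphs of Lipschitz functions -/

section Subgraph

/-- The tangential component of `x` in the orthonormal frame given by the isometry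
`A : ℝⁿ × ℝ ≃ ℝⁿ⁺¹`. -/
noncomputable def horiz (A : WithLp 2 (EuclideanSpace ℝ (Fin n) × ℝ) ≃ₗᵢ[ℝ] Space n)
    (x : Space n) : EuclideanSpace ℝ (Fin n) :=
  (A.symm x).fst

/-- The vertical component of `x` in the orthonormal frame given by the isometry `A`. -/
noncomputable def vert (A : WithLp 2 (EuclideanSpace ℝ (Fin n) × ℝ) ≃ₗᵢ[ℝ] Space n)
    (x : Space n) : ℝ :=
  (A.symm x).snd

/-- The parametrization `y ↦ (y, h y)` of the graph of `h`, in the frame `A`. -/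
noncomputable def graphMap (A : WithLp 2 (EuclideanSpace ℝ (Fin n) × ℝ) ≃ₗᵢ[ℝ] Space n)
    (h : EuclideanSpace ℝ (Fin n) → ℝ) (y : EuclideanSpace ℝ (Fin n)) : Space n :=
  A (WithLp.toLp 2 (y, h y))

/-- The open set below the graph of `h`, in the frame `A`. -/
def subgraph (A : WithLp 2 (EuclideanSpace ℝ (Fin n) × ℝ) ≃ₗᵢ[ℝ] Space n)
    (h : EuclideanSpace ℝ (Fin n) → ℝ) : Set (Space n) := {x | vert A x < h (horiz A x)}

variable (A : WithLp 2 (EuclideanSpace ℝ (Fin n) × ℝ) ≃ₗᵢ[ℝ] Space n)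
  {h : EuclideanSpace ℝ (Fin n) → ℝ}

@[simp] theorem horiz_apply (p : EuclideanSpace ℝ (Fin n) × ℝ) :
    horiz A (A (WithLp.toLp 2 p)) = p.1 := by simp [horiz]

@[simp] theorem vert_apply (p : EuclideanSpace ℝ (Fin n) × ℝ) :
    vert A (A (WithLp.toLp 2 p)) = p.2 := by simp [vert]

theorem apply_horiz_vert (x : Space n) : A (WithLp.toLp 2 (horiz A x, vert A x)) = x :=
  A.apply_symm_apply x

theorem horiz_sub (x y : Space n) : horiz A (x - y) = horiz A x - horiz A y := by simp [horiz]

theorem vert_sub (x y : Space n) : vert A (x - y) = vert A x - vert A y := by simp [vert]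

theorem horiz_smul (r : ℝ) (x : Space n) : horiz A (r • x) = r • horiz A x := by simp [horiz]

theorem vert_smul (r : ℝ) (x : Space n) : vert A (r • x) = r * vert A x := by simp [vert]

theorem continuous_horiz : Continuous (horiz A) := by
  unfold horiz
  exact (WithLp.prod_continuous_ofLp 2 _ _).fst.comp A.symm.continuous

theorem continuous_vert : Continuous (vert A) := by
  unfold vert
  exact (WithLp.prod_continuous_ofLp 2 _ _).snd.comp A.symm.continuous

theorem norm_sq_eq (x : Space n) : ‖x‖ ^ 2 = ‖horiz A x‖ ^ 2 + vert A x ^ 2 := by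
  rw [← A.symm.norm_map x, WithLp.prod_norm_sq_eq_of_L2, Real.norm_eq_abs, sq_abs]; rfl

theorem norm_horiz_le (x : Space n) : ‖horiz A x‖ ≤ ‖x‖ := by
  have := norm_sq_eq A x
  exact abs_le_of_sq_le_sq' (by nlinarith [sq_nonneg (vert A x)]) (norm_nonneg _) |>.2

theorem norm_le_horiz_add_vert (x : Space n) : ‖x‖ ≤ ‖horiz A x‖ + |vert A x| := by
  have := norm_sq_eq A x
  refine abs_le_of_sq_le_sq' ?_ (by positivity) |>.2
  nlinarith [norm_nonneg (horiz A x), abs_nonneg (vert A x), sq_abs (vert A x)]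

theorem inner_vert (x : Space n) : ⟪A (WithLp.toLp 2 (0, 1)), x⟫ = vert A x := by
  rw [← A.symm.inner_map_map, LinearIsometryEquiv.symm_apply_apply, WithLp.prod_inner_apply]
  simp [vert]

theorem continuous_graphMap (hh : Continuous h) : Continuous (graphMap A h) := by
  unfold graphMap
  exact A.continuous.comp ((WithLp.prod_continuous_toLp 2 _ _).comp (by fun_prop))

theorem mem_range_graphMap {x : Space n} :
    x ∈ range (graphMap A h) ↔ vert A x = h (horiz A x) := by
  constructor
  · rintro ⟨y, rfl⟩; simp [graphMap]
  · intro hx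
    exact ⟨horiz A x, by rw [graphMap, ← hx, apply_horiz_vert]⟩

theorem isClosed_range_graphMap (hh : Continuous h) : IsClosed (range (graphMap A h)) := by
  have : range (graphMap A h) = {x | vert A x = h (horiz A x)} := by
    ext x; exact mem_range_graphMap A
  rw [this]
  exact isClosed_eq (continuous_vert A) (hh.comp (continuous_horiz A))

theorem isOpen_subgraph (hh : Continuous h) : IsOpen (subgraph A h) :=
  isOpen_lt (continuous_vert A) (hh.comp (continuous_horiz A))

theorem measurePreserving_frame :
    MeasurePreserving (fun p : EuclideanSpace ℝ (Fin n) × ℝ => A (WithLp.toLp 2 p)) :=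
  A.measurePreserving.comp (WithLp.volume_preserving_toLp _ _)

theorem measurableEmbedding_frame :
    MeasurableEmbedding (fun p : EuclideanSpace ℝ (Fin n) × ℝ => A (WithLp.toLp 2 p)) :=
  A.toMeasurableEquiv.measurableEmbedding.comp
    (MeasurableEquiv.toLp 2 _).measurableEmbedding

theorem isClosedEmbedding_frame :
    Topology.IsClosedEmbedding (fun p : EuclideanSpace ℝ (Fin n) × ℝ => A (WithLp.toLp 2 p)) :=
  (A.toHomeomorph.isClosedEmbedding).comp
    (WithLp.homeomorphProd 2 (EuclideanSpace ℝ (Fin n)) ℝ).symm.isClosedEmbedding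

theorem isClosedEmbedding_graphMap (hh : Continuous h) :
    Topology.IsClosedEmbedding (graphMap A h) :=
  (isClosedEmbedding_frame A).comp
    ((Function.LeftInverse.isClosedEmbedding (f := Prod.fst) (g := fun y => (y, h y)) (fun y => rfl)
      continuous_fst (by fun_prop)))

/-- The integral over a subgraph of the derivative in the vertical direction, computed by Fubini
and the fundamental theorem of calculus on vertical lines. -/
theorem integral_subgraph_fderiv_vertical (hh : Continuous h) {g : Space n → ℝ}
    (hg : ContDiff ℝ 1 g) (hgc : HasCompactSupport g) :
    ∫ x in subgraph A h, fderiv ℝ g x (A (WithLp.toLp 2 (0, 1))) = ∫ y, g (graphMap A h y) := by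
  set e := A (WithLp.toLp 2 ((0 : EuclideanSpace ℝ (Fin n)), (1 : ℝ))) with he
  set Φ := fun p : EuclideanSpace ℝ (Fin n) × ℝ => A (WithLp.toLp 2 p) with hΦ
  have hcont : Continuous fun x => fderiv ℝ g x e :=
    (hg.continuous_fderiv (by simp)).clm_apply continuous_const
  have hcs : HasCompactSupport fun x => fderiv ℝ g x e := hgc.fderiv_apply ℝ e
  have hint : Integrable (fun x => fderiv ℝ g x e) := hcont.integrable_of_hasCompactSupport hcs
  rw [← (measurePreserving_frame A).setIntegral_preimage_emb (measurableEmbedding_frame A)]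
  have hmeas : MeasurableSet ((fun p => A (WithLp.toLp 2 p)) ⁻¹' subgraph A h) :=
    (isOpen_subgraph A hh).measurableSet.preimage (measurableEmbedding_frame A).measurable
  rw [← integral_indicator hmeas]
  have hint' : Integrable (fun p => fderiv ℝ g (Φ p) e) :=
    (measurePreserving_frame A).integrable_comp_of_integrable hint
  rw [Measure.volume_eq_prod, integral_prod _ ((hint'.indicator hmeas))]
  refine integral_congr_ae (Filter.Eventually.of_forall fun y => ?_)
  have hline : ∀ s : ℝ, Φ (y, s) = Φ (y, 0) + s • e := by
    intro s
    simp only [hΦ, he, ← map_smul, ← map_add, ← WithLp.toLp_smul, ← WithLp.toLp_add]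
    simp
  have hG : ContDiff ℝ 1 fun s : ℝ => g (Φ (y, s)) := by
    have : ContDiff ℝ 1 fun s : ℝ => Φ (y, 0) + s • e := by fun_prop
    exact hg.comp ((funext hline : (fun s : ℝ => Φ (y, s)) = _) ▸ this)
  have hGc : HasCompactSupport fun s : ℝ => g (Φ (y, s)) := by
    refine hgc.comp_isClosedEmbedding (g := fun s : ℝ => Φ (y, s))
      ((isClosedEmbedding_frame A).comp ?_)
    exact (Function.LeftInverse.isClosedEmbedding (f := Prod.snd) (g := fun s : ℝ => (y, s))
      (fun s => rfl) continuous_snd (by fun_prop))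
  have hder : ∀ s, deriv (fun s : ℝ => g (Φ (y, s))) s = fderiv ℝ g (Φ (y, s)) e := by
    intro s
    have h1 : HasDerivAt (fun s : ℝ => Φ (y, s)) e s := by
      rw [show (fun s : ℝ => Φ (y, s)) = fun s => Φ (y, 0) + s • e from funext hline]
      simpa using ((hasDerivAt_id s).smul_const e).const_add (Φ (y, 0))
    exact (((hg.differentiable (by simp)) (Φ (y, s))).hasFDerivAt.comp_hasDerivAt s h1).deriv
  have := HasCompactSupport.integral_Iic_deriv_eq hG hGc (h y)
  simp_rw [hder] at this
  change _ = g (Φ (y, h y))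
  rw [← this, ← integral_Iic_eq_integral_Iio' (by simp) |>.symm,
    ← integral_indicator measurableSet_Iio]
  refine integral_congr_ae (Filter.Eventually.of_forall fun s => ?_)
  simp only [indicator, mem_preimage, subgraph, mem_ofPred_eq, vert_apply, horiz_apply, mem_Iio]

/-- If `w` points out of a Lipschitz subgraph then the integral of `∂_w g` is nonnegative for
`g ≥ 0`, because translating the subgraph along `w` enlarges it. -/
theorem integral_subgraph_fderiv_nonneg {ε : NNReal} (hh : LipschitzWith ε h) {g : Space n → ℝ}
    (hg : ContDiff ℝ 1 g) (hgc : HasCompactSupport g) (hg0 : ∀ x, 0 ≤ g x) {w : Space n}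
    (hw : ε * ‖horiz A w‖ ≤ vert A w) :
    0 ≤ ∫ x in subgraph A h, fderiv ℝ g x w := by
  obtain ⟨K, hK⟩ := hg.lipschitzWith_of_hasCompactSupport hgc (by simp)
  set S := Metric.cthickening (‖w‖) (tsupport g) with hS
  have hScomp : IsCompact S := IsCompact.cthickening hgc
  have hgint : Integrable g := hg.continuous.integrable_of_hasCompactSupport hgc
  have hder : HasDerivAt (fun r : ℝ => ∫ x in subgraph A h, g (x + r • w))
      (∫ x in subgraph A h, fderiv ℝ g x w) 0 := by
    refine (hasDerivAt_integral_of_dominated_loc_of_lip (F := fun r x => g (x + r • w))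
      (bound := S.indicator fun _ => K * ‖w‖) (Metric.ball_mem_nhds 0 one_pos) ?_ ?_ ?_ ?_ ?_ ?_).2
    · exact Filter.Eventually.of_forall fun r =>
        (hg.continuous.comp (by fun_prop)).aestronglyMeasurable
    · simpa using! hgint.integrableOn (s := subgraph A h)
    · exact ((hg.continuous_fderiv (by simp)).clm_apply continuous_const).aestronglyMeasurable
    · refine Filter.Eventually.of_forall fun x => ?_
      by_cases hx : x ∈ S
      · rw [indicator_of_mem hx]
        refine LipschitzOnWith.of_dist_le_mul fun r _ r' _ => ?_
        refine (hK.dist_le_mul _ _).trans ?_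
        rw [Real.coe_nnabs, abs_of_nonneg (by positivity), dist_add_left, dist_eq_norm, ← sub_smul,
          norm_smul, dist_eq_norm]
        apply le_of_eq; ring
      · rw [indicator_of_notMem hx]
        have : ∀ r ∈ Metric.ball (0 : ℝ) 1, g (x + r • w) = 0 := by
          intro r hr
          by_contra hne
          refine hx (Metric.mem_cthickening_of_dist_le x (x + r • w) _ _
            (subset_tsupport g hne) ?_)
          rw [dist_self_add_right, norm_smul]
          exact mul_le_of_le_one_left (norm_nonneg _) (by simpa using (Metric.mem_ball.1 hr).le)
        refine LipschitzOnWith.of_dist_le_mul fun r hr r' hr' => ?_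
        simp only [this r hr, this r' hr', dist_self]
        positivity
    · exact ((integrable_indicator_iff hScomp.isClosed.measurableSet).2
        (integrableOn_const hScomp.measure_lt_top.ne)).integrableOn
    · refine Filter.Eventually.of_forall fun x => ?_
      have h1 : HasDerivAt (fun r : ℝ => x + r • w) w 0 := by
        simpa using ((hasDerivAt_id (0 : ℝ)).smul_const w).const_add x
      have h2 : HasFDerivAt g (fderiv ℝ g x) (x + (0 : ℝ) • w) := by
        simpa using ((hg.differentiable (by simp)) x).hasFDerivAt
      exact h2.comp_hasDerivAt (0 : ℝ) h1
  have hmono : ∀ r : ℝ, 0 ≤ r → ∫ x in subgraph A h, g x ≤ ∫ x in subgraph A h, g (x + r • w) := by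
    intro r hr
    have hsub : subgraph A h ⊆ (fun x => x - r • w) ⁻¹' subgraph A h := by
      intro x hx
      have h1 := hh.dist_le_mul (horiz A x) (horiz A (x - r • w))
      rw [horiz_sub, horiz_smul, dist_eq_norm, dist_eq_norm, sub_sub_cancel, norm_smul,
        Real.norm_eq_abs, Real.norm_eq_abs, abs_of_nonneg hr] at h1
      have h2 := (abs_le.1 h1).2
      have h3 : vert A x < h (horiz A x) := hx
      change vert A (x - r • w) < h (horiz A (x - r • w))
      rw [vert_sub, vert_smul, horiz_sub, horiz_smul]
      nlinarith [mul_le_mul_of_nonneg_left hw hr]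
    have htr : ∫ x in subgraph A h, g (x + r • w)
        = ∫ x in (fun x => x - r • w) ⁻¹' subgraph A h, g x := by
      have mp : MeasurePreserving (fun x : Space n => x + r • w) :=
        measurePreserving_add_right volume (r • w)
      rw [← mp.setIntegral_preimage_emb (Homeomorph.addRight (r • w)).measurableEmbedding g
        ((fun x => x - r • w) ⁻¹' subgraph A h), ← preimage_comp]
      simp [Function.comp_def]
    rw [htr]
    exact setIntegral_mono_set hgint.integrableOn (Filter.Eventually.of_forall hg0)
      (LE.le.eventuallyLE hsub)
  have hs := (hasDerivAt_iff_tendsto_slope_zero.1 hder).mono_left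
    (nhdsWithin_mono (0 : ℝ) (fun s (hs : 0 < s) => ne_of_gt hs) : nhdsWithin (0 : ℝ) (Ioi 0) ≤ _)
  refine ge_of_tendsto hs ?_
  filter_upwards [self_mem_nhdsWithin] with r hr
  have hr : 0 < r := hr
  have := hmono r hr.le
  simp only [zero_add, zero_smul, add_zero, smul_eq_mul]
  exact mul_nonneg (inv_nonneg.2 hr.le) (sub_nonneg.2 this)

/-- On the subgraph of an `ε`-Lipschitz function, the derivative in any direction `w` integrates to
its vertical part up to an error controlled by `ε`. -/
theorem abs_integral_subgraph_fderiv_sub_le {ε : NNReal} (hh : LipschitzWith ε h) {g : Space n → ℝ}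
    (hg : ContDiff ℝ 1 g) (hgc : HasCompactSupport g) (hg0 : ∀ x, 0 ≤ g x) {w : Space n}
    (hw : ‖w‖ ≤ 1) :
    |(∫ x in subgraph A h, fderiv ℝ g x w) - vert A w * ∫ y, g (graphMap A h y)|
      ≤ ε * ∫ y, g (graphMap A h y) := by
  set e := A (WithLp.toLp 2 ((0 : EuclideanSpace ℝ (Fin n)), (1 : ℝ))) with he
  have hint : ∀ v, IntegrableOn (fun x => fderiv ℝ g x v) (subgraph A h) := fun v =>
    (((hg.continuous_fderiv (by simp)).clm_apply continuous_const).integrable_of_hasCompactSupport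
      (hgc.fderiv_apply ℝ v)).integrableOn
  have hv := integral_subgraph_fderiv_vertical A hh.continuous hg hgc
  rw [← he] at hv
  -- Nonnegativity of the integral in the two outward directions `(ε - w_v) e + w` and
  -- `(ε + w_v) e - w`, with `w_v` the vertical part of `w`, gives the two bounds.
  have key : ∀ (c d : ℝ), 0 ≤ ∫ x in subgraph A h, fderiv ℝ g x (c • e + d • w) →
      0 ≤ c * (∫ y, g (graphMap A h y)) + d * ∫ x in subgraph A h, fderiv ℝ g x w := by
    intro c d hcd
    simp only [map_add, map_smul, smul_eq_mul] at hcd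
    rwa [integral_add ((hint e).const_mul c) ((hint w).const_mul d), integral_const_mul,
      integral_const_mul, hv] at hcd
  have hE : horiz A e = 0 ∧ vert A e = 1 := by simp [he]
  have hp : ‖horiz A w‖ ≤ 1 := (norm_horiz_le A w).trans hw
  have hadd : ∀ x y : Space n, horiz A (x + y) = horiz A x + horiz A y := by simp [horiz]
  have vadd : ∀ x y : Space n, vert A (x + y) = vert A x + vert A y := by simp [vert]
  have k1 := key (ε - vert A w) 1 (integral_subgraph_fderiv_nonneg A hh hg hgc hg0 (by
    rw [hadd, vadd, horiz_smul, horiz_smul, vert_smul, vert_smul, hE.1, hE.2]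
    simp only [smul_zero, one_smul, zero_add]
    nlinarith [ε.coe_nonneg]))
  have k2 := key (ε + vert A w) (-1) (integral_subgraph_fderiv_nonneg A hh hg hgc hg0 (by
    rw [hadd, vadd, horiz_smul, horiz_smul, vert_smul, vert_smul, hE.1, hE.2]
    simp only [smul_zero, neg_smul, one_smul, zero_add, norm_neg]
    nlinarith [ε.coe_nonneg]))
  rw [abs_le]
  constructor <;> linarith

theorem lipschitzWith_graphMap {ε : NNReal} (hh : LipschitzWith ε h) :
    LipschitzWith (1 + ε) (graphMap A h) := by
  refine LipschitzWith.of_dist_le_mul fun y z => ?_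
  rw [dist_eq_norm]
  refine (norm_le_horiz_add_vert A _).trans ?_
  rw [horiz_sub, vert_sub]
  simp only [graphMap, horiz_apply, vert_apply]
  have := hh.dist_le_mul y z
  rw [Real.dist_eq] at this
  rw [← dist_eq_norm]
  push_cast
  linarith

theorem LipschitzWith.euclideanHausdorffMeasure_image_le {X Y : Type*} [EMetricSpace X]
    [MeasurableSpace X] [BorelSpace X] [EMetricSpace Y] [MeasurableSpace Y] [BorelSpace Y]
    {K : NNReal} {f : X → Y} (hf : LipschitzWith K f) (d : ℕ) (s : Set X) :
    μHE[d] (f '' s) ≤ (K : ENNReal) ^ d * μHE[d] s := by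
  rw [Measure.euclideanHausdorffMeasure_def, Measure.euclideanHausdorffMeasure_def,
    Measure.smul_apply, Measure.smul_apply, ENNReal.smul_def, ENNReal.smul_def, smul_eq_mul,
    smul_eq_mul, mul_left_comm]
  gcongr
  simpa using hf.hausdorffMeasure_image_le (d := d) (by positivity) s

/-- Orthogonal projection of the graph to its base does not increase Hausdorff measure. -/
theorem map_graphMap_le {ε : NNReal} (hh : LipschitzWith ε h) :
    volume.map (graphMap A h) ≤ (μHE[n]).restrict (range (graphMap A h)) := by
  have hm : Measurable (graphMap A h) := (continuous_graphMap A hh.continuous).measurable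
  refine Measure.le_iff.2 fun s hs => ?_
  rw [Measure.map_apply hm hs, Measure.restrict_apply hs]
  have himg : graphMap A h ⁻¹' s = horiz A '' (s ∩ range (graphMap A h)) := by
    ext y
    constructor
    · intro hy; exact ⟨graphMap A h y, ⟨hy, mem_range_self y⟩, by simp [graphMap]⟩
    · rintro ⟨_, ⟨hx, ⟨z, rfl⟩⟩, rfl⟩
      simpa [graphMap] using hx
  have hP : LipschitzWith 1 (horiz A) := LipschitzWith.of_dist_le_mul fun x y => by
    rw [dist_eq_norm, dist_eq_norm, ← horiz_sub, NNReal.coe_one, one_mul]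
    exact norm_horiz_le A _
  rw [himg, ← EuclideanSpace.euclideanHausdorffMeasure_eq_volume]
  simpa using LipschitzWith.euclideanHausdorffMeasure_image_le hP n (s ∩ range (graphMap A h))

/-- The parametrization of the graph of an `ε`-Lipschitz function, being `(1 + ε)`-Lipschitz,
increases Hausdorff measure by a factor of at most `(1 + ε) ^ n`. -/
theorem restrict_range_graphMap_le {ε : NNReal} (hh : LipschitzWith ε h) :
    (μHE[n]).restrict (range (graphMap A h)) ≤
      ((1 + ε) ^ n : NNReal) • volume.map (graphMap A h) := by
  have hm : Measurable (graphMap A h) := (continuous_graphMap A hh.continuous).measurable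
  refine Measure.le_iff.2 fun s hs => ?_
  rw [Measure.smul_apply, Measure.map_apply hm hs, Measure.restrict_apply hs,
    ← image_preimage_eq_inter_range, ← EuclideanSpace.euclideanHausdorffMeasure_eq_volume]
  refine (LipschitzWith.euclideanHausdorffMeasure_image_le (lipschitzWith_graphMap A hh) n _).trans
    (le_of_eq ?_)
  rw [ENNReal.smul_def, smul_eq_mul, ENNReal.coe_pow]

theorem integrable_restrict_range_graphMap {ε : NNReal} (hh : LipschitzWith ε h) {g : Space n → ℝ}
    (hg : Continuous g) (hgc : HasCompactSupport g) :
    Integrable g ((μHE[n]).restrict (range (graphMap A h))) := by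
  have hc := continuous_graphMap A hh.continuous
  have h1 : Integrable (g ∘ graphMap A h) :=
    (hg.comp hc).integrable_of_hasCompactSupport
      (hgc.comp_isClosedEmbedding (isClosedEmbedding_graphMap A hh.continuous))
  have h2 : Integrable g (volume.map (graphMap A h)) :=
    (integrable_map_measure hg.aestronglyMeasurable hc.aemeasurable).2 h1
  exact (h2.smul_measure_nnreal (c := (1 + ε) ^ n)).mono_measure (restrict_range_graphMap_le A hh)

/-- The Hausdorff measure of the graph of an `ε`-Lipschitz function is comparable with the Lebesgue
measure of the base, with constants tending to `1` as `ε → 0`. -/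
theorem integral_graphMap_compare {ε : NNReal} (hh : LipschitzWith ε h) {g : Space n → ℝ}
    (hg : Continuous g) (hgc : HasCompactSupport g) (hg0 : ∀ x, 0 ≤ g x) :
    ∫ y, g (graphMap A h y) ≤ ∫ x in range (graphMap A h), g x ∂μHE[n] ∧
    ∫ x in range (graphMap A h), g x ∂μHE[n] ≤ (1 + ε) ^ n * ∫ y, g (graphMap A h y) := by
  have hc := continuous_graphMap A hh.continuous
  have hint := integrable_restrict_range_graphMap A hh hg hgc
  have h2 : Integrable g (volume.map (graphMap A h)) := hint.mono_measure (map_graphMap_le A hh)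
  have hmap : ∫ y, g (graphMap A h y) = ∫ x, g x ∂(volume.map (graphMap A h)) :=
    (integral_map hc.aemeasurable hg.aestronglyMeasurable).symm
  rw [hmap]
  constructor
  · exact integral_mono_measure (map_graphMap_le A hh) (Filter.Eventually.of_forall hg0) hint
  · refine (integral_mono_measure (restrict_range_graphMap_le A hh)
      (Filter.Eventually.of_forall hg0) (h2.smul_measure_nnreal (c := (1 + ε) ^ n))).trans
      (le_of_eq ?_)
    rw [integral_smul_nnreal_measure, NNReal.smul_def]
    simp

end Subgraph

/-! ### Defining functions and the outer unit normal -/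

theorem IsLocalDefiningFunction.contDiffAt {Ω : Set (Space n)} {x : Space n} {ρ : Space n → ℝ}
    (h : IsLocalDefiningFunction Ω x ρ) : ContDiffAt ℝ ∞ ρ x := by
  obtain ⟨-, U, hU, hx, hρ, -⟩ := h
  exact hρ.contDiffAt (hU.mem_nhds hx)

theorem continuousAt_gradient {ρ : Space n → ℝ} {x : Space n} (h : ContDiffAt ℝ ∞ ρ x) :
    ContinuousAt (∇ ρ) x := by
  have h1 : ContinuousAt (fderiv ℝ ρ) x :=
    (h.fderiv_right (m := 0) (by simp)).continuousAt
  exact ((InnerProductSpace.toDual ℝ (Space n)).symm.continuous.continuousAt).comp h1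

theorem IsLocalDefiningFunction.eventually {Ω : Set (Space n)} {x : Space n} {ρ : Space n → ℝ}
    (h : IsLocalDefiningFunction Ω x ρ) : ∀ᶠ y in nhds x, IsLocalDefiningFunction Ω y ρ := by
  have hc := continuousAt_gradient h.contDiffAt
  obtain ⟨hne, U, hU, hx, hρ, he⟩ := h
  filter_upwards [hc.eventually_ne hne, hU.mem_nhds hx] with y hy hyU
  exact ⟨hy, U, hU, hyU, hρ, he⟩

/-- A zero of a defining function is a boundary point, because the defining function is negative at
nearby points in the direction `-∇ρ`. -/
theorem IsLocalDefiningFunction.mem_frontier {Ω : Set (Space n)} {x : Space n} {ρ : Space n → ℝ}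
    (hΩ : IsOpen Ω) (h : IsLocalDefiningFunction Ω x ρ) (h0 : ρ x = 0) : x ∈ frontier Ω := by
  have hd : DifferentiableAt ℝ ρ x := h.contDiffAt.differentiableAt (by simp)
  obtain ⟨hne, U, hU, hxU, hρ, he⟩ := h
  rw [hΩ.frontier_eq]
  refine ⟨?_, fun hx => absurd ((he x hxU).1 hx) (by simp [h0])⟩
  set v := -∇ ρ x
  have hl : HasDerivAt (fun s : ℝ => x + s • v) v 0 := by
    simpa using ((hasDerivAt_id (0 : ℝ)).smul_const v).const_add x
  have hg : HasFDerivAt ρ (fderiv ℝ ρ x) (x + (0 : ℝ) • v) := by simpa using hd.hasFDerivAt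
  have hder : HasDerivAt (fun s : ℝ => ρ (x + s • v)) (fderiv ℝ ρ x v) 0 :=
    hg.comp_hasDerivAt (0 : ℝ) hl
  have hneg : fderiv ℝ ρ x v < 0 := by
    rw [← inner_gradient_left, inner_neg_right, real_inner_self_eq_norm_sq, neg_lt_zero]
    exact pow_pos (norm_pos_iff.2 hne) 2
  have hs := ((hasDerivAt_iff_tendsto_slope_zero.1 hder).mono_left
    (nhdsWithin_mono (0 : ℝ) (fun s (hs : 0 < s) => ne_of_gt hs) :
      nhdsWithin (0 : ℝ) (Ioi 0) ≤ _)).eventually (gt_mem_nhds hneg)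
  have hcont : Filter.Tendsto (fun s : ℝ => x + s • v) (nhdsWithin 0 (Ioi 0)) (nhds x) := by
    have : Continuous (fun s : ℝ => x + s • v) := by fun_prop
    simpa using (this.tendsto 0).mono_left nhdsWithin_le_nhds
  refine mem_closure_of_tendsto hcont ?_
  filter_upwards [hs, hcont.eventually (hU.mem_nhds hxU), self_mem_nhdsWithin] with s h1 h2 h3
  have h3 : 0 < s := h3
  simp only [zero_add, zero_smul, add_zero, h0, sub_zero, smul_eq_mul] at h1
  refine (he _ h2).2 ?_
  by_contra! hc
  exact absurd h1 (not_lt.2 (mul_nonneg (inv_nonneg.2 h3.le) hc))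

theorem IsLocalDefiningFunction.eventually_frontier {Ω : Set (Space n)} {x : Space n}
    {ρ : Space n → ℝ} (hΩ : IsOpen Ω) (h : IsLocalDefiningFunction Ω x ρ) :
    ∀ᶠ y in nhds x, y ∈ frontier Ω ↔ ρ y = 0 := by
  filter_upwards [h.eventually] with y hy
  exact ⟨fun h' => hy.eq_zero hΩ h', fun h' => hy.mem_frontier hΩ h'⟩

theorem norm_outerUnitNormal {Ω : Set (Space n)} (hΩ : IsBoundedSmoothDomain Ω) {x : Space n}
    (hx : x ∈ frontier Ω) : ‖outerUnitNormal Ω x‖ = 1 := by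
  obtain ⟨ρ, h⟩ := hΩ.smooth_boundary x hx
  rw [outerUnitNormal_eq hΩ.isOpen hx h, norm_smul, norm_inv, norm_norm,
    inv_mul_cancel₀ (norm_ne_zero_iff.2 h.1)]

theorem continuousOn_outerUnitNormal {Ω : Set (Space n)} (hΩ : IsBoundedSmoothDomain Ω) :
    ContinuousOn (outerUnitNormal Ω) (frontier Ω) := by
  intro x hx
  obtain ⟨ρ, h⟩ := hΩ.smooth_boundary x hx
  have hc := continuousAt_gradient h.contDiffAt
  have hc' : ContinuousAt (fun y => ‖∇ ρ y‖⁻¹ • ∇ ρ y) x :=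
    (hc.norm.inv₀ (norm_ne_zero_iff.2 h.1)).smul hc
  refine hc'.continuousWithinAt.congr_of_eventuallyEq ?_ (outerUnitNormal_eq hΩ.isOpen hx h)
  filter_upwards [nhdsWithin_le_nhds h.eventually, self_mem_nhdsWithin] with y hy hyM
  exact outerUnitNormal_eq hΩ.isOpen hyM hy

theorem IsBoundedSmoothDomain.isCompact_closure {Ω : Set (Space n)}
    (hΩ : IsBoundedSmoothDomain Ω) : IsCompact (closure Ω) :=
  hΩ.isBounded.isCompact_closure

theorem IsBoundedSmoothDomain.isCompact_frontier {Ω : Set (Space n)}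
    (hΩ : IsBoundedSmoothDomain Ω) : IsCompact (frontier Ω) :=
  hΩ.isCompact_closure.of_isClosed_subset isClosed_frontier frontier_subset_closure

/-! ### The boundary as a nearly flat graph over the tangent plane -/

/-- Every unit vector is the vertical direction of an orthonormal frame: a reflection moves the
vertical direction of any given frame to it. -/
theorem exists_frame {e : Space n} (he : ‖e‖ = 1) :
    ∃ A : WithLp 2 (EuclideanSpace ℝ (Fin n) × ℝ) ≃ₗᵢ[ℝ] Space n,
      A (WithLp.toLp 2 (0, 1)) = e := by
  have hfr : Module.finrank ℝ (WithLp 2 (EuclideanSpace ℝ (Fin n) × ℝ))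
      = Module.finrank ℝ (Space n) := by
    rw [(WithLp.linearEquiv 2 ℝ (EuclideanSpace ℝ (Fin n) × ℝ)).finrank_eq]; simp
  let B : WithLp 2 (EuclideanSpace ℝ (Fin n) × ℝ) ≃ₗᵢ[ℝ] Space n :=
    (stdOrthonormalBasis ℝ _).equiv (stdOrthonormalBasis ℝ _) (finCongr hfr)
  set b := B (WithLp.toLp 2 (0, 1))
  have hb : ‖b‖ = ‖e‖ := by
    rw [he, B.norm_map]
    simp
  exact ⟨B.trans (ℝ ∙ (b - e))ᗮ.reflection, by simp [b]; exact Submodule.reflection_sub hb⟩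

/-- A smooth domain is, near each boundary point, the subgraph of an `ε`-Lipschitz function over the
tangent plane, with normal `ε`-close to the normal at that point. -/
theorem exists_local_graph {Ω : Set (Space n)} (hΩ : IsBoundedSmoothDomain Ω) {x₀ : Space n}
    (hx₀ : x₀ ∈ frontier Ω) {ε : NNReal} (hε : 0 < ε) (hε1 : ε ≤ 1) :
    ∃ (A : WithLp 2 (EuclideanSpace ℝ (Fin n) × ℝ) ≃ₗᵢ[ℝ] Space n)
      (h : EuclideanSpace ℝ (Fin n) → ℝ) (U : Set (Space n)), IsOpen U ∧ x₀ ∈ U ∧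
      Bornology.IsBounded U ∧ LipschitzWith ε h ∧
      (∀ x ∈ U, x ∈ Ω ↔ x ∈ subgraph A h) ∧ (∀ x ∈ U, x ∈ frontier Ω ↔ x ∈ range (graphMap A h)) ∧
      ∀ x ∈ U, x ∈ frontier Ω → ‖outerUnitNormal Ω x - A (WithLp.toLp 2 (0, 1))‖ ≤ ε := by
  obtain ⟨ρ₀, hρ₀⟩ := hΩ.smooth_boundary x₀ hx₀
  set e := outerUnitNormal Ω x₀ with he
  have he1 : ‖e‖ = 1 := norm_outerUnitNormal hΩ hx₀
  obtain ⟨A, hA⟩ := exists_frame he1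
  have hg0 : 0 < ‖∇ ρ₀ x₀‖ := norm_pos_iff.2 hρ₀.1
  -- The defining function is normalized so that its gradient at the base point is the normal.
  set ρ : Space n → ℝ := fun x => ‖∇ ρ₀ x₀‖⁻¹ * ρ₀ x with hρdef
  have hstrict : HasStrictFDerivAt ρ (InnerProductSpace.toDual ℝ (Space n) e) x₀ := by
    have h1 : HasStrictFDerivAt ρ₀ (fderiv ℝ ρ₀ x₀) x₀ :=
      hρ₀.contDiffAt.hasStrictFDerivAt (by simp)
    have h2 := h1.const_mul (‖∇ ρ₀ x₀‖⁻¹)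
    refine h2.congr_fderiv (ContinuousLinearMap.ext fun v => ?_)
    rw [InnerProductSpace.toDual_apply_apply, he, outerUnitNormal_eq hΩ.isOpen hx₀ hρ₀,
      real_inner_smul_left, inner_gradient_left]
    simp
  have hsign : ∀ x, (ρ x < 0 ↔ ρ₀ x < 0) ∧ (ρ x = 0 ↔ ρ₀ x = 0) := by
    intro x
    have := inv_pos.2 hg0
    exact ⟨by rw [hρdef]; constructor <;> intro h <;> nlinarith, by simp [hρdef, hg0.ne']⟩
  set δ : NNReal := ε / (1 + ε) with hδ
  have hδ' : (δ : ℝ) * (1 + ε) = ε := by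
    rw [hδ]; push_cast; field_simp
  have hεr : (0 : ℝ) < ε := hε
  have hεr1 : (ε : ℝ) ≤ 1 := hε1
  have hδpos : (0 : ℝ) < δ := by
    by_contra! hc
    nlinarith
  have hδ2 : (δ : ℝ) ≤ 1 / 2 := by nlinarith
  obtain ⟨s, hs, happ⟩ := hstrict.approximates_deriv_on_nhds (c := δ) (Or.inr hδpos)
  have hball : ∀ᶠ x in nhds x₀, x ∈ s ∧ (x ∈ Ω ↔ ρ x < 0) ∧ (x ∈ frontier Ω ↔ ρ x = 0) ∧
      (x ∈ frontier Ω → ‖outerUnitNormal Ω x - e‖ ≤ ε) := by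
    have hn : ∀ᶠ x in nhds x₀, x ∈ frontier Ω → ‖outerUnitNormal Ω x - e‖ ≤ ε := by
      have h1 := Metric.continuousWithinAt_iff.1 (continuousOn_outerUnitNormal hΩ x₀ hx₀) ε hεr
      obtain ⟨d, hd, h1⟩ := h1
      filter_upwards [Metric.ball_mem_nhds x₀ hd] with x hx hxM
      rw [← dist_eq_norm]
      exact (h1 hxM hx).le
    have hin : ∀ᶠ x in nhds x₀, x ∈ Ω ↔ ρ₀ x < 0 := by
      obtain ⟨-, U, hU, hx, -, h⟩ := hρ₀
      filter_upwards [hU.mem_nhds hx] with x hx using h x hx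
    filter_upwards [hs, hin, hρ₀.eventually_frontier hΩ.isOpen, hn] with x h1 h2 h3 h4
    exact ⟨h1, h2.trans (hsign x).1.symm, h3.trans (hsign x).2.symm, h4⟩
  obtain ⟨r, hr, hball⟩ := Metric.eventually_nhds_iff.1 hball
  -- On the ball, the defining function is close to its linearization, the vertical coordinate.
  have hlin : ∀ x y : Space n, dist x x₀ < r → dist y x₀ < r →
      |ρ x - ρ y - (vert A x - vert A y)|
        ≤ δ * (‖horiz A x - horiz A y‖ + |vert A x - vert A y|) := by
    intro x y hx hy
    have h1 := happ x (hball hx).1 y (hball hy).1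
    rw [InnerProductSpace.toDual_apply_apply, ← hA, inner_vert, vert_sub] at h1
    refine h1.trans (mul_le_mul_of_nonneg_left ?_ hδpos.le)
    rw [← horiz_sub, ← vert_sub]
    exact norm_le_horiz_add_vert A _
  have hlip : ∀ x y : Space n, dist x x₀ < r → dist y x₀ < r → ρ x = 0 → ρ y = 0 →
      |vert A x - vert A y| ≤ ε * ‖horiz A x - horiz A y‖ := by
    intro x y hx hy h0x h0y
    have h1 := hlin x y hx hy
    rw [h0x, h0y, sub_zero, zero_sub, abs_neg] at h1
    nlinarith [abs_nonneg (vert A x - vert A y), norm_nonneg (horiz A x - horiz A y)]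
  set Z : Set (Space n) := {x | dist x x₀ < r ∧ ρ x = 0} with hZ
  have hsel : ∀ y ∈ horiz A '' Z, ∃ x ∈ Z, horiz A x = y := fun y hy => hy
  choose! sel hselZ hsel using hsel
  have hLip : LipschitzOnWith ε (fun y => vert A (sel y)) (horiz A '' Z) :=
    LipschitzOnWith.of_dist_le_mul fun y hy z hz => by
      have := hlip _ _ (hselZ y hy).1 (hselZ z hz).1 (hselZ y hy).2 (hselZ z hz).2
      rwa [hsel y hy, hsel z hz, ← dist_eq_norm, ← Real.dist_eq] at this
  obtain ⟨h, hh, heq⟩ := hLip.extend_real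
  have hgraph : ∀ x ∈ Z, vert A x = h (horiz A x) := by
    intro x hx
    have hy : horiz A x ∈ horiz A '' Z := mem_image_of_mem _ hx
    have h1 := hlip x _ hx.1 (hselZ _ hy).1 hx.2 (hselZ _ hy).2
    rw [hsel _ hy, sub_self, norm_zero, mul_zero] at h1
    rw [← heq hy]
    linarith [abs_nonpos_iff.1 h1]
  have hdist : ∀ x, ‖horiz A x - horiz A x₀‖ < r / 4 → |vert A x - vert A x₀| ≤ r / 2 →
      dist x x₀ < r := by
    intro x h1 h2
    rw [dist_eq_norm]
    have := norm_le_horiz_add_vert A (x - x₀)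
    rw [horiz_sub, vert_sub] at this
    linarith
  have hρx₀ : ρ x₀ = 0 := (hsign x₀).2.2 (hρ₀.eq_zero hΩ.isOpen hx₀)
  refine ⟨A, h, {x | ‖horiz A x - horiz A x₀‖ < r / 4 ∧ |vert A x - vert A x₀| < r / 2},
    ?_, ?_, ?_, hh, ?_, ?_, ?_⟩
  · exact (isOpen_lt ((continuous_horiz A).sub continuous_const).norm continuous_const).inter
      (isOpen_lt ((continuous_vert A).sub continuous_const).abs continuous_const)
  · constructor <;> simp [hr]
  · refine (Metric.isBounded_ball (x := x₀) (r := r)).subset fun x hx => ?_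
    exact hdist x hx.1 hx.2.le
  all_goals
    intro x hx
    have hxr := hdist x hx.1 hx.2.le
    -- The vertical line through `x` meets the zero set, by the intermediate value theorem.
    obtain ⟨z, hzZ, hz⟩ : ∃ z ∈ Z, horiz A z = horiz A x := by
      let c : ℝ → Space n := fun s => A (WithLp.toLp 2 (horiz A x, vert A x₀ + s))
      have hc : Continuous c :=
        A.continuous.comp ((WithLp.prod_continuous_toLp 2 _ _).comp (by fun_prop))
      have hcr : ∀ s ∈ Icc (-(r / 2)) (r / 2), dist (c s) x₀ < r := fun s hs =>
        hdist _ (by simpa [c] using hx.1) (by simpa [c, abs_le] using hs)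
      have hcont : ContinuousOn (fun s => ρ (c s)) (Icc (-(r / 2)) (r / 2)) := by
        refine (happ.continuousOn).comp hc.continuousOn fun s hs => (hball (hcr s hs)).1
      have hend : ∀ s ∈ Icc (-(r / 2)) (r / 2), |ρ (c s) - s| ≤ δ * (r / 4 + |s|) := by
        intro s hs
        have h1 := hlin (c s) x₀ (hcr s hs) (by simpa using hr)
        simp only [c, horiz_apply, vert_apply, add_sub_cancel_left, hρx₀, sub_zero] at h1
        exact h1.trans (by gcongr; exact hx.1.le)
      have hm : (-(r / 2)) ∈ Icc (-(r / 2)) (r / 2) := ⟨le_rfl, by linarith⟩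
      have hp : (r / 2) ∈ Icc (-(r / 2)) (r / 2) := ⟨by linarith, le_rfl⟩
      have h1 := (abs_le.1 (hend _ hm)).2
      have h2 := (abs_le.1 (hend _ hp)).1
      rw [abs_neg, abs_of_pos (by linarith : 0 < r / 2)] at h1
      rw [abs_of_pos (by linarith : 0 < r / 2)] at h2
      have h3 : δ * (r / 4 + r / 2) ≤ 1 / 2 * (r / 4 + r / 2) := by gcongr
      obtain ⟨s, hs, hs0⟩ := intermediate_value_Icc (by linarith) hcont
        (show (0 : ℝ) ∈ Icc _ _ from ⟨by linarith, by linarith⟩)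
      exact ⟨c s, ⟨hcr s hs, hs0⟩, by simp [c]⟩
    have hzx := hlin x z hxr hzZ.1
    rw [hz, hzZ.2, sub_self, norm_zero, zero_add, sub_zero, hgraph z hzZ, hz] at hzx
  · rw [(hball hxr).2.1, subgraph, mem_ofPred_eq]
    constructor
    · intro hneg
      by_contra! hc
      rw [abs_of_nonneg (sub_nonneg.2 hc)] at hzx
      nlinarith [(abs_le.1 hzx).1]
    · intro hlt
      rw [abs_of_neg (sub_neg.2 hlt)] at hzx
      nlinarith [(abs_le.1 hzx).2]
  · rw [(hball hxr).2.2.1, mem_range_graphMap]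
    constructor
    · intro h0; exact hgraph x ⟨hxr, h0⟩
    · intro hv
      rw [hv, sub_self, sub_zero, abs_zero, mul_zero] at hzx
      exact abs_nonpos_iff.1 hzx
  · rw [hA]
    exact (hball hxr).2.2.2

/-! ### The divergence theorem -/

/-- The boundary is locally a Lipschitz graph over a bounded set, and compact. -/
theorem euclideanHausdorffMeasure_frontier_lt_top {Ω : Set (Space n)}
    (hΩ : IsBoundedSmoothDomain Ω) : μHE[n] (frontier Ω) < ⊤ := by
  refine hΩ.isCompact_frontier.measure_lt_top_of_nhdsWithin fun x hx => ?_
  obtain ⟨A, h, U, hU, hxU, hUb, hh, -, hUM, -⟩ := exists_local_graph hΩ hx one_pos le_rfl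
  refine ⟨frontier Ω ∩ U, Filter.inter_mem self_mem_nhdsWithin
    (mem_nhdsWithin_of_mem_nhds (hU.mem_nhds hxU)), ?_⟩
  have hsub : frontier Ω ∩ U ⊆ U ∩ range (graphMap A h) := fun y hy => ⟨hy.2, (hUM y hy.2).1 hy.1⟩
  refine (measure_mono hsub).trans_lt ?_
  rw [← Measure.restrict_apply hU.measurableSet]
  refine (restrict_range_graphMap_le A hh U).trans_lt ?_
  rw [Measure.smul_apply, Measure.map_apply (continuous_graphMap A hh.continuous).measurable
    hU.measurableSet]
  refine ENNReal.mul_lt_top ENNReal.coe_lt_top (Bornology.IsBounded.measure_lt_top ?_)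
  obtain ⟨R, hR⟩ := hUb.exists_norm_le
  refine isBounded_iff_forall_norm_le.2 ⟨R, fun y hy => ?_⟩
  simpa [graphMap] using (norm_horiz_le A _).trans (hR _ hy)

theorem integrableOn_frontier {Ω : Set (Space n)} (hΩ : IsBoundedSmoothDomain Ω) {g : Space n → ℝ}
    (hg : ContinuousOn g (frontier Ω)) : IntegrableOn g (frontier Ω) μHE[n] :=
  hg.integrableOn_of_subset_isCompact hΩ.isCompact_frontier isClosed_frontier.measurableSet
    Subset.rfl (euclideanHausdorffMeasure_frontier_lt_top hΩ).ne

theorem integrableOn_domain {Ω : Set (Space n)} (hΩ : IsBoundedSmoothDomain Ω) {g : Space n → ℝ}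
    (hg : ContinuousOn g (closure Ω)) : IntegrableOn g Ω :=
  (hg.integrableOn_compact hΩ.isCompact_closure).mono_set subset_closure

theorem exists_small_slope (n : ℕ) {δ : ℝ} (hδ : 0 < δ) :
    ∃ ε : NNReal, 0 < ε ∧ ε ≤ 1 ∧ (ε : ℝ) ≤ δ ∧ (1 + (ε : ℝ)) ^ n ≤ 1 + δ := by
  have hc : ContinuousAt (fun e : ℝ => (1 + e) ^ n) 0 := by fun_prop
  have h1 : ∀ᶠ e : ℝ in nhdsWithin 0 (Ioi 0), (1 + e) ^ n < 1 + δ :=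
    nhdsWithin_le_nhds (hc.eventually (gt_mem_nhds (by simpa using hδ)))
  have h2 : ∀ᶠ e : ℝ in nhdsWithin 0 (Ioi 0), e < min 1 δ :=
    nhdsWithin_le_nhds (gt_mem_nhds (by positivity))
  obtain ⟨e, ⟨h3, h4⟩, h5⟩ := ((h1.and h2).and self_mem_nhdsWithin).exists
  have h5 : 0 < e := h5
  exact ⟨⟨e, h5.le⟩, h5, (h4.trans_le (min_le_left _ _)).le, (h4.trans_le (min_le_right _ _)).le,
    h3.le⟩

/-- Near a boundary point, Gauss' formula holds up to an arbitrarily small relative error: the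
domain is the subgraph of a function with small slope, for which both sides are nearly the
integral over the tangent plane. -/
theorem exists_nhds_abs_integral_fderiv_sub_le {Ω : Set (Space n)} (hΩ : IsBoundedSmoothDomain Ω)
    {x₀ : Space n} (hx₀ : x₀ ∈ frontier Ω) {δ : ℝ} (hδ : 0 < δ) :
    ∃ U : Set (Space n), IsOpen U ∧ x₀ ∈ U ∧ ∀ g : Space n → ℝ, ContDiff ℝ 1 g →
      HasCompactSupport g → (∀ x, 0 ≤ g x) → tsupport g ⊆ U → ∀ w : Space n, ‖w‖ ≤ 1 →
      |(∫ x in Ω, fderiv ℝ g x w) - ∫ x in frontier Ω, g x * ⟪w, outerUnitNormal Ω x⟫ ∂μHE[n]|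
        ≤ δ * ∫ x in frontier Ω, g x ∂μHE[n] := by
  -- Three errors of size `δ / 3`: the derivative over the subgraph, surface measure, the normal.
  obtain ⟨ε, hε, hε1, hεδ, hεn⟩ := exists_small_slope n (δ := δ / 3) (by positivity)
  obtain ⟨A, h, U, hU, hxU, -, hh, hUΩ, hUM, hUν⟩ := exists_local_graph hΩ hx₀ hε hε1
  refine ⟨U, hU, hxU, fun g hg hgc hg0 hgU w hw => ?_⟩
  set e := A (WithLp.toLp 2 ((0 : EuclideanSpace ℝ (Fin n)), (1 : ℝ))) with he
  have e1 : ∫ x in Ω, fderiv ℝ g x w = ∫ x in subgraph A h, fderiv ℝ g x w := by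
    rw [← integral_indicator hΩ.isOpen.measurableSet,
      ← integral_indicator (isOpen_subgraph A hh.continuous).measurableSet]
    congr 1
    ext x
    by_cases hx : x ∈ U
    · by_cases hx' : x ∈ Ω
      · rw [indicator_of_mem hx', indicator_of_mem ((hUΩ x hx).1 hx')]
      · rw [indicator_of_notMem hx', indicator_of_notMem (fun h' => hx' ((hUΩ x hx).2 h'))]
    · have : fderiv ℝ g x w = 0 := by
        rw [image_eq_zero_of_notMem_tsupport (f := fderiv ℝ g)
          (fun h' => hx (hgU (tsupport_fderiv_subset ℝ h')))]
        rfl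
      simp [indicator, this]
  have e2 : ∫ x in frontier Ω, g x ∂μHE[n] = ∫ x in range (graphMap A h), g x ∂μHE[n] := by
    rw [← integral_indicator isClosed_frontier.measurableSet,
      ← integral_indicator (isClosed_range_graphMap A hh.continuous).measurableSet]
    congr 1
    ext x
    by_cases hx : x ∈ U
    · by_cases hx' : x ∈ frontier Ω
      · rw [indicator_of_mem hx', indicator_of_mem ((hUM x hx).1 hx')]
      · rw [indicator_of_notMem hx', indicator_of_notMem (fun h' => hx' ((hUM x hx).2 h'))]
    · have : g x = 0 := image_eq_zero_of_notMem_tsupport fun h' => hx (hgU h')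
      simp [indicator, this]
  have b1 := abs_integral_subgraph_fderiv_sub_le A hh hg hgc hg0 hw
  obtain ⟨b2, b3⟩ := integral_graphMap_compare A hh hg.continuous hgc hg0
  have hν := continuousOn_outerUnitNormal hΩ
  have i1 : IntegrableOn g (frontier Ω) μHE[n] :=
    integrableOn_frontier hΩ hg.continuous.continuousOn
  have i2 : IntegrableOn (fun x => g x * ⟪w, outerUnitNormal Ω x⟫) (frontier Ω) μHE[n] :=
    integrableOn_frontier hΩ (hg.continuous.continuousOn.mul (continuousOn_const.inner hν))
  have b4 : |vert A w * (∫ x in frontier Ω, g x ∂μHE[n])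
      - ∫ x in frontier Ω, g x * ⟪w, outerUnitNormal Ω x⟫ ∂μHE[n]|
        ≤ ε * ∫ x in frontier Ω, g x ∂μHE[n] := by
    rw [← integral_const_mul, ← integral_sub (i1.const_mul _) i2, ← integral_const_mul,
      ← Real.norm_eq_abs]
    refine norm_integral_le_of_norm_le (i1.const_mul _) ?_
    refine (ae_restrict_iff' isClosed_frontier.measurableSet).2 (Filter.Eventually.of_forall ?_)
    intro x hx
    by_cases hxU : x ∈ U
    · have h1 := hUν x hxU hx
      have h2 : vert A w * g x - g x * ⟪w, outerUnitNormal Ω x⟫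
          = -(g x * ⟪w, outerUnitNormal Ω x - e⟫) := by
        rw [inner_sub_right, real_inner_comm e w, inner_vert]; ring
      rw [h2, norm_neg, norm_mul, Real.norm_of_nonneg (hg0 x), mul_comm (ε : ℝ)]
      refine mul_le_mul_of_nonneg_left ?_ (hg0 x)
      refine (norm_inner_le_norm _ _).trans ?_
      nlinarith [norm_nonneg w, norm_nonneg (outerUnitNormal Ω x - e)]
    · have : g x = 0 := image_eq_zero_of_notMem_tsupport fun h' => hxU (hgU h')
      simp [this]
  have hv : |vert A w| ≤ 1 := by
    rw [← inner_vert, ← he]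
    refine (abs_real_inner_le_norm _ _).trans ?_
    have : ‖e‖ = 1 := by rw [he, A.norm_map]; simp
    rw [this, one_mul]; exact hw
  rw [e1]
  rw [← e2] at b2 b3
  set L := ∫ x in subgraph A h, fderiv ℝ g x w
  set I := ∫ y, g (graphMap A h y)
  set J := ∫ x in frontier Ω, g x ∂μHE[n]
  set N := ∫ x in frontier Ω, g x * ⟪w, outerUnitNormal Ω x⟫ ∂μHE[n]
  have hI : 0 ≤ I := integral_nonneg fun y => hg0 _
  have b5 : |vert A w * I - vert A w * J| ≤ J - I := by
    rw [← mul_sub, abs_mul, abs_sub_comm I J, abs_of_nonneg (sub_nonneg.2 b2)]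
    exact mul_le_of_le_one_left (sub_nonneg.2 b2) hv
  have b6 : (1 + (ε : ℝ)) ^ n * I ≤ (1 + δ / 3) * I := mul_le_mul_of_nonneg_right hεn hI
  have b7 : L - N = (L - vert A w * I) + (vert A w * I - vert A w * J) + (vert A w * J - N) := by
    ring
  rw [b7]
  refine (abs_add_three _ _ _).trans ?_
  nlinarith [mul_le_mul_of_nonneg_right hεδ hI, mul_le_mul_of_nonneg_right hεδ (hI.trans b2),
    mul_le_mul_of_nonneg_left b2 hδ.le]

theorem integral_fderiv_eq_zero_of_hasCompactSupport {g : Space n → ℝ} (hg : ContDiff ℝ 1 g)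
    (hgc : HasCompactSupport g) (w : Space n) : ∫ x, fderiv ℝ g x w = 0 := by
  have h1 : Integrable fun x => fderiv ℝ g x w :=
    ((hg.continuous_fderiv (by simp)).clm_apply continuous_const).integrable_of_hasCompactSupport
      (hgc.fderiv_apply ℝ w)
  have := integral_mul_fderiv_eq_neg_fderiv_mul_of_integrable (μ := (volume : Measure (Space n)))
    (f := fun _ => (1 : ℝ)) (g := g) (v := w) (by simp) (by simpa using h1)
    (by simpa using hg.continuous.integrable_of_hasCompactSupport hgc) (by simp)
    (fun x _ => (hg.differentiable (by simp)) x)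
  simpa using this

/-- Near every point of the closed domain, Gauss' formula holds up to a small relative error. -/
theorem exists_nhds_closure_abs_integral_fderiv_sub_le {Ω : Set (Space n)}
    (hΩ : IsBoundedSmoothDomain Ω) {x₀ : Space n} (hx₀ : x₀ ∈ closure Ω) {δ : ℝ} (hδ : 0 < δ) :
    ∃ U : Set (Space n), IsOpen U ∧ x₀ ∈ U ∧ ∀ g : Space n → ℝ, ContDiff ℝ 1 g →
      HasCompactSupport g → (∀ x, 0 ≤ g x) → tsupport g ⊆ U → ∀ w : Space n, ‖w‖ ≤ 1 →
      |(∫ x in Ω, fderiv ℝ g x w) - ∫ x in frontier Ω, g x * ⟪w, outerUnitNormal Ω x⟫ ∂μHE[n]|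
        ≤ δ * ∫ x in frontier Ω, g x ∂μHE[n] := by
  by_cases hx : x₀ ∈ Ω
  -- Both integrals vanish for functions supported in the interior.
  · refine ⟨Ω, hΩ.isOpen, hx, fun g hg hgc hg0 hgU w hw => ?_⟩
    have e1 : ∫ x in Ω, fderiv ℝ g x w = 0 := by
      rw [← integral_fderiv_eq_zero_of_hasCompactSupport hg hgc w]
      refine setIntegral_eq_integral_of_forall_compl_eq_zero fun x hx => ?_
      rw [image_eq_zero_of_notMem_tsupport (f := fderiv ℝ g)
          (fun h' => hx (hgU (tsupport_fderiv_subset ℝ h')))]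
      rfl
    have h0 : ∀ x ∈ frontier Ω, g x = 0 := fun x hx =>
      image_eq_zero_of_notMem_tsupport fun h' =>
        (hΩ.isOpen.frontier_eq ▸ hx : x ∈ closure Ω \ Ω).2 (hgU h')
    rw [e1, setIntegral_eq_zero_of_forall_eq_zero (fun x hx => by rw [h0 x hx, zero_mul]),
      setIntegral_eq_zero_of_forall_eq_zero h0]
    simp
  · exact exists_nhds_abs_integral_fderiv_sub_le hΩ (by rw [hΩ.isOpen.frontier_eq]; exact ⟨hx₀, hx⟩)
      hδ

/-- Gauss' formula for a nonnegative function. A partition of unity adds up the local estimates; as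
their errors are relative to `∫ g` over the boundary, the total error is arbitrarily small, however
many patches there are. -/
theorem integral_fderiv_eq_of_nonneg {Ω : Set (Space n)} (hΩ : IsBoundedSmoothDomain Ω)
    {g : Space n → ℝ} (hg : ContDiff ℝ 1 g) (hgc : HasCompactSupport g) (hg0 : ∀ x, 0 ≤ g x)
    {w : Space n} (hw : ‖w‖ ≤ 1) :
    ∫ x in Ω, fderiv ℝ g x w
      = ∫ x in frontier Ω, g x * ⟪w, outerUnitNormal Ω x⟫ ∂μHE[n] := by
  have hν := continuousOn_outerUnitNormal hΩ
  have key : ∀ δ : ℝ, 0 < δ →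
      |(∫ x in Ω, fderiv ℝ g x w) - ∫ x in frontier Ω, g x * ⟪w, outerUnitNormal Ω x⟫ ∂μHE[n]|
        ≤ δ * ∫ x in frontier Ω, g x ∂μHE[n] := by
    intro δ hδ
    choose! U hUo hxU hU using fun x (hx : x ∈ closure Ω) =>
      exists_nhds_closure_abs_integral_fderiv_sub_le hΩ hx hδ
    obtain ⟨t, htK, ht⟩ := hΩ.isCompact_closure.elim_nhds_subcover U
      fun x hx => (hUo x hx).mem_nhds (hxU x hx)
    obtain ⟨χ, hχ⟩ := SmoothPartitionOfUnity.exists_isSubordinate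
      (modelWithCornersSelf ℝ (Space n)) (isClosed_closure (s := Ω)) (fun i : t => U i)
      (fun i => hUo i (htK i i.2)) (by simpa [iUnion_subtype] using ht)
    have hsum : ∀ x ∈ closure Ω, ∑ i, χ i x = 1 := fun x hx => by
      rw [← finsum_eq_sum_of_fintype]; exact χ.sum_eq_one hx
    have hs : ∀ i, ContDiff ℝ 1 (χ i) := fun i => (χ i).contMDiff.contDiff.of_le (by simp)
    have hs' : ∀ i, ContDiff ℝ 1 fun x => χ i x * g x := fun i => (hs i).mul hg
    have hc' : ∀ i, HasCompactSupport fun x => χ i x * g x := fun i => hgc.mul_left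
    have est := fun i : t => hU i (htK i i.2) (fun x => χ i x * g x) (hs' i) (hc' i)
      (fun x => mul_nonneg (χ.nonneg i x) (hg0 x))
      ((tsupport_mul_subset_left).trans (hχ i)) w hw
    have i0 : ∀ i ∈ Finset.univ, IntegrableOn (fun x => fderiv ℝ (fun x => χ i x * g x) x w) Ω :=
      fun i _ => ((((hs' i).continuous_fderiv (by simp)).clm_apply
        continuous_const).integrable_of_hasCompactSupport ((hc' i).fderiv_apply ℝ w)).integrableOn
    have i1 : ∀ i ∈ Finset.univ, IntegrableOn (fun x => χ i x * g x) (frontier Ω) μHE[n] :=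
      fun i _ => integrableOn_frontier hΩ (hs' i).continuous.continuousOn
    have i2 : ∀ i ∈ Finset.univ, IntegrableOn
        (fun x => χ i x * g x * ⟪w, outerUnitNormal Ω x⟫) (frontier Ω) μHE[n] := fun i _ =>
      integrableOn_frontier hΩ ((hs' i).continuous.continuousOn.mul (continuousOn_const.inner hν))
    have s0 : ∫ x in Ω, fderiv ℝ g x w
        = ∑ i, ∫ x in Ω, fderiv ℝ (fun x => χ i x * g x) x w := by
      rw [← integral_finsetSum _ i0]
      refine setIntegral_congr_fun hΩ.isOpen.measurableSet fun x hx => ?_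
      have : g =ᶠ[nhds x] fun x => ∑ i, χ i x * g x := by
        filter_upwards [hΩ.isOpen.mem_nhds hx] with y hy
        rw [← Finset.sum_mul, hsum y (subset_closure hy), one_mul]
      rw [this.fderiv_eq, fderiv_fun_sum fun i _ => ((hs' i).differentiable (by simp)) x]
      simp
    have hMcl : ∀ x ∈ frontier Ω, g x = ∑ i, χ i x * g x := fun x hx => by
      rw [← Finset.sum_mul, hsum x (frontier_subset_closure hx), one_mul]
    have s1 : ∫ x in frontier Ω, g x ∂μHE[n]
        = ∑ i, ∫ x in frontier Ω, χ i x * g x ∂μHE[n] := by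
      rw [← integral_finsetSum _ i1]
      exact setIntegral_congr_fun isClosed_frontier.measurableSet fun x hx => hMcl x hx
    have s2 : ∫ x in frontier Ω, g x * ⟪w, outerUnitNormal Ω x⟫ ∂μHE[n]
        = ∑ i, ∫ x in frontier Ω, χ i x * g x * ⟪w, outerUnitNormal Ω x⟫ ∂μHE[n] := by
      rw [← integral_finsetSum _ i2]
      refine setIntegral_congr_fun isClosed_frontier.measurableSet fun x hx => ?_
      rw [← Finset.sum_mul, ← hMcl x hx]
    rw [s0, s1, s2, ← Finset.sum_sub_distrib, Finset.mul_sum]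
    exact (Finset.abs_sum_le_sum_abs _ _).trans (Finset.sum_le_sum fun i _ => est i)
  have hJ : 0 ≤ ∫ x in frontier Ω, g x ∂μHE[n] := integral_nonneg hg0
  rw [← sub_eq_zero, ← abs_nonpos_iff]
  refine le_of_forall_pos_le_add fun ε hε => ?_
  have h1 := key (ε / (1 + ∫ x in frontier Ω, g x ∂μHE[n])) (by positivity)
  refine h1.trans ?_
  rw [zero_add, div_mul_eq_mul_div, div_le_iff₀ (by positivity)]
  nlinarith

/-- **Gauss' formula** on a bounded smooth domain, with the Hausdorff measure on the boundary, for a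
function that is `C¹` up to the boundary. -/
theorem integral_fderiv_eq_integral_frontier {Ω : Set (Space n)} (hΩ : IsBoundedSmoothDomain Ω)
    {g : Space n → ℝ} {U : Set (Space n)} (hU : IsOpen U) (hΩU : closure Ω ⊆ U)
    (hg : ContDiffOn ℝ 1 g U) (w : Space n) :
    ∫ x in Ω, fderiv ℝ g x w
      = ∫ x in frontier Ω, g x * ⟪w, outerUnitNormal Ω x⟫ ∂μHE[n] := by
  have hν := continuousOn_outerUnitNormal hΩ
  wlog hw : ‖w‖ ≤ 1 generalizing w
  · have hw0 : ‖w‖ ≠ 0 := by linarith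
    have h1 := this (‖w‖⁻¹ • w) (by rw [norm_smul, norm_inv, norm_norm, inv_mul_cancel₀ hw0])
    simp only [map_smul, smul_eq_mul, real_inner_smul_left] at h1
    simp_rw [mul_left_comm _ (‖w‖⁻¹)] at h1
    rw [integral_const_mul, integral_const_mul] at h1
    exact mul_left_cancel₀ (inv_ne_zero hw0) h1
  -- A cutoff `χ` reduces to compactly supported functions; adding a large multiple of `χ`, to which
  -- the formula applies as well, reduces to nonnegative ones.
  obtain ⟨V, hVc, hKV, hVU⟩ := exists_compact_between hΩ.isCompact_closure hU hΩU
  obtain ⟨χ, hχ1, hχ0, hχ⟩ := exists_contMDiffMap_one_nhds_of_subset_interior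
    (modelWithCornersSelf ℝ (Space n)) (n := 1) (isClosed_closure (s := Ω)) hKV
  have hχs : ContDiff ℝ 1 χ := χ.contMDiff.contDiff
  have hχV : tsupport χ ⊆ V := closure_minimal
    (fun x hx => by by_contra hV; exact hx (hχ0 x hV)) hVc.isClosed
  have hχc : HasCompactSupport χ := hVc.of_isClosed_subset (isClosed_tsupport _) hχV
  obtain ⟨c, hc⟩ := (hVc.bddBelow_image (hg.continuousOn.mono hVU))
  have hs : ContDiff ℝ 1 fun x => χ x * (g x - c) := by
    rw [contDiff_iff_contDiffAt]
    intro x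
    by_cases hx : x ∈ tsupport χ
    · exact hχs.contDiffAt.mul
        ((hg.contDiffAt (hU.mem_nhds (hVU (hχV hx)))).sub contDiffAt_const)
    · refine (contDiffAt_const (c := (0 : ℝ))).congr_of_eventuallyEq ?_
      filter_upwards [(isClosed_tsupport χ).isOpen_compl.mem_nhds hx] with y hy
      rw [image_eq_zero_of_notMem_tsupport hy, zero_mul]
  have h1 := integral_fderiv_eq_of_nonneg hΩ hs hχc.mul_right (fun x => by
    by_cases hx : x ∈ V
    · exact mul_nonneg (hχ x).1 (sub_nonneg.2 (hc (mem_image_of_mem _ hx)))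
    · rw [hχ0 x hx, zero_mul]) hw
  have h2 := integral_fderiv_eq_of_nonneg hΩ hχs hχc (fun x => (hχ x).1) hw
  have hev : ∀ x ∈ closure Ω, ∀ᶠ y in nhds x, χ y = 1 := fun x hx =>
    hχ1.filter_mono (nhds_le_nhdsSet hx)
  have d1 : ∀ x ∈ Ω, fderiv ℝ (fun x => χ x * (g x - c)) x w = fderiv ℝ g x w := by
    intro x hx
    have : (fun x => χ x * (g x - c)) =ᶠ[nhds x] fun x => g x - c := by
      filter_upwards [hev x (subset_closure hx)] with y hy
      rw [hy, one_mul]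
    rw [this.fderiv_eq, fderiv_sub_const]
  have d2 : ∀ x ∈ Ω, fderiv ℝ χ x w = 0 := by
    intro x hx
    have : χ =ᶠ[nhds x] fun _ => (1 : ℝ) := hev x (subset_closure hx)
    rw [this.fderiv_eq]; simp
  have hone : ∀ x ∈ frontier Ω, χ x = 1 := fun x hx =>
    (hev x (frontier_subset_closure hx)).self_of_nhds
  rw [setIntegral_congr_fun hΩ.isOpen.measurableSet d1] at h1
  rw [setIntegral_eq_zero_of_forall_eq_zero d2,
    setIntegral_congr_fun (g := fun x => ⟪w, outerUnitNormal Ω x⟫) isClosed_frontier.measurableSet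
      (fun x hx => by simp only [hone x hx, one_mul])] at h2
  rw [h1, setIntegral_congr_fun (g := fun x => g x * ⟪w, outerUnitNormal Ω x⟫
    - c * ⟪w, outerUnitNormal Ω x⟫) isClosed_frontier.measurableSet
      (fun x hx => by simp only [hone x hx]; ring), integral_sub, integral_const_mul, ← h2,
    mul_zero, sub_zero]
  · exact integrableOn_frontier hΩ ((hg.continuousOn.mono
      (frontier_subset_closure.trans hΩU)).mul (continuousOn_const.inner hν))
  · exact integrableOn_frontier hΩ (continuousOn_const.mul (continuousOn_const.inner hν))

/-! ### Moving domains in space-time -/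

theorem hasFDerivAt_space_slice {E G : Type*} [NormedAddCommGroup E] [NormedSpace ℝ E]
    [NormedAddCommGroup G] [NormedSpace ℝ G] {F : ℝ × E → G} {z : ℝ × E}
    (h : DifferentiableAt ℝ F z) :
    HasFDerivAt (fun y => F (z.1, y)) ((fderiv ℝ F z).comp (ContinuousLinearMap.inr ℝ ℝ E)) z.2 :=
  h.hasFDerivAt.comp z.2 (hasFDerivAt_prodMk_right z.1 z.2)

theorem fderiv_space_slice {E G : Type*} [NormedAddCommGroup E] [NormedSpace ℝ E]
    [NormedAddCommGroup G] [NormedSpace ℝ G] {F : ℝ × E → G} {z : ℝ × E}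
    (h : DifferentiableAt ℝ F z) (v : E) :
    fderiv ℝ (fun y => F (z.1, y)) z.2 v = fderiv ℝ F z (0, v) := by
  rw [(hasFDerivAt_space_slice h).fderiv]; simp

theorem hasDerivAt_time_slice {E G : Type*} [NormedAddCommGroup E] [NormedSpace ℝ E]
    [NormedAddCommGroup G] [NormedSpace ℝ G] {F : ℝ × E → G} {z : ℝ × E}
    (h : DifferentiableAt ℝ F z) :
    HasDerivAt (fun s => F (s, z.2)) (fderiv ℝ F z (1, 0)) z.1 := by
  have h1 : HasDerivAt (fun s : ℝ => (s, z.2)) ((1 : ℝ), (0 : E)) z.1 :=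
    (hasDerivAt_id z.1).prodMk (hasDerivAt_const _ _)
  exact h.hasFDerivAt.comp_hasDerivAt z.1 h1

theorem IsSmoothDiffeoFamily.injOn {T : ℝ} {Ω₀ : Set (Space n)} {φ : ℝ → Space n → Space n}
    (hφ : IsSmoothDiffeoFamily T Ω₀ φ) {t : ℝ} (ht : t ∈ Ioo 0 T) : InjOn (φ t) (closure Ω₀) := by
  obtain ⟨ψ, -, h⟩ := hφ.smooth_inverse t ht
  exact (show LeftInvOn ψ (φ t) (closure Ω₀) from h).injOn

/-- The derivative of a diffeomorphism of the closed domain is injective, at boundary points too. -/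
theorem IsSmoothDiffeoFamily.injective_fderiv {T : ℝ} {Ω₀ : Set (Space n)}
    {φ : ℝ → Space n → Space n} (hφ : IsSmoothDiffeoFamily T Ω₀ φ) (hΩ₀ : IsOpen Ω₀) {t : ℝ}
    (ht : t ∈ Ioo 0 T) {p : Space n} (hp : p ∈ closure Ω₀) :
    Function.Injective (fderiv ℝ (φ t) p) := by
  obtain ⟨V, hV, hsub, hs⟩ := hφ.smooth
  obtain ⟨ψ, ⟨W, hW, hWsub, hψ⟩, hinv⟩ := hφ.smooth_inverse t ht
  have hφt : ∀ q ∈ closure Ω₀, ContDiffAt ℝ ∞ (φ t) q := fun q hq =>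
    (hs.contDiffAt (hV.mem_nhds (hsub ⟨ht, hq⟩))).comp q
      (f := fun q : Space n => (t, q)) (by fun_prop)
  have hψt : ∀ q ∈ closure Ω₀, ContDiffAt ℝ ∞ ψ (φ t q) := fun q hq =>
    hψ.contDiffAt (hW.mem_nhds (hWsub (mem_image_of_mem _ hq)))
  have hcomp : ∀ q ∈ closure Ω₀, fderiv ℝ (fun q => ψ (φ t q)) q
      = (fderiv ℝ ψ (φ t q)).comp (fderiv ℝ (φ t) q) := fun q hq =>
    fderiv_comp q ((hψt q hq).differentiableAt (by simp)) ((hφt q hq).differentiableAt (by simp))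
  have hEq : EqOn (fderiv ℝ (fun q => ψ (φ t q))) (fun _ => ContinuousLinearMap.id ℝ (Space n))
      Ω₀ := by
    intro q hq
    have : (fun q => ψ (φ t q)) =ᶠ[nhds q] id := by
      filter_upwards [hΩ₀.mem_nhds hq] with y hy using hinv y (subset_closure hy)
    rw [this.fderiv_eq, fderiv_id]
  have hEq' := hEq.of_subset_closure (t := closure Ω₀) (fun q hq =>
    ((((hψt q hq).comp q (hφt q hq)).fderiv_right (m := 0) (by simp)).continuousAt
      ).continuousWithinAt) continuousOn_const subset_closure Subset.rfl hp
  rw [hcomp p hp] at hEq'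
  intro v w hvw
  have h1 := congrArg (fun L => L v) hEq'
  have h2 := congrArg (fun L => L w) hEq'
  simp only [ContinuousLinearMap.comp_apply, ContinuousLinearMap.id_apply] at h1 h2
  rw [← h1, ← h2, hvw]

/-- The inverses `φ_s⁻¹` are, near each point of a closed domain `φ_t(closure Ω₀)`, restrictions of
a map `θ` that is smooth jointly in space and time. Compactness of the closed domain ensures that
no other sheet of the family comes near. -/
theorem exists_smooth_inverse {T : ℝ} {Ω₀ : Set (Space n)} {φ : ℝ → Space n → Space n}
    (hφ : IsSmoothDiffeoFamily T Ω₀ φ) (hΩ₀ : IsOpen Ω₀) (hK : IsCompact (closure Ω₀))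
    {V : Set (ℝ × Space n)} (hV : IsOpen V) (hsub : Ioo 0 T ×ˢ closure Ω₀ ⊆ V)
    (hs : ContDiffOn ℝ ∞ (fun z : ℝ × Space n => φ z.1 z.2) V) {t : ℝ} (ht : t ∈ Ioo 0 T)
    {p : Space n} (hp : p ∈ closure Ω₀) :
    ∃ (O : Set (ℝ × Space n)) (θ : ℝ × Space n → Space n), IsOpen O ∧ (t, φ t p) ∈ O ∧
      ContDiffOn ℝ ∞ θ O ∧ θ (t, φ t p) = p ∧
      (∀ z ∈ O, z.1 ∈ Ioo 0 T ∧ φ z.1 (θ z) = z.2 ∧ ∀ q ∈ closure Ω₀, φ z.1 q = z.2 → q = θ z) ∧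
      ∀ᶠ z in nhds (t, p), θ (z.1, φ z.1 z.2) = z.2 := by
  set Φ : ℝ × Space n → ℝ × Space n := fun z => (z.1, φ z.1 z.2) with hΦ
  have hΦs : ContDiffOn ℝ ∞ Φ V := contDiffOn_fst.prodMk hs
  have hVp : (t, p) ∈ V := hsub ⟨ht, hp⟩
  have hd : ∀ z ∈ V, DifferentiableAt ℝ (fun z : ℝ × Space n => φ z.1 z.2) z := fun z hz =>
    (hs.contDiffAt (hV.mem_nhds hz)).differentiableAt (by simp)
  have hΦd : ∀ z ∈ V, DifferentiableAt ℝ Φ z := fun z hz =>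
    (hΦs.contDiffAt (hV.mem_nhds hz)).differentiableAt (by simp)
  have hfd : ∀ v, fderiv ℝ Φ (t, p) v
      = (v.1, fderiv ℝ (fun z : ℝ × Space n => φ z.1 z.2) (t, p) v) :=
    fun v => by
      rw [(hasFDerivAt_fst.prodMk (hd _ hVp).hasFDerivAt : HasFDerivAt Φ _ (t, p)).fderiv]; rfl
  have hinj : Function.Injective (fderiv ℝ Φ (t, p) : ℝ × Space n →ₗ[ℝ] ℝ × Space n) := by
    rw [injective_iff_map_eq_zero]
    rintro ⟨r, v⟩ h
    have h1 : fderiv ℝ Φ (t, p) (r, v) = 0 := h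
    rw [hfd] at h1
    obtain ⟨rfl, h3⟩ : r = 0 ∧ _ := Prod.mk.inj h1
    have h4 := fderiv_space_slice (hd _ hVp) v
    rw [h3] at h4
    have h5 : v = 0 := hφ.injective_fderiv hΩ₀ ht hp (h4.trans (map_zero _).symm)
    rw [h5]; rfl
  let L : (ℝ × Space n) ≃L[ℝ] (ℝ × Space n) :=
    (LinearEquiv.ofInjectiveEndo _ hinj).toContinuousLinearEquiv
  have hL : (L : ℝ × Space n →L[ℝ] ℝ × Space n) = fderiv ℝ Φ (t, p) := by ext1 <;> ext1 <;> rfl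
  have hΦp : ContDiffAt ℝ ∞ Φ (t, p) := hΦs.contDiffAt (hV.mem_nhds hVp)
  have hL' : HasFDerivAt Φ (L : ℝ × Space n →L[ℝ] ℝ × Space n) (t, p) := by
    rw [hL]; exact (hΦd _ hVp).hasFDerivAt
  let e := hΦp.toOpenPartialHomeomorph Φ hL' (by simp)
  have he : ∀ z, e z = Φ z := fun z => by
    rw [hΦp.toOpenPartialHomeomorph_coe hL' (by simp)]
  have hpe : (t, p) ∈ e.source := hΦp.mem_toOpenPartialHomeomorph_source hL' (by simp)
  have hcont : ContinuousAt (fderiv ℝ Φ) (t, p) :=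
    (hΦp.fderiv_right (m := 0) (by simp)).continuousAt
  have hinvert : ∀ᶠ z in nhds (t, p),
      fderiv ℝ Φ z ∈ range (ContinuousLinearEquiv.toContinuousLinearMap (M₁ := ℝ × Space n)
        (M₂ := ℝ × Space n) (σ₁₂ := RingHom.id ℝ)) :=
    hcont.eventually (by rw [← hL]; exact L.nhds)
  -- Where the derivative is invertible the local inverse is smooth.
  have hgood := hinvert.and ((hV.eventually_mem hVp).and
    ((isOpen_Ioo.preimage continuous_fst).eventually_mem
      (show (t, p) ∈ Prod.fst ⁻¹' Ioo 0 T from ht)))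
  obtain ⟨N, hNsub, hNo, hpN⟩ := mem_nhds_iff.1 hgood
  -- Preimages in the closed domain of points near `(t, φ t p)` are near `p`, in the domain
  -- of the local diffeomorphism.
  have hnear : ∀ᶠ z : ℝ × Space n in nhds (t, φ t p), ∀ q ∈ closure Ω₀, φ z.1 q = z.2 →
      (z.1, q) ∈ e.source := by
    refine hK.eventually_forall_of_forall_eventually fun q hq => ?_
    by_cases hqp : q = p
    · subst hqp
      have hc : ContinuousAt (fun w : (ℝ × Space n) × Space n => (w.1.1, w.2)) ((t, φ t q), q) := by
        fun_prop
      filter_upwards [hc.eventually (e.open_source.mem_nhds hpe)] with w hw _ using hw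
    · have hc : ContinuousAt (fun w : (ℝ × Space n) × Space n => φ w.1.1 w.2 - w.1.2)
          ((t, φ t p), q) := by
        have h1 : ContinuousAt (fun z : ℝ × Space n => φ z.1 z.2) (t, q) :=
          (hd _ (hsub ⟨ht, hq⟩)).continuousAt
        have h2 : ContinuousAt (fun w : (ℝ × Space n) × Space n => (w.1.1, w.2))
          ((t, φ t p), q) := by fun_prop
        have h3 : ContinuousAt (fun w : (ℝ × Space n) × Space n => φ w.1.1 w.2)
          ((t, φ t p), q) := ContinuousAt.comp
            (f := fun w : (ℝ × Space n) × Space n => (w.1.1, w.2))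
            (g := fun z : ℝ × Space n => φ z.1 z.2) h1 h2
        exact h3.sub (by fun_prop)
      have hne : φ t q - φ t p ≠ 0 := sub_ne_zero.2 fun h => hqp (hφ.injOn ht hq hp h)
      filter_upwards [hc.eventually_ne hne] with w hw hw'
      exact absurd (sub_eq_zero.2 hw') hw
  obtain ⟨N', hN'sub, hN'o, hN'⟩ := mem_nhds_iff.1 hnear
  have hep : e (t, p) = (t, φ t p) := he _
  refine ⟨(e.target ∩ e.symm ⁻¹' N) ∩ N', fun z => (e.symm z).2,
    (e.isOpen_inter_preimage_symm hNo).inter hN'o, ⟨⟨?_, ?_⟩, hN'⟩, ?_, ?_, ?_, ?_⟩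
  · rw [← hep]; exact e.map_source hpe
  · rw [mem_preimage, ← hep, e.left_inv hpe]; exact hpN
  · intro z hz
    obtain ⟨⟨L', hL'⟩, hzV, -⟩ := hNsub hz.1.2
    refine (ContDiffAt.contDiffWithinAt ?_)
    refine contDiffAt_snd.comp z (e.contDiffAt_symm (f₀' := L') hz.1.1 ?_ ?_)
    · rw [show (e : ℝ × Space n → ℝ × Space n) = Φ from funext he, hL']
      exact (hΦd _ hzV).hasFDerivAt
    · rw [show (e : ℝ × Space n → ℝ × Space n) = Φ from funext he]
      exact hΦs.contDiffAt (hV.mem_nhds hzV)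
  · simp only [← hep, e.left_inv hpe]
  · intro z hz
    have h1 : Φ (e.symm z) = z := by rw [← he]; exact e.right_inv hz.1.1
    have h2 : (e.symm z).1 = z.1 := (congrArg Prod.fst h1 : (Φ (e.symm z)).1 = z.1)
    have h3 : φ (e.symm z).1 (e.symm z).2 = z.2 :=
      (congrArg Prod.snd h1 : (Φ (e.symm z)).2 = z.2)
    refine ⟨h2 ▸ (hNsub hz.1.2).2.2, by rw [← h2]; exact h3, fun q hq hqz => ?_⟩
    have h4 : (z.1, q) ∈ e.source := hN'sub hz.2 q hq hqz
    have h5 : e (z.1, q) = z := by rw [he]; exact Prod.ext rfl hqz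
    have h6 : e.symm z = (z.1, q) := (congrArg e.symm h5).symm.trans (e.left_inv h4)
    simp only [h6]
  · filter_upwards [e.open_source.mem_nhds hpe] with z hz
    have : (z.1, φ z.1 z.2) = e z := (he z).symm
    rw [this, e.left_inv hz]

theorem closure_domainAt {T : ℝ} {Ω₀ : Set (Space n)} {φ : ℝ → Space n → Space n}
    (hφ : IsSmoothDiffeoFamily T Ω₀ φ) (hK : IsCompact (closure Ω₀)) {t : ℝ} (ht : t ∈ Ioo 0 T) :
    closure (domainAt Ω₀ φ t) = φ t '' closure Ω₀ := by
  obtain ⟨V, hV, hsub, hs⟩ := hφ.smooth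
  have hc : ContinuousOn (φ t) (closure Ω₀) := fun q hq =>
    (ContinuousAt.comp (f := fun q : Space n => (t, q)) (g := fun z : ℝ × Space n => φ z.1 z.2)
      (hs.continuousOn.continuousAt (hV.mem_nhds (hsub ⟨ht, hq⟩))) (by fun_prop)).continuousWithinAt
  refine Subset.antisymm ?_ hc.image_closure
  exact closure_minimal (image_mono subset_closure) (hK.image_of_continuousOn hc).isClosed

/-- The space-time domain `{(t, x) : x ∈ Ω_t}` is open. -/
theorem eventually_mem_domainAt {T : ℝ} {Ω₀ : Set (Space n)} {φ : ℝ → Space n → Space n}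
    (hφ : IsSmoothDiffeoFamily T Ω₀ φ) (hΩ₀ : IsOpen Ω₀) (hK : IsCompact (closure Ω₀))
    {z : ℝ × Space n} (ht : z.1 ∈ Ioo 0 T) (hz : z.2 ∈ domainAt Ω₀ φ z.1) :
    ∀ᶠ y in nhds z, y.2 ∈ domainAt Ω₀ φ y.1 := by
  obtain ⟨t, x⟩ := z
  obtain ⟨p, hp, hpx : φ t p = x⟩ := hz
  subst hpx
  obtain ⟨V, hV, hsub, hs⟩ := hφ.smooth
  obtain ⟨O, θ, hO, hpO, hθ, hθp, hinv, -⟩ :=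
    exists_smooth_inverse hφ hΩ₀ hK hV hsub hs ht (subset_closure hp)
  have hc : ContinuousAt θ (t, φ t p) := hθ.continuousOn.continuousAt (hO.mem_nhds hpO)
  filter_upwards [hO.mem_nhds hpO, hc.eventually (hΩ₀.mem_nhds (hθp.symm ▸ hp))] with y hy hy'
  exact ⟨θ y, hy', (hinv y hy).2.1⟩

theorem isOpen_domainAt {T : ℝ} {Ω₀ : Set (Space n)} {φ : ℝ → Space n → Space n}
    (hφ : IsSmoothDiffeoFamily T Ω₀ φ) (hΩ₀ : IsOpen Ω₀) (hK : IsCompact (closure Ω₀)) {t : ℝ}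
    (ht : t ∈ Ioo 0 T) : IsOpen (domainAt Ω₀ φ t) := by
  refine isOpen_iff_mem_nhds.2 fun x hx => ?_
  have h1 := eventually_mem_domainAt hφ hΩ₀ hK (z := (t, x)) ht hx
  have h2 : ContinuousAt (fun y : Space n => (t, y)) x := by fun_prop
  exact h2.eventually h1

theorem frontier_domainAt {T : ℝ} {Ω₀ : Set (Space n)} {φ : ℝ → Space n → Space n}
    (hφ : IsSmoothDiffeoFamily T Ω₀ φ) (hΩ₀ : IsOpen Ω₀) (hK : IsCompact (closure Ω₀)) {t : ℝ}
    (ht : t ∈ Ioo 0 T) : frontier (domainAt Ω₀ φ t) = φ t '' frontier Ω₀ := by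
  rw [(isOpen_domainAt hφ hΩ₀ hK ht).frontier_eq, closure_domainAt hφ hK ht, hΩ₀.frontier_eq]
  exact ((hφ.injOn ht).image_sdiff_subset subset_closure).symm

/-- The space-time track of the moving boundary has, near each of its points, a smooth defining
function `R` that is constant along the trajectories of the family and whose spatial derivative
does not vanish. -/
theorem exists_spacetime_definingFunction {T : ℝ} {Ω₀ : Set (Space n)} {φ : ℝ → Space n → Space n}
    (hφ : IsSmoothDiffeoFamily T Ω₀ φ) (hΩ₀ : IsBoundedSmoothDomain Ω₀) {t : ℝ}
    (ht : t ∈ Ioo 0 T) {x : Space n} (hx : x ∈ frontier (domainAt Ω₀ φ t)) :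
    ∃ (R : ℝ × Space n → ℝ) (O : Set (ℝ × Space n)), IsOpen O ∧ (t, x) ∈ O ∧ ContDiffOn ℝ ∞ R O ∧
      (∀ z ∈ O, z.1 ∈ Ioo 0 T) ∧ (∀ z ∈ O, z.2 ∈ domainAt Ω₀ φ z.1 ↔ R z < 0) ∧
      (∃ v, fderiv ℝ R (t, x) (0, v) ≠ 0) ∧
      ∀ z ∈ O, ∀ p ∈ Ω₀, φ z.1 p = z.2 → fderiv ℝ R z (1, deriv (fun s => φ s p) z.1) = 0 := by
  have hK := hΩ₀.isCompact_closure
  rw [frontier_domainAt hφ hΩ₀.isOpen hK ht] at hx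
  obtain ⟨p, hp, rfl⟩ := hx
  have hpc : p ∈ closure Ω₀ := frontier_subset_closure hp
  obtain ⟨V, hV, hsub, hs⟩ := hφ.smooth
  obtain ⟨O, θ, hO, hpO, hθ, hθp, hinv, hleft⟩ :=
    exists_smooth_inverse hφ hΩ₀.isOpen hK hV hsub hs ht hpc
  obtain ⟨ρ, hρ⟩ := hΩ₀.smooth_boundary p hp
  have hρd : DifferentiableAt ℝ ρ p := hρ.contDiffAt.differentiableAt (by simp)
  obtain ⟨hne, U, hU, hpU, hρs, hρΩ⟩ := hρ
  obtain ⟨N, hNsub, hN, hpN⟩ := mem_nhds_iff.1 hleft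
  have hd : ∀ z ∈ V, DifferentiableAt ℝ (fun z : ℝ × Space n => φ z.1 z.2) z := fun z hz =>
    (hs.contDiffAt (hV.mem_nhds hz)).differentiableAt (by simp)
  have hcθ : ContinuousOn (fun z : ℝ × Space n => (z.1, θ z)) O :=
    continuousOn_fst.prodMk hθ.continuousOn
  have hOo : IsOpen ((O ∩ θ ⁻¹' U) ∩ (O ∩ (fun z : ℝ × Space n => (z.1, θ z)) ⁻¹' N)) :=
    (hθ.continuousOn.isOpen_inter_preimage hO hU).inter (hcθ.isOpen_inter_preimage hO hN)
  set O' := (O ∩ θ ⁻¹' U) ∩ (O ∩ (fun z : ℝ × Space n => (z.1, θ z)) ⁻¹' N) with hO'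
  have hmem : (t, φ t p) ∈ O' :=
    ⟨⟨hpO, by rw [mem_preimage, hθp]; exact hpU⟩, hpO, by rw [mem_preimage, hθp]; exact hpN⟩
  have hRs : ContDiffOn ℝ ∞ (fun z => ρ (θ z)) O' :=
    hρs.comp (hθ.mono fun z hz => hz.1.1) fun z hz => hz.1.2
  have hRd : ∀ z ∈ O', DifferentiableAt ℝ (fun z => ρ (θ z)) z := fun z hz =>
    (hRs.contDiffAt (hOo.mem_nhds hz)).differentiableAt (by simp)
  refine ⟨fun z => ρ (θ z), O', hOo, hmem, hRs, fun z hz => (hinv z hz.1.1).1, ?_, ?_, ?_⟩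
  · intro z hz
    rw [← hρΩ _ hz.1.2]
    constructor
    · rintro ⟨q, hq, hqz⟩
      rwa [← (hinv z hz.1.1).2.2 q (subset_closure hq) hqz]
    · intro h
      exact ⟨θ z, h, (hinv z hz.1.1).2.1⟩
  · by_contra! hall
    refine hne ?_
    have h1 : (fun q => ρ (θ (t, φ t q))) =ᶠ[nhds p] ρ := by
      have hc : ContinuousAt (fun q : Space n => (t, q)) p := by fun_prop
      filter_upwards [hc.eventually hleft] with q hq
      rw [show θ (t, φ t q) = q from hq]
    have h2 := hasFDerivAt_space_slice (hd _ (hsub ⟨ht, hpc⟩ : (t, p) ∈ V))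
    have h3 := (hasFDerivAt_space_slice (hRd _ hmem)).comp p h2
    have h4 : HasFDerivAt ρ _ p := h3.congr_of_eventuallyEq h1.symm
    have h5 : fderiv ℝ ρ p = 0 := by
      rw [h4.fderiv]
      ext v
      simp only [ContinuousLinearMap.comp_apply, ContinuousLinearMap.inr_apply,
        zero_apply]
      exact hall _
    rw [gradient, h5, map_zero]
  · rintro ⟨s, y⟩ hz q hq hqz
    simp only at hqz ⊢
    subst hqz
    have hθq : q = θ (s, φ s q) := (hinv _ hz.1.1).2.2 q (subset_closure hq) rfl
    have hsN : (s, q) ∈ N := by have := hz.2.2; rwa [mem_preimage, ← hθq] at this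
    have hsT : s ∈ Ioo 0 T := (hinv _ hz.1.1).1
    have h1 : (fun r => ρ (θ (r, φ r q))) =ᶠ[nhds s] fun _ => ρ q := by
      have hc : ContinuousAt (fun r : ℝ => (r, q)) s := by fun_prop
      filter_upwards [hc.eventually (hN.mem_nhds hsN)] with r hr
      rw [show θ (r, φ r q) = q from hNsub hr]
    have h2 := hasDerivAt_time_slice (hd _ (hsub ⟨hsT, subset_closure hq⟩ : (s, q) ∈ V))
    have h3 : HasDerivAt (fun r => (r, φ r q)) _ s := (hasDerivAt_id s).prodMk h2
    have h4 := (hRd _ hz).hasFDerivAt.comp_hasDerivAt s h3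
    have h5 : HasDerivAt (fun r => ρ (θ (r, φ r q))) 0 s :=
      (hasDerivAt_const s (ρ q)).congr_of_eventuallyEq h1
    rw [h2.deriv]
    exact h4.unique h5

theorem isBoundedSmoothDomain_domainAt {T : ℝ} {Ω₀ : Set (Space n)} {φ : ℝ → Space n → Space n}
    (hφ : IsSmoothDiffeoFamily T Ω₀ φ) (hΩ₀ : IsBoundedSmoothDomain Ω₀) {t : ℝ}
    (ht : t ∈ Ioo 0 T) : IsBoundedSmoothDomain (domainAt Ω₀ φ t) := by
  have hK := hΩ₀.isCompact_closure
  refine ⟨isOpen_domainAt hφ hΩ₀.isOpen hK ht, ?_, fun x hx => ?_⟩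
  · obtain ⟨V, hV, hsub, hs⟩ := hφ.smooth
    have hc : ContinuousOn (φ t) (closure Ω₀) := fun q hq =>
      (ContinuousAt.comp (f := fun q : Space n => (t, q)) (g := fun z : ℝ × Space n => φ z.1 z.2)
        (hs.continuousOn.continuousAt (hV.mem_nhds (hsub ⟨ht, hq⟩)))
        (by fun_prop)).continuousWithinAt
    exact (hK.image_of_continuousOn hc).isBounded.subset (image_mono subset_closure)
  · obtain ⟨R, O, hO, hxO, hR, -, hRΩ, ⟨v, hv⟩, -⟩ := exists_spacetime_definingFunction hφ hΩ₀ ht hx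
    refine ⟨fun y => R (t, y), fun h0 => hv ?_, (fun y => (t, y)) ⁻¹' O,
      hO.preimage (by fun_prop), hxO, ?_, fun y hy => hRΩ _ hy⟩
    · have hd : DifferentiableAt ℝ R (t, x) :=
        (hR.contDiffAt (hO.mem_nhds hxO)).differentiableAt (by simp)
      rw [← fderiv_space_slice hd v, ← inner_gradient_left, h0, inner_zero_left]
    · exact hR.comp (by fun_prop) fun y hy => hy

/-! ### Calculus of smooth functions on space-time -/

/-- The directional derivative of `F` along the constant vector `v`. -/
noncomputable def dirDeriv {X Y : Type*} [NormedAddCommGroup X] [NormedSpace ℝ X]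
    [NormedAddCommGroup Y] [NormedSpace ℝ Y] (v : X) (F : X → Y) (z : X) : Y := fderiv ℝ F z v

section DirDeriv

variable {X : Type*} [NormedAddCommGroup X] [NormedSpace ℝ X] {U : Set X} {F G : X → ℝ} {z : X}

theorem contDiffOn_dirDeriv {Y : Type*} [NormedAddCommGroup Y] [NormedSpace ℝ Y] {F : X → Y}
    (hU : IsOpen U) (hF : ContDiffOn ℝ ∞ F U) (v : X) : ContDiffOn ℝ ∞ (dirDeriv v F) U :=
  (hF.fderiv_of_isOpen hU (by simp)).clm_apply contDiffOn_const

theorem differentiableAt_of_contDiffOn {Y : Type*} [NormedAddCommGroup Y] [NormedSpace ℝ Y]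
    {F : X → Y} (hU : IsOpen U) (hF : ContDiffOn ℝ ∞ F U) (hz : z ∈ U) : DifferentiableAt ℝ F z :=
  (hF.contDiffAt (hU.mem_nhds hz)).differentiableAt (by simp)

theorem dirDeriv_dirDeriv (hU : IsOpen U) (hF : ContDiffOn ℝ ∞ F U) (hz : z ∈ U) (v w : X) :
    dirDeriv v (dirDeriv w F) z = fderiv ℝ (fderiv ℝ F) z v w := by
  have h : DifferentiableAt ℝ (fderiv ℝ F) z :=
    differentiableAt_of_contDiffOn hU (hF.fderiv_of_isOpen hU (by simp)) hz
  have h1 := (h.hasFDerivAt.clm_apply (hasFDerivAt_const w z)).fderiv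
  change fderiv ℝ (fun z => fderiv ℝ F z w) z v = _
  rw [h1]; simp

theorem fderiv_fderiv_symm (hU : IsOpen U) (hF : ContDiffOn ℝ ∞ F U) (hz : z ∈ U) (v w : X) :
    fderiv ℝ (fderiv ℝ F) z v w = fderiv ℝ (fderiv ℝ F) z w v :=
  ((hF.contDiffAt (hU.mem_nhds hz)).isSymmSndFDerivAt (by
    rw [minSmoothness_of_isRCLikeNormedField]
    exact ENat.LEInfty.out)).eq v w

theorem dirDeriv_comm (hU : IsOpen U) (hF : ContDiffOn ℝ ∞ F U) (hz : z ∈ U) (v w : X) :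
    dirDeriv v (dirDeriv w F) z = dirDeriv w (dirDeriv v F) z := by
  rw [dirDeriv_dirDeriv hU hF hz, dirDeriv_dirDeriv hU hF hz, fderiv_fderiv_symm hU hF hz]

theorem dirDeriv_add (hF : DifferentiableAt ℝ F z) (hG : DifferentiableAt ℝ G z) (v : X) :
    dirDeriv v (fun z => F z + G z) z = dirDeriv v F z + dirDeriv v G z := by
  simp only [dirDeriv]; rw [fderiv_fun_add hF hG]; rfl

theorem dirDeriv_sub (hF : DifferentiableAt ℝ F z) (hG : DifferentiableAt ℝ G z) (v : X) :
    dirDeriv v (fun z => F z - G z) z = dirDeriv v F z - dirDeriv v G z := by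
  simp only [dirDeriv]; rw [fderiv_fun_sub hF hG]; rfl

theorem dirDeriv_mul (hF : DifferentiableAt ℝ F z) (hG : DifferentiableAt ℝ G z) (v : X) :
    dirDeriv v (fun z => F z * G z) z = dirDeriv v F z * G z + F z * dirDeriv v G z := by
  simp only [dirDeriv]; rw [fderiv_fun_mul hF hG]; simp; ring

theorem dirDeriv_const_mul (hF : DifferentiableAt ℝ F z) (c : ℝ) (v : X) :
    dirDeriv v (fun z => c * F z) z = c * dirDeriv v F z := by
  simp only [dirDeriv]; rw [fderiv_const_mul hF]; simp

theorem dirDeriv_const (c : ℝ) (v : X) : dirDeriv v (fun _ : X => c) z = 0 := by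
  simp [dirDeriv]

theorem dirDeriv_sum {ι : Type*} {s : Finset ι} {F : ι → X → ℝ}
    (hF : ∀ i ∈ s, DifferentiableAt ℝ (F i) z) (v : X) :
    dirDeriv v (fun z => ∑ i ∈ s, F i z) z = ∑ i ∈ s, dirDeriv v (F i) z := by
  simp only [dirDeriv]; rw [fderiv_fun_sum hF]; simp

theorem dirDeriv_congr (hU : IsOpen U) (h : EqOn F G U) (hz : z ∈ U) (v : X) :
    dirDeriv v F z = dirDeriv v G z := by
  simp only [dirDeriv]; rw [(h.eventuallyEq_of_mem (hU.mem_nhds hz)).fderiv_eq]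

end DirDeriv

/-- The `i`-th spatial coordinate direction in space-time. -/
noncomputable def spaceDir (i : Fin (n + 1)) : ℝ × Space n := (0, EuclideanSpace.single i 1)

/-- The time direction in space-time. -/
def timeDir : ℝ × Space n := (1, 0)

/-- The Laplacian in the space variables of a function on space-time. -/
noncomputable def spaceLaplacian (F : ℝ × Space n → ℝ) (z : ℝ × Space n) : ℝ :=
  ∑ i, dirDeriv (spaceDir i) (dirDeriv (spaceDir i) F) z

/-- The squared norm `|∇F|²` of the gradient in the space variables. -/
noncomputable def spaceGradSq (F : ℝ × Space n → ℝ) (z : ℝ × Space n) : ℝ :=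
  ∑ i, dirDeriv (spaceDir i) F z ^ 2

/-- The inner product `∇F · ∇G` of the gradients in the space variables. -/
noncomputable def spaceGradInner (F G : ℝ × Space n → ℝ) (z : ℝ × Space n) : ℝ :=
  ∑ i, dirDeriv (spaceDir i) F z * dirDeriv (spaceDir i) G z

/-- The squared norm of the tensor `∇²F - I / (2τ)`, the Hessian being taken in space. -/
noncomputable def solitonSq (τ : ℝ) (F : ℝ × Space n → ℝ) (z : ℝ × Space n) : ℝ :=
  ∑ i, ∑ j,
    (dirDeriv (spaceDir i) (dirDeriv (spaceDir j) F) z - if i = j then 1 / (2 * τ) else 0) ^ 2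

/-- The function `W = τ (2 ΔF - |∇F|²) + F - (n + 1)` on space-time, with `τ = a - t`. -/
noncomputable def spaceTimeW (a : ℝ) (F : ℝ × Space n → ℝ) (z : ℝ × Space n) : ℝ :=
  (a - z.1) * (2 * spaceLaplacian F z - spaceGradSq F z) + F z - (n + 1)

/-- The density `u = e^{-F} / (4πτ)^{(n+1)/2}` on space-time, with `τ = a - t`. -/
noncomputable def spaceTimeDensity (a : ℝ) (F : ℝ × Space n → ℝ) (z : ℝ × Space n) : ℝ :=
  Real.exp (-F z) / (4 * Real.pi * (a - z.1)) ^ (((n : ℝ) + 1) / 2)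

section SpaceTime

variable {U : Set (ℝ × Space n)} {F G : ℝ × Space n → ℝ} {z : ℝ × Space n}

theorem contDiffOn_spaceLaplacian (hU : IsOpen U) (hF : ContDiffOn ℝ ∞ F U) :
    ContDiffOn ℝ ∞ (spaceLaplacian F) U :=
  ContDiffOn.sum fun _ _ => contDiffOn_dirDeriv hU (contDiffOn_dirDeriv hU hF _) _

theorem contDiffOn_spaceGradSq (hU : IsOpen U) (hF : ContDiffOn ℝ ∞ F U) :
    ContDiffOn ℝ ∞ (spaceGradSq F) U :=
  ContDiffOn.sum fun _ _ => (contDiffOn_dirDeriv hU hF _).pow 2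

theorem contDiffOn_spaceTimeW (a : ℝ) (hU : IsOpen U) (hF : ContDiffOn ℝ ∞ F U) :
    ContDiffOn ℝ ∞ (spaceTimeW a F) U :=
  ((((contDiffOn_const.sub contDiffOn_fst).mul ((contDiffOn_const.mul
    (contDiffOn_spaceLaplacian hU hF)).sub (contDiffOn_spaceGradSq hU hF))).add hF).sub
    contDiffOn_const)

theorem dirDeriv_timeFun (a : ℝ) (v : ℝ × Space n) :
    dirDeriv v (fun z : ℝ × Space n => a - z.1) z = -v.1 := by
  simp only [dirDeriv]
  rw [fderiv_const_sub, fderiv_fst]; rfl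

theorem dirDeriv_spaceGradSq (hU : IsOpen U) (hF : ContDiffOn ℝ ∞ F U) (hz : z ∈ U)
    (v : ℝ × Space n) : dirDeriv v (spaceGradSq F) z
      = 2 * ∑ i, dirDeriv (spaceDir i) F z * dirDeriv v (dirDeriv (spaceDir i) F) z := by
  have hd : ∀ i, DifferentiableAt ℝ (dirDeriv (spaceDir i) F) z := fun i =>
    differentiableAt_of_contDiffOn hU (contDiffOn_dirDeriv hU hF _) hz
  change dirDeriv v (fun z => ∑ i, dirDeriv (spaceDir i) F z ^ 2) z = _
  simp_rw [sq]
  rw [dirDeriv_sum fun i _ => (hd i).fun_mul (hd i), Finset.mul_sum]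
  refine Finset.sum_congr rfl fun i _ => ?_
  rw [dirDeriv_mul (hd i) (hd i)]; ring

theorem dirDeriv_spaceTimeW (a : ℝ) (hU : IsOpen U) (hF : ContDiffOn ℝ ∞ F U) (hz : z ∈ U)
    (v : ℝ × Space n) : dirDeriv v (spaceTimeW a F) z
      = -v.1 * (2 * spaceLaplacian F z - spaceGradSq F z)
        + (a - z.1) * (2 * dirDeriv v (spaceLaplacian F) z - dirDeriv v (spaceGradSq F) z)
        + dirDeriv v F z := by
  have h1 := differentiableAt_of_contDiffOn hU (contDiffOn_spaceLaplacian hU hF) hz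
  have h2 := differentiableAt_of_contDiffOn hU (contDiffOn_spaceGradSq hU hF) hz
  have h3 := differentiableAt_of_contDiffOn hU hF hz
  have h4 : DifferentiableAt ℝ (fun z : ℝ × Space n => a - z.1) z := by fun_prop
  change dirDeriv v (fun z => (a - z.1) * (2 * spaceLaplacian F z - spaceGradSq F z) + F z
    - ((n : ℝ) + 1)) z = _
  rw [dirDeriv_sub ((h4.fun_mul ((h1.const_mul 2).fun_sub h2)).fun_add h3) (by fun_prop),
    dirDeriv_add (h4.fun_mul ((h1.const_mul 2).fun_sub h2)) h3,
    dirDeriv_mul h4 ((h1.const_mul 2).fun_sub h2),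
    dirDeriv_sub (h1.const_mul 2) h2, dirDeriv_const_mul h1, dirDeriv_timeFun, dirDeriv_const]
  ring

theorem spaceLaplacian_spaceTimeW (a : ℝ) (hU : IsOpen U) (hF : ContDiffOn ℝ ∞ F U) (hz : z ∈ U) :
    spaceLaplacian (spaceTimeW a F) z
      = (a - z.1) * (2 * spaceLaplacian (spaceLaplacian F) z - spaceLaplacian (spaceGradSq F) z)
        + spaceLaplacian F z := by
  have hL := contDiffOn_spaceLaplacian hU hF
  have hG := contDiffOn_spaceGradSq hU hF
  have key : ∀ i : Fin (n + 1), dirDeriv (spaceDir i) (dirDeriv (spaceDir i) (spaceTimeW a F)) z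
      = (a - z.1) * (2 * dirDeriv (spaceDir i) (dirDeriv (spaceDir i) (spaceLaplacian F)) z
          - dirDeriv (spaceDir i) (dirDeriv (spaceDir i) (spaceGradSq F)) z)
        + dirDeriv (spaceDir i) (dirDeriv (spaceDir i) F) z := by
    intro i
    have h0 : EqOn (dirDeriv (spaceDir i) (spaceTimeW a F)) (fun z =>
        (a - z.1) * (2 * dirDeriv (spaceDir i) (spaceLaplacian F) z
          - dirDeriv (spaceDir i) (spaceGradSq F) z) + dirDeriv (spaceDir i) F z) U := by
      intro y hy
      rw [dirDeriv_spaceTimeW a hU hF hy]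
      simp [spaceDir]
    have h1 := differentiableAt_of_contDiffOn hU (contDiffOn_dirDeriv hU hL (spaceDir i)) hz
    have h2 := differentiableAt_of_contDiffOn hU (contDiffOn_dirDeriv hU hG (spaceDir i)) hz
    have h3 := differentiableAt_of_contDiffOn hU (contDiffOn_dirDeriv hU hF (spaceDir i)) hz
    have h4 : DifferentiableAt ℝ (fun z : ℝ × Space n => a - z.1) z := by fun_prop
    rw [dirDeriv_congr hU h0 hz, dirDeriv_add (h4.fun_mul ((h1.const_mul 2).fun_sub h2)) h3,
      dirDeriv_mul h4 ((h1.const_mul 2).fun_sub h2), dirDeriv_sub (h1.const_mul 2) h2,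
      dirDeriv_const_mul h1, dirDeriv_timeFun]
    simp [spaceDir]
  simp only [spaceLaplacian] at key ⊢
  simp_rw [key, Finset.sum_add_distrib, ← Finset.mul_sum, Finset.sum_sub_distrib, ← Finset.mul_sum]

/-- Bochner's formula in flat space. -/
theorem spaceLaplacian_spaceGradSq (hU : IsOpen U) (hF : ContDiffOn ℝ ∞ F U) (hz : z ∈ U) :
    spaceLaplacian (spaceGradSq F) z
      = 2 * (∑ i, ∑ j, dirDeriv (spaceDir i) (dirDeriv (spaceDir j) F) z ^ 2)
        + 2 * spaceGradInner F (spaceLaplacian F) z := by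
  have hs := fun v : ℝ × Space n => contDiffOn_dirDeriv hU hF v
  have hs2 := fun v w : ℝ × Space n => contDiffOn_dirDeriv hU (hs v) w
  have key : ∀ i : Fin (n + 1), dirDeriv (spaceDir i) (dirDeriv (spaceDir i) (spaceGradSq F)) z
      = 2 * ∑ j, (dirDeriv (spaceDir i) (dirDeriv (spaceDir j) F) z ^ 2 + dirDeriv (spaceDir j) F z
        * dirDeriv (spaceDir j) (dirDeriv (spaceDir i) (dirDeriv (spaceDir i) F)) z) := by
    intro i
    have h0 : EqOn (dirDeriv (spaceDir i) (spaceGradSq F)) (fun z => 2 * ∑ j,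
        dirDeriv (spaceDir j) F z * dirDeriv (spaceDir i) (dirDeriv (spaceDir j) F) z) U :=
      fun y hy => dirDeriv_spaceGradSq hU hF hy _
    have hd1 := fun v => differentiableAt_of_contDiffOn hU (hs v) hz
    have hd2 := fun v w => differentiableAt_of_contDiffOn hU (hs2 v w) hz
    rw [dirDeriv_congr hU h0 hz, dirDeriv_const_mul
      (DifferentiableAt.fun_sum fun j _ => (hd1 _).fun_mul (hd2 _ _)),
      dirDeriv_sum fun j _ => (hd1 _).fun_mul (hd2 _ _)]
    congr 1
    refine Finset.sum_congr rfl fun j _ => ?_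
    rw [dirDeriv_mul (hd1 _) (hd2 _ _), sq]
    congr 2
    rw [dirDeriv_congr hU (fun y hy => dirDeriv_comm hU hF hy (spaceDir i) (spaceDir j)) hz,
      dirDeriv_comm hU (hs _) hz]
  have hL : ∀ j : Fin (n + 1), dirDeriv (spaceDir j) (spaceLaplacian F) z
      = ∑ i, dirDeriv (spaceDir j) (dirDeriv (spaceDir i) (dirDeriv (spaceDir i) F)) z := fun j =>
    dirDeriv_sum (fun i _ => differentiableAt_of_contDiffOn hU (hs2 _ _) hz) _
  simp only [spaceGradInner, hL]
  simp only [spaceLaplacian]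
  simp_rw [key, Finset.sum_add_distrib, ← Finset.mul_sum, Finset.sum_add_distrib, mul_add]
  congr 2
  rw [Finset.sum_comm]
  exact Finset.sum_congr rfl fun j _ => (Finset.mul_sum _ _ _).symm

/-- The square `|∇²F - I / (2τ)|²`, expanded. -/
theorem solitonSq_eq {τ : ℝ} (hτ : τ ≠ 0) : 2 * τ * solitonSq τ F z
    = 2 * τ * (∑ i, ∑ j, dirDeriv (spaceDir i) (dirDeriv (spaceDir j) F) z ^ 2)
      - 2 * spaceLaplacian F z + (n + 1) / (2 * τ) := by
  have h1 : ∀ i : Fin (n + 1), ∑ j, (dirDeriv (spaceDir i) (dirDeriv (spaceDir j) F) z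
      - if i = j then 1 / (2 * τ) else 0) ^ 2
      = (∑ j, dirDeriv (spaceDir i) (dirDeriv (spaceDir j) F) z ^ 2)
        - dirDeriv (spaceDir i) (dirDeriv (spaceDir i) F) z / τ + 1 / (2 * τ) ^ 2 := by
    intro i
    have : ∀ j : Fin (n + 1), (dirDeriv (spaceDir i) (dirDeriv (spaceDir j) F) z
        - if i = j then 1 / (2 * τ) else 0) ^ 2
        = dirDeriv (spaceDir i) (dirDeriv (spaceDir j) F) z ^ 2
          - (if i = j then dirDeriv (spaceDir i) (dirDeriv (spaceDir j) F) z / τ else 0)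
          + if i = j then 1 / (2 * τ) ^ 2 else 0 := by
      intro j
      split_ifs
      · field_simp; ring
      · ring
    simp_rw [this, Finset.sum_add_distrib, Finset.sum_sub_distrib, Finset.sum_ite_eq,
      Finset.mem_univ, if_true]
  simp only [solitonSq, h1, spaceLaplacian, Finset.sum_add_distrib, Finset.sum_sub_distrib,
    Finset.sum_const, Finset.card_univ, Fintype.card_fin, nsmul_eq_mul, ← Finset.sum_div]
  push_cast
  field_simp

/-- Perelman's computation: if `F_t + ΔF = |∇F|² + (n + 1) / (2τ)`, then
`W_t + ΔW = 2τ |∇²F - I / (2τ)|² + 2 ∇W · ∇F`. -/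
theorem spaceTimeW_evolution {a : ℝ} (hU : IsOpen U) (hF : ContDiffOn ℝ ∞ F U)
    (hτ : ∀ z ∈ U, a - z.1 ≠ 0)
    (heat : ∀ z ∈ U, dirDeriv timeDir F z + spaceLaplacian F z
      = spaceGradSq F z + (n + 1) / (2 * (a - z.1))) (hz : z ∈ U) :
    dirDeriv timeDir (spaceTimeW a F) z + spaceLaplacian (spaceTimeW a F) z
      = 2 * (a - z.1) * solitonSq (a - z.1) F z + 2 * spaceGradInner (spaceTimeW a F) F z := by
  have hs := fun v : ℝ × Space n => contDiffOn_dirDeriv hU hF v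
  have hs2 := fun v w : ℝ × Space n => contDiffOn_dirDeriv hU (hs v) w
  have hL := contDiffOn_spaceLaplacian hU hF
  have hG := contDiffOn_spaceGradSq hU hF
  have hdiv : ∀ y ∈ U, DifferentiableAt ℝ
      (fun z : ℝ × Space n => ((n : ℝ) + 1) / (2 * (a - z.1))) y := fun y hy => by
    have := hτ y hy
    have h2 : (2 * (a - y.1)) ≠ 0 := by positivity
    fun_prop (disch := assumption)
  -- The term `(n + 1) / (2τ)` does not depend on space.
  have hdiv0 : ∀ y ∈ U, ∀ i : Fin (n + 1), dirDeriv (spaceDir i)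
      (fun z : ℝ × Space n => ((n : ℝ) + 1) / (2 * (a - z.1))) y = 0 := fun y hy i => by
    have h1 : HasDerivAt (fun r : ℝ => ((n : ℝ) + 1) / (2 * (a - (y + r • spaceDir i).1))) 0 0 := by
      simpa [spaceDir] using hasDerivAt_const (0 : ℝ) (((n : ℝ) + 1) / (2 * (a - y.1)))
    have h2 : HasDerivAt (fun r : ℝ => y + r • (spaceDir i : ℝ × Space n)) (spaceDir i) 0 := by
      simpa using ((hasDerivAt_id (0 : ℝ)).smul_const (spaceDir i)).const_add y
    have h3 := (hdiv y hy).hasFDerivAt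
    rw [← add_zero y, ← zero_smul ℝ (spaceDir i : ℝ × Space n)] at h3
    have h4 := h3.comp_hasDerivAt (0 : ℝ) h2
    rw [zero_smul, add_zero] at h4
    exact h4.unique h1
  -- The heat equation differentiated in space, once and twice.
  have heat1 : ∀ y ∈ U, ∀ i : Fin (n + 1), dirDeriv (spaceDir i) (dirDeriv timeDir F) y
      = dirDeriv (spaceDir i) (spaceGradSq F) y - dirDeriv (spaceDir i) (spaceLaplacian F) y := by
    intro y hy i
    have h1 := differentiableAt_of_contDiffOn hU (hs timeDir) hy
    have h2 := differentiableAt_of_contDiffOn hU hL hy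
    have h3 := differentiableAt_of_contDiffOn hU hG hy
    have := dirDeriv_congr hU heat hy (spaceDir i)
    rw [dirDeriv_add h1 h2, dirDeriv_add h3 (hdiv y hy), hdiv0 y hy] at this
    linarith
  have heat2 : spaceLaplacian (dirDeriv timeDir F) z
      = spaceLaplacian (spaceGradSq F) z - spaceLaplacian (spaceLaplacian F) z := by
    simp only [spaceLaplacian]
    rw [← Finset.sum_sub_distrib]
    refine Finset.sum_congr rfl fun i _ => ?_
    rw [dirDeriv_congr hU (fun y hy => heat1 y hy i) hz, dirDeriv_sub]
    · exact differentiableAt_of_contDiffOn hU (contDiffOn_dirDeriv hU hG _) hz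
    · exact differentiableAt_of_contDiffOn hU (contDiffOn_dirDeriv hU hL _) hz
  have htL : dirDeriv timeDir (spaceLaplacian F) z = spaceLaplacian (dirDeriv timeDir F) z := by
    simp only [spaceLaplacian]
    change dirDeriv timeDir (fun z => ∑ i, dirDeriv (spaceDir i) (dirDeriv (spaceDir i) F) z) z = _
    rw [dirDeriv_sum fun i _ => differentiableAt_of_contDiffOn hU (hs2 _ _) hz]
    refine Finset.sum_congr rfl fun i _ => ?_
    rw [dirDeriv_comm hU (hs _) hz, dirDeriv_congr hU
      (fun y hy => dirDeriv_comm hU hF hy timeDir (spaceDir i)) hz]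
  have htG : dirDeriv timeDir (spaceGradSq F) z
      = 2 * spaceGradInner F (spaceGradSq F) z - 2 * spaceGradInner F (spaceLaplacian F) z := by
    rw [dirDeriv_spaceGradSq hU hF hz, ← mul_sub]
    simp only [spaceGradInner]
    rw [← Finset.sum_sub_distrib]
    congr 1
    refine Finset.sum_congr rfl fun i _ => ?_
    rw [dirDeriv_comm hU hF hz, heat1 z hz]; ring
  have hin : spaceGradInner (spaceTimeW a F) F z = (a - z.1)
      * (2 * spaceGradInner F (spaceLaplacian F) z - spaceGradInner F (spaceGradSq F) z)
      + spaceGradSq F z := by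
    simp only [spaceGradInner]
    conv_rhs => rw [spaceGradSq]
    rw [Finset.mul_sum, ← Finset.sum_sub_distrib, Finset.mul_sum, ← Finset.sum_add_distrib]
    refine Finset.sum_congr rfl fun i _ => ?_
    rw [dirDeriv_spaceTimeW a hU hF hz]
    simp only [spaceDir]; ring
  rw [dirDeriv_spaceTimeW a hU hF hz, spaceLaplacian_spaceTimeW a hU hF hz, solitonSq_eq (hτ z hz),
    hin, htL, htG, heat2, spaceLaplacian_spaceGradSq hU hF hz]
  have := heat z hz
  simp only [timeDir]
  change dirDeriv (1, 0) F z + spaceLaplacian F z = _ at this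
  linear_combination this

/-! ### Restriction of space-time functions to a time slice -/

theorem laplacian_slice (hU : IsOpen U) (hF : ContDiffOn ℝ ∞ F U) (hz : z ∈ U) :
    Laplacian.laplacian (fun y => F (z.1, y)) z.2 = spaceLaplacian F z := by
  rw [InnerProductSpace.laplacian_eq_iteratedFDeriv_orthonormalBasis _
    (EuclideanSpace.basisFun (Fin (n + 1)) ℝ)]
  refine Finset.sum_congr rfl fun i _ => ?_
  rw [iteratedFDeriv_two_apply]
  simp only [Matrix.cons_val_zero, Matrix.cons_val_one, EuclideanSpace.basisFun_apply]
  set v : Space n := EuclideanSpace.single i 1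
  have hUz : IsOpen ((fun y : Space n => (z.1, y)) ⁻¹' U) := hU.preimage (by fun_prop)
  have hsl : ContDiffOn ℝ ∞ (fun y => F (z.1, y)) ((fun y : Space n => (z.1, y)) ⁻¹' U) :=
    hF.comp (by fun_prop) fun y hy => hy
  rw [← dirDeriv_dirDeriv hUz hsl hz]
  have h1 : EqOn (dirDeriv v fun y => F (z.1, y)) (fun y => dirDeriv (spaceDir i) F (z.1, y))
      ((fun y : Space n => (z.1, y)) ⁻¹' U) := fun y hy =>
    fderiv_space_slice (z := (z.1, y)) (differentiableAt_of_contDiffOn hU hF hy) v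
  rw [dirDeriv_congr hUz h1 hz]
  exact fderiv_space_slice
    (differentiableAt_of_contDiffOn hU (contDiffOn_dirDeriv hU hF _) hz) v

theorem inner_gradient_slice (hU : IsOpen U) (hF : ContDiffOn ℝ ∞ F U) (hz : z ∈ U) (v : Space n) :
    ⟪∇ (fun y => F (z.1, y)) z.2, v⟫ = fderiv ℝ F z (0, v) := by
  rw [inner_gradient_left, fderiv_space_slice (differentiableAt_of_contDiffOn hU hF hz)]

theorem gradient_slice_coord (hU : IsOpen U) (hF : ContDiffOn ℝ ∞ F U) (hz : z ∈ U)
    (i : Fin (n + 1)) : ∇ (fun y => F (z.1, y)) z.2 i = dirDeriv (spaceDir i) F z := by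
  rw [dirDeriv, spaceDir, ← inner_gradient_slice hU hF hz]
  rw [EuclideanSpace.inner_single_right]; simp

theorem norm_gradient_slice_sq (hU : IsOpen U) (hF : ContDiffOn ℝ ∞ F U) (hz : z ∈ U) :
    ‖∇ (fun y => F (z.1, y)) z.2‖ ^ 2 = spaceGradSq F z := by
  rw [EuclideanSpace.norm_sq_eq]
  refine Finset.sum_congr rfl fun i _ => ?_
  rw [gradient_slice_coord hU hF hz, Real.norm_eq_abs, sq_abs]

theorem perelmanW_slice (a : ℝ) (hU : IsOpen U) (hF : ContDiffOn ℝ ∞ F U) (hz : z ∈ U) :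
    perelmanW (fun y => F (z.1, y)) (a - z.1) z.2 = spaceTimeW a F z := by
  rw [perelmanW, laplacian_slice hU hF hz, norm_gradient_slice_sq hU hF hz]; rfl

end SpaceTime

/-! ### Derivatives along hypersurfaces -/

/-- The derivative within a regular level set, in a tangential direction, of a function with a
differentiable extension is the derivative of the extension. Derivatives within a hypersurface are
not unique, but their values on tangent vectors are. -/
theorem fderivWithin_apply_of_levelSet {X Y : Type*} [NormedAddCommGroup X] [NormedSpace ℝ X]
    [CompleteSpace X] [NormedAddCommGroup Y] [NormedSpace ℝ Y] {S : Set X} {R : X → ℝ}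
    {R' : X →L[ℝ] ℝ} {z : X} (hR : HasStrictFDerivAt R R' z) (hR0 : R' ≠ 0) (hz : R z = 0)
    (hS : ∀ᶠ y in nhds z, y ∈ S ↔ R y = 0) {g G : X → Y} (hG : DifferentiableAt ℝ G z)
    (hgG : ∀ᶠ y in nhds z, y ∈ S → g y = G y) {v : X} (hv : R' v = 0) :
    fderivWithin ℝ g S z v = fderiv ℝ G z v := by
  have hrange : (R' : X →ₗ[ℝ] ℝ).range = ⊤ := LinearMap.range_eq_top.2
    (LinearMap.surjective fun h => hR0 (ContinuousLinearMap.coe_injective h))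
  have hzS : z ∈ S := hS.self_of_nhds.2 hz
  have hg : HasFDerivWithinAt g (fderiv ℝ G z) S z := by
    refine hG.hasFDerivAt.hasFDerivWithinAt.congr_of_eventuallyEq ?_ (hgG.self_of_nhds hzS)
    filter_upwards [nhdsWithin_le_nhds hgG, self_mem_nhdsWithin] with y hy hyS using hy hyS
  -- The implicit function theorem provides a curve in the level set with velocity `v`.
  let v' : (R' : X →ₗ[ℝ] ℝ).ker := ⟨v, hv⟩
  let c : ℝ → X := fun s => hR.implicitFunction R R' hrange (R z) (s • v')
  have hc0 : c 0 = z := by simp [c]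
  have hc : HasDerivAt c v 0 := by
    have h1 : HasDerivAt (fun s : ℝ => s • v') v' 0 := by
      simpa using (hasDerivAt_id (0 : ℝ)).smul_const v'
    have h2 := (hR.to_implicitFunction hrange).hasFDerivAt
    rw [← zero_smul ℝ v'] at h2
    exact h2.comp_hasDerivAt (0 : ℝ) h1
  have hcS : ∀ᶠ s in nhds (0 : ℝ), c s ∈ S := by
    have h1 : Filter.Tendsto c (nhds 0) (nhds z) := by simpa [hc0] using hc.continuousAt.tendsto
    have h2 : Filter.Tendsto (fun s : ℝ => (R z, s • v')) (nhds 0) (nhds (R z, 0)) := by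
      have : Continuous (fun s : ℝ => (R z, s • v')) := by fun_prop
      simpa using this.tendsto 0
    filter_upwards [h1.eventually hS, h2.eventually (hR.map_implicitFunction_eq hrange)]
      with s hs hs'
    exact hs.2 (hs'.trans hz)
  have k1 : HasDerivAt (g ∘ c) (fderiv ℝ G z v) 0 :=
    HasFDerivWithinAt.comp_hasDerivAt (0 : ℝ) (by rwa [hc0]) hc hcS
  have k2 : HasDerivAt (g ∘ c) (fderivWithin ℝ g S z v) 0 :=
    HasFDerivWithinAt.comp_hasDerivAt (0 : ℝ)
      (by rw [hc0]; exact hg.differentiableWithinAt.hasFDerivWithinAt) hc hcS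
  exact k2.unique k1

/-! ### The spatial gradient on space-time -/

/-- The gradient in the space variables of a function on space-time. -/
noncomputable def spaceGrad (F : ℝ × Space n → ℝ) (z : ℝ × Space n) : Space n :=
  (InnerProductSpace.toDual ℝ (Space n)).symm
    ((fderiv ℝ F z).comp (ContinuousLinearMap.inr ℝ ℝ (Space n)))

theorem inner_spaceGrad (F : ℝ × Space n → ℝ) (z : ℝ × Space n) (v : Space n) :
    ⟪spaceGrad F z, v⟫ = fderiv ℝ F z (0, v) := by
  rw [spaceGrad, InnerProductSpace.toDual_symm_apply]; rfl

theorem spaceGrad_eq_gradient {F : ℝ × Space n → ℝ} {z : ℝ × Space n}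
    (h : DifferentiableAt ℝ F z) : spaceGrad F z = ∇ (fun y => F (z.1, y)) z.2 := by
  rw [gradient, (hasFDerivAt_space_slice h).fderiv]; rfl

theorem contDiffOn_spaceGrad {U : Set (ℝ × Space n)} {F : ℝ × Space n → ℝ} (hU : IsOpen U)
    (hF : ContDiffOn ℝ ∞ F U) : ContDiffOn ℝ ∞ (spaceGrad F) U :=
  (InnerProductSpace.toDual ℝ (Space n)).symm.toContinuousLinearEquiv.contDiff.comp_contDiffOn
    ((hF.fderiv_of_isOpen hU (by simp)).clm_comp contDiffOn_const)

theorem inner_fderiv_spaceGrad {U : Set (ℝ × Space n)} {F : ℝ × Space n → ℝ} (hU : IsOpen U)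
    (hF : ContDiffOn ℝ ∞ F U) {z : ℝ × Space n} (hz : z ∈ U) (v : ℝ × Space n) (w : Space n) :
    ⟪fderiv ℝ (spaceGrad F) z v, w⟫ = fderiv ℝ (fderiv ℝ F) z v (0, w) := by
  have h1 := (differentiableAt_of_contDiffOn hU (contDiffOn_spaceGrad hU hF) hz).hasFDerivAt
  have h2 := (h1.inner ℝ (hasFDerivAt_const w z)).fderiv
  have h3 : (fun y => ⟪spaceGrad F y, w⟫) = dirDeriv ((0 : ℝ), w) F :=
    funext fun y => inner_spaceGrad F y w
  rw [h3] at h2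
  have h4 := dirDeriv_dirDeriv hU hF hz v ((0 : ℝ), w)
  rw [dirDeriv, h2] at h4
  simpa using h4

/-! ### Normal fields along a moving boundary -/

/-- A continuous function on space-time that is constant in a time slice of a domain keeps its value
at the boundary points of the slice. -/
theorem eq_of_mem_closure_slice {Y : Type*} [TopologicalSpace Y] [T2Space Y] {Ψ : ℝ × Space n → Y}
    {D : Set (Space n)} {t : ℝ} {x : Space n} (hx : x ∈ closure D) (hΨ : ContinuousAt Ψ (t, x))
    {c : Y} (h : ∀ᶠ y in nhds x, y ∈ D → Ψ (t, y) = c) : Ψ (t, x) = c := by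
  have : (nhdsWithin x D).NeBot := mem_closure_iff_nhdsWithin_neBot.1 hx
  have h1 : Filter.Tendsto (fun y => Ψ (t, y)) (nhdsWithin x D) (nhds (Ψ (t, x))) :=
    (ContinuousAt.comp (f := fun y : Space n => (t, y)) hΨ (by fun_prop)).tendsto.mono_left
      nhdsWithin_le_nhds
  refine tendsto_nhds_unique h1 (tendsto_const_nhds.congr' ?_)
  filter_upwards [nhdsWithin_le_nhds h, self_mem_nhdsWithin] with y hy hyD using (hy hyD).symm

/-- A family of domains moving with velocity `-∇F` has, near a boundary point in space-time, a
differentiable unit field `N` extending the outer unit normals of the slices. It changes along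
trajectories by `Y · N' = ∇²F(Y, N)` for tangential `Y`. -/
theorem exists_normal_field {T : ℝ} {Ω₀ : Set (Space n)} {φ : ℝ → Space n → Space n}
    (hφ : IsSmoothDiffeoFamily T Ω₀ φ) (hΩ₀ : IsBoundedSmoothDomain Ω₀)
    {F : ℝ × Space n → ℝ} {U : Set (ℝ × Space n)} (hU : IsOpen U) (hF : ContDiffOn ℝ ∞ F U)
    (hflow : ∀ t ∈ Ioo 0 T, ∀ p ∈ Ω₀, deriv (fun s => φ s p) t
      = -∇ (fun y => F (t, y)) (φ t p))
    {t : ℝ} (ht : t ∈ Ioo 0 T) {x : Space n} (hx : x ∈ frontier (domainAt Ω₀ φ t))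
    (hxU : (t, x) ∈ U) :
    ∃ (N : ℝ × Space n → Space n) (R : ℝ × Space n → ℝ) (c : ℝ), 0 < c ∧
      ContDiffAt ℝ ∞ R (t, x) ∧ DifferentiableAt ℝ N (t, x) ∧ ‖N (t, x)‖ = 1 ∧ R (t, x) = 0 ∧
      (∀ v, fderiv ℝ R (t, x) (0, v) = c * ⟪N (t, x), v⟫) ∧
      fderiv ℝ R (t, x) (1, -spaceGrad F (t, x)) = 0 ∧
      (∀ᶠ z in nhds (t, x), z.2 ∈ frontier (domainAt Ω₀ φ z.1) ↔ R z = 0) ∧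
      (∀ᶠ z in nhds (t, x), z.2 ∈ frontier (domainAt Ω₀ φ z.1) →
        outerUnitNormal (domainAt Ω₀ φ z.1) z.2 = N z) ∧
      (∀ v, ⟪N (t, x), fderiv ℝ N (t, x) v⟫ = 0) ∧
      ∀ Y, ⟪N (t, x), Y⟫ = 0 → ⟪Y, fderiv ℝ N (t, x) (1, -spaceGrad F (t, x))⟫
        = fderiv ℝ (fderiv ℝ F) (t, x) (0, Y) (0, N (t, x)) := by
  have hK := hΩ₀.isCompact_closure
  obtain ⟨R, O, hO, hxO, hR, hOT, hRΩ, ⟨v₀, hv₀⟩, htraj⟩ :=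
    exists_spacetime_definingFunction hφ hΩ₀ ht hx
  set z₀ : ℝ × Space n := (t, x) with hz₀
  set G := spaceGrad R with hG
  set g := spaceGrad F with hg
  have hGs : ContDiffOn ℝ ∞ G O := contDiffOn_spaceGrad hO hR
  have hgs : ContDiffOn ℝ ∞ g U := contDiffOn_spaceGrad hU hF
  have hG0 : G z₀ ≠ 0 := fun h => hv₀ (by rw [← inner_spaceGrad, ← hG, h, inner_zero_left])
  have hGc : ContinuousAt G z₀ := hGs.continuousOn.continuousAt (hO.mem_nhds hxO)
  have hdef : ∀ᶠ z in nhds z₀,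
      IsLocalDefiningFunction (domainAt Ω₀ φ z.1) z.2 (fun y => R (z.1, y)) := by
    filter_upwards [hGc.eventually_ne hG0, hO.mem_nhds hxO] with z hz hzO
    refine ⟨?_, (fun y => (z.1, y)) ⁻¹' O, hO.preimage (by fun_prop), hzO,
      hR.comp (by fun_prop) fun y hy => hy, fun y hy => hRΩ _ hy⟩
    rwa [← spaceGrad_eq_gradient (differentiableAt_of_contDiffOn hO hR hzO)]
  have hfront : ∀ᶠ z in nhds z₀, z.2 ∈ frontier (domainAt Ω₀ φ z.1) ↔ R z = 0 := by
    filter_upwards [hdef, hO.mem_nhds hxO] with z hz hzO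
    have ho := isOpen_domainAt hφ hΩ₀.isOpen hK (hOT z hzO)
    exact ⟨fun h => hz.eq_zero ho h, fun h => hz.mem_frontier ho h⟩
  -- The defining function is constant along trajectories, so `R_t = ∇R · ∇F`; this equation and its
  -- first derivatives extend to the boundary.
  set Q : ℝ × Space n → ℝ := fun z => fderiv ℝ R z (1, -g z) with hQ
  have hOU : IsOpen (O ∩ U) := hO.inter hU
  have hRd : ContDiffOn ℝ ∞ (fderiv ℝ R) O := hR.fderiv_of_isOpen hO (by simp)
  have hQs : ContDiffOn ℝ ∞ Q (O ∩ U) :=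
    (hRd.mono inter_subset_left).clm_apply
      (contDiffOn_const.prodMk (hgs.mono inter_subset_right).neg)
  have hQ0 : ∀ z ∈ O ∩ U, z.2 ∈ domainAt Ω₀ φ z.1 → Q z = 0 := by
    rintro z hz ⟨p, hp, hpz⟩
    have h1 := htraj z hz.1 p hp hpz
    rw [hflow z.1 (hOT z hz.1) p hp, hpz,
      ← spaceGrad_eq_gradient (differentiableAt_of_contDiffOn hU hF hz.2)] at h1
    exact h1
  have hxcl : x ∈ closure (domainAt Ω₀ φ t) := frontier_subset_closure hx
  have hslice : ∀ᶠ y in nhds x, (t, y) ∈ O ∩ U := by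
    have hc : ContinuousAt (fun y : Space n => (t, y)) x := by fun_prop
    exact hc.eventually (hOU.mem_nhds ⟨hxO, hxU⟩)
  have hQz : Q z₀ = 0 := by
    refine eq_of_mem_closure_slice hxcl (hQs.continuousOn.continuousAt (hOU.mem_nhds ⟨hxO, hxU⟩)) ?_
    filter_upwards [hslice] with y hy hyD using hQ0 _ hy hyD
  have hDQ : fderiv ℝ Q z₀ = 0 := by
    refine eq_of_mem_closure_slice hxcl ((hQs.fderiv_of_isOpen (m := ∞) hOU
      (by simp)).continuousOn.continuousAt (hOU.mem_nhds ⟨hxO, hxU⟩)) ?_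
    filter_upwards [hslice] with y hy hyD
    have h1 : Q =ᶠ[nhds (t, y)] fun _ => 0 := by
      filter_upwards [hOU.mem_nhds hy,
        eventually_mem_domainAt hφ hΩ₀.isOpen hK (z := (t, y)) ht hyD] with z hz hzD
      exact hQ0 z hz hzD
    rw [h1.fderiv_eq]; simp
  have hgd : HasFDerivAt g (fderiv ℝ g z₀) z₀ :=
    (differentiableAt_of_contDiffOn hU hgs hxU).hasFDerivAt
  have hDQ' : ∀ v, fderiv ℝ (fderiv ℝ R) z₀ v (1, -g z₀) - ⟪G z₀, fderiv ℝ g z₀ v⟫ = 0 := by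
    intro v
    have h1 := (differentiableAt_of_contDiffOn hO hRd hxO).hasFDerivAt.clm_apply
      ((hasFDerivAt_const (1 : ℝ) z₀).prodMk hgd.neg)
    have h2 := congrArg (fun L => L v) h1.fderiv
    change fderiv ℝ Q z₀ v = _ at h2
    rw [hDQ] at h2
    simp only [zero_apply, add_apply, ContinuousLinearMap.comp_apply,
      ContinuousLinearMap.flip_apply, ContinuousLinearMap.prod_apply,
      neg_apply] at h2
    rw [hG, inner_spaceGrad, sub_eq_add_neg, ← map_neg, Prod.neg_mk, neg_zero, add_comm]
    exact h2.symm
  have hevol : ∀ w, ⟪fderiv ℝ G z₀ (1, -g z₀), w⟫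
      = fderiv ℝ (fderiv ℝ F) z₀ (0, w) (0, G z₀) := by
    intro w
    rw [hG, inner_fderiv_spaceGrad hO hR hxO, fderiv_fderiv_symm hO hR hxO,
      ← inner_fderiv_spaceGrad hU hF hxU, real_inner_comm]
    linarith [hDQ' (0, w)]
  have hcd : DifferentiableAt ℝ (fun z => ‖G z‖⁻¹) z₀ :=
    ((differentiableAt_of_contDiffOn hO hGs hxO).norm ℝ hG0).inv (norm_ne_zero_iff.2 hG0)
  have hNd := hcd.hasFDerivAt.smul (differentiableAt_of_contDiffOn hO hGs hxO).hasFDerivAt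
  have hc : 0 < ‖G z₀‖ := norm_pos_iff.2 hG0
  refine ⟨fun z => ‖G z‖⁻¹ • G z, R, ‖G z₀‖, hc, hR.contDiffAt (hO.mem_nhds hxO),
    hNd.differentiableAt, ?_, hfront.self_of_nhds.1 hx, ?_, hQz, hfront, ?_, ?_, ?_⟩
  · rw [norm_smul, norm_inv, norm_norm, inv_mul_cancel₀ hc.ne']
  · intro v
    rw [real_inner_smul_left, ← mul_assoc, mul_inv_cancel₀ hc.ne', one_mul, hG, inner_spaceGrad]
  · filter_upwards [hdef, hO.mem_nhds hxO] with z hz hzO hzf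
    rw [outerUnitNormal_eq (isOpen_domainAt hφ hΩ₀.isOpen hK (hOT z hzO)) hzf hz,
      ← spaceGrad_eq_gradient (differentiableAt_of_contDiffOn hO hR hzO)]
  · intro v
    have h1 := (hNd.inner ℝ hNd)
    have h2 : HasFDerivAt (fun z => ⟪‖G z‖⁻¹ • G z, ‖G z‖⁻¹ • G z⟫)
        (0 : ℝ × Space n →L[ℝ] ℝ) z₀ := by
      refine (hasFDerivAt_const (1 : ℝ) z₀).congr_of_eventuallyEq ?_
      filter_upwards [hGc.eventually_ne hG0] with z hz
      rw [real_inner_self_eq_norm_sq, norm_smul, norm_inv, norm_norm,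
        inv_mul_cancel₀ (norm_ne_zero_iff.2 hz), one_pow]
    have h3 := congrArg (fun L => L v) (h1.unique h2)
    have h4 : fderiv ℝ (fun z => ‖G z‖⁻¹ • G z) z₀ = _ := hNd.fderiv
    rw [h4]
    simp only [ContinuousLinearMap.comp_apply, ContinuousLinearMap.prod_apply,
      fderivInnerCLM_apply, zero_apply] at h3
    rw [real_inner_comm (((fun z => ‖G z‖⁻¹) • G) z₀)] at h3
    change ⟪((fun z => ‖G z‖⁻¹) • G) z₀, _⟫ = 0
    linarith
  · intro Y hY
    have h4 : fderiv ℝ (fun z => ‖G z‖⁻¹ • G z) z₀ = _ := hNd.fderiv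
    have hYG : ⟪Y, G z₀⟫ = 0 := by
      rw [real_inner_smul_left] at hY
      rw [real_inner_comm]
      exact (mul_eq_zero.1 hY).resolve_left (inv_ne_zero hc.ne')
    rw [h4]
    simp only [add_apply, smul_apply,
      ContinuousLinearMap.smulRight_apply, inner_add_right, real_inner_smul_right, hYG, mul_zero,
      add_zero]
    rw [real_inner_comm, hevol]
    have : ((0 : ℝ), ‖G z₀‖⁻¹ • G z₀) = ‖G z₀‖⁻¹ • ((0 : ℝ), G z₀) := by simp
    rw [this, map_smul]; rfl

/-! ### The boundary integrand -/

/-- The tangential gradient, tested against a vector `w`, is the derivative of an extension in the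
direction of the tangential part of `w`. -/
theorem inner_tangentialGradient {D : Set (Space n)} {x : Space n} {R : Space n → ℝ}
    {R' : Space n →L[ℝ] ℝ} {c : ℝ} (hc : 0 < c) (hR : HasStrictFDerivAt R R' x)
    (hR' : ∀ v, R' v = c * ⟪outerUnitNormal D x, v⟫) (hν : ‖outerUnitNormal D x‖ = 1)
    (hz : R x = 0) (hS : ∀ᶠ y in nhds x, y ∈ frontier D ↔ R y = 0) {g G : Space n → ℝ}
    (hG : DifferentiableAt ℝ G x) (hgG : ∀ᶠ y in nhds x, y ∈ frontier D → g y = G y)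
    (w : Space n) : ⟪tangentialGradient D g x, w⟫
      = fderiv ℝ G x (w - ⟪outerUnitNormal D x, w⟫ • outerUnitNormal D x) := by
  set ν := outerUnitNormal D x with hνdef
  have hνν : ⟪ν, ν⟫ = 1 := by rw [real_inner_self_eq_norm_sq, hν, one_pow]
  have hR0 : R' ≠ 0 := by
    intro h
    have h1 := hR' ν
    rw [h, hνν] at h1
    simp at h1
    exact hc.ne h1
  have htan : R' (w - ⟪ν, w⟫ • ν) = 0 := by
    rw [hR', inner_sub_right, real_inner_smul_right, hνν]; ring
  rw [← fderivWithin_apply_of_levelSet hR hR0 hz hS hG hgG htan, tangentialGradient,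
    inner_sub_left, real_inner_smul_left, ← hνdef, gradientWithin, map_sub, map_smul,
    InnerProductSpace.toDual_symm_apply, InnerProductSpace.toDual_symm_apply, smul_eq_mul]
  ring

/-- On the boundary, the terms of the Harnack expression that involve the shape of the hypersurface
cancel: only the Hessian of `f` along trajectories, in normal direction, remains. -/
theorem harnackExpr_eq {T : ℝ} {Ω₀ : Set (Space n)} {φ : ℝ → Space n → Space n}
    (hφ : IsSmoothDiffeoFamily T Ω₀ φ) (hΩ₀ : IsBoundedSmoothDomain Ω₀)
    {f β : ℝ → Space n → ℝ} {U : Set (ℝ × Space n)} (hU : IsOpen U)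
    (hF : ContDiffOn ℝ ∞ (fun z : ℝ × Space n => f z.1 z.2) U)
    (hflow : ∀ t ∈ Ioo 0 T, ∀ p ∈ Ω₀, deriv (fun s => φ s p) t = -∇ (f t) (φ t p))
    (hneumann : ∀ t ∈ Ioo 0 T, ∀ x ∈ frontier (domainAt Ω₀ φ t),
      ⟪∇ (f t) x, outerUnitNormal (domainAt Ω₀ φ t) x⟫ = β t x)
    {t : ℝ} (ht : t ∈ Ioo 0 T) {x : Space n} (hx : x ∈ frontier (domainAt Ω₀ φ t))
    (hxU : (t, x) ∈ U) (τ : ℝ) :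
    harnackExpr (domainAt Ω₀ φ) β f τ t x
      = fderiv ℝ (fderiv ℝ fun z : ℝ × Space n => f z.1 z.2) (t, x) (1, -∇ (f t) x)
          (0, outerUnitNormal (domainAt Ω₀ φ t) x) - β t x / (2 * τ) := by
  obtain ⟨N, R, c, hc, hR, hN, hN1, hR0, hRv, hRt, hfront, hnormal, hNN, hNY⟩ :=
    exists_normal_field hφ hΩ₀ hU hF hflow ht hx hxU
  set F : ℝ × Space n → ℝ := fun z => f z.1 z.2 with hFdef
  set z₀ : ℝ × Space n := (t, x) with hz₀
  set g := spaceGrad F with hg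
  have hFd : ∀ z ∈ U, DifferentiableAt ℝ F z := fun z hz => differentiableAt_of_contDiffOn hU hF hz
  have hgrad : ∀ z ∈ U, ∇ (f z.1) z.2 = g z := fun z hz => (spaceGrad_eq_gradient (hFd z hz)).symm
  have hgd : DifferentiableAt ℝ g z₀ :=
    differentiableAt_of_contDiffOn hU (contDiffOn_spaceGrad hU hF) hxU
  have hν : outerUnitNormal (domainAt Ω₀ φ t) x = N z₀ := hnormal.self_of_nhds hx
  set B : ℝ × Space n → ℝ := fun z => ⟪g z, N z⟫ with hB
  have hBd : DifferentiableAt ℝ B z₀ := hgd.inner ℝ hN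
  have hDB : ∀ v, fderiv ℝ B z₀ v = ⟪fderiv ℝ g z₀ v, N z₀⟫ + ⟪g z₀, fderiv ℝ N z₀ v⟫ := by
    intro v; rw [hB, fderiv_inner_apply ℝ hgd hN, add_comm]
  have hβB : ∀ᶠ z in nhds z₀, z.2 ∈ frontier (domainAt Ω₀ φ z.1) → β z.1 z.2 = B z := by
    have h1 : ∀ᶠ z : ℝ × Space n in nhds z₀, z.1 ∈ Ioo 0 T :=
      continuousAt_fst.eventually (isOpen_Ioo.mem_nhds ht)
    filter_upwards [hnormal, h1, hU.mem_nhds hxU] with z hz hzT hzU hzf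
    rw [← hneumann z.1 hzT z.2 hzf, hz hzf, hgrad z hzU]
  have hb : β t x = ⟪g z₀, N z₀⟫ := hβB.self_of_nhds hx
  set b := β t x with hbdef
  set Y := g z₀ - b • N z₀ with hY
  have hNN1 : ⟪N z₀, N z₀⟫ = 1 := by rw [real_inner_self_eq_norm_sq, hN1, one_pow]
  have hNYz : ⟪N z₀, Y⟫ = 0 := by
    rw [hY, inner_sub_right, real_inner_smul_right, hNN1, hb, real_inner_comm]; ring
  have hYN : ⟪Y, N z₀⟫ = 0 := by rw [real_inner_comm]; exact hNYz
  -- The normal velocity differs from the velocity of trajectories by a tangent vector.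
  have hdir : ((1 : ℝ), -b • N z₀) = (1, -g z₀) + (0, Y) := by
    rw [Prod.mk_add_mk, add_zero, hY, neg_smul]; congr 1; abel
  have hstrict : HasStrictFDerivAt R (fderiv ℝ R z₀) z₀ := hR.hasStrictFDerivAt (by simp)
  have hRne : fderiv ℝ R z₀ ≠ 0 := by
    intro h
    have h1 := hRv (N z₀)
    rw [h, hNN1] at h1
    simp at h1
    exact hc.ne h1
  have htime : normalTimeDeriv (domainAt Ω₀ φ) β β t x = fderiv ℝ B z₀ (1, -b • N z₀) := by
    rw [normalTimeDeriv, hν]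
    refine fderivWithin_apply_of_levelSet hstrict hRne hR0 hfront hBd hβB ?_
    rw [← hbdef, hdir, map_add, hRt, hRv, hNYz]; simp
  -- Restriction to the time slice.
  have hslice : Filter.Tendsto (fun y : Space n => (t, y)) (nhds x) (nhds z₀) := by
    have : ContinuousAt (fun y : Space n => (t, y)) x := by fun_prop
    exact this
  have hRs : HasStrictFDerivAt (fun y => R (t, y))
      ((fderiv ℝ R z₀).comp (ContinuousLinearMap.inr ℝ ℝ (Space n))) x :=
    hstrict.comp x ((hasStrictFDerivAt_const t x).prodMk (hasStrictFDerivAt_id x))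
  have hRs' : ∀ v, ((fderiv ℝ R z₀).comp (ContinuousLinearMap.inr ℝ ℝ (Space n))) v
      = c * ⟪outerUnitNormal (domainAt Ω₀ φ t) x, v⟫ := fun v => by rw [hν, ← hRv]; simp
  have hRs0 : (fderiv ℝ R z₀).comp (ContinuousLinearMap.inr ℝ ℝ (Space n)) ≠ 0 := by
    intro h
    have h1 := hRs' (N z₀)
    rw [h, hν, hNN1] at h1
    simp at h1
    exact hc.ne h1
  have hfs : ∀ᶠ y in nhds x, y ∈ frontier (domainAt Ω₀ φ t) ↔ R (t, y) = 0 :=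
    hslice.eventually hfront
  have htang := fun (h : Space n → ℝ) (H : ℝ × Space n → ℝ) (hH : DifferentiableAt ℝ H z₀)
    (hhH : ∀ᶠ y in nhds x, y ∈ frontier (domainAt Ω₀ φ t) → h y = H (t, y)) =>
    inner_tangentialGradient hc hRs hRs' (by rw [hν, hN1]) hR0 hfs
      (hasFDerivAt_space_slice hH).differentiableAt hhH
  have htf : tangentialGradient (domainAt Ω₀ φ t) (f t) x = Y := by
    refine ext_inner_right ℝ fun w => ?_
    rw [htang (f t) F (hFd z₀ hxU) (.of_forall fun y _ => rfl) w, hν,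
      fderiv_space_slice (z := z₀) (hFd z₀ hxU), ← inner_spaceGrad, ← hg, hY, inner_sub_right,
      inner_sub_left, real_inner_smul_right, real_inner_smul_left, hb]
    ring
  have htβ : ⟪tangentialGradient (domainAt Ω₀ φ t) (β t) x, Y⟫ = fderiv ℝ B z₀ (0, Y) := by
    rw [htang (β t) B hBd (hslice.eventually hβB) Y, hν, fderiv_space_slice (z := z₀) hBd, hNYz]
    simp
  have hsff : secondFundamentalForm (domainAt Ω₀ φ t) x Y Y = ⟪fderiv ℝ N z₀ (0, Y), Y⟫ := by
    rw [secondFundamentalForm, fderivWithin_apply_of_levelSet hRs hRs0 hR0 hfs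
      (hasFDerivAt_space_slice hN).differentiableAt (hslice.eventually hnormal)
      (by rw [hRs', hν, hNYz, mul_zero]), fderiv_space_slice (z := z₀) hN]
  have hgdec : g z₀ = Y + b • N z₀ := by rw [hY]; abel
  have hgN : ∀ v, ⟪g z₀, fderiv ℝ N z₀ v⟫ = ⟪Y, fderiv ℝ N z₀ v⟫ := fun v => by
    rw [hgdec, inner_add_left, real_inner_smul_left, hNN v, mul_zero, add_zero]
  have hHg : ∀ v, ⟪fderiv ℝ g z₀ v, N z₀⟫ = fderiv ℝ (fderiv ℝ F) z₀ v (0, N z₀) := fun v =>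
    inner_fderiv_spaceGrad hU hF hxU v (N z₀)
  have e1 : fderiv ℝ B z₀ (1, -g z₀) = fderiv ℝ (fderiv ℝ F) z₀ (1, -g z₀) (0, N z₀)
      + fderiv ℝ (fderiv ℝ F) z₀ (0, Y) (0, N z₀) := by
    rw [hDB, hHg, hgN, hNY Y hNYz]
  have e2 : fderiv ℝ B z₀ (0, Y) = fderiv ℝ (fderiv ℝ F) z₀ (0, Y) (0, N z₀)
      + ⟪fderiv ℝ N z₀ (0, Y), Y⟫ := by
    rw [hDB, hHg, hgN, real_inner_comm Y]
  rw [harnackExpr, htime, htf, htβ, hsff, hdir, map_add, e1, e2, hν, hgrad z₀ hxU]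
  ring

theorem spaceGrad_eq_sum (F : ℝ × Space n → ℝ) (z : ℝ × Space n) :
    ((0 : ℝ), spaceGrad F z) = ∑ i, dirDeriv (spaceDir i) F z • spaceDir i := by
  have h : spaceGrad F z
      = ∑ i, dirDeriv (spaceDir i) F z • (EuclideanSpace.single i 1 : Space n) := by
    conv_lhs => rw [← (EuclideanSpace.basisFun (Fin (n + 1)) ℝ).sum_repr (spaceGrad F z)]
    refine Finset.sum_congr rfl fun i _ => ?_
    rw [dirDeriv, spaceDir, ← inner_spaceGrad, real_inner_comm,
      ← EuclideanSpace.basisFun_apply, OrthonormalBasis.repr_apply_apply]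
  refine Prod.ext ?_ ?_
  · simp [Prod.fst_sum, spaceDir]
  · simp [Prod.snd_sum, spaceDir, h]

/-- The spatial derivatives of `W` where the first spatial derivatives of the heat equation hold. -/
theorem fderiv_spaceTimeW_of_heat {a : ℝ} {U : Set (ℝ × Space n)} {F : ℝ × Space n → ℝ}
    (hU : IsOpen U) (hF : ContDiffOn ℝ ∞ F U) {z : ℝ × Space n} (hz : z ∈ U) (w : Space n)
    (heat : dirDeriv ((0 : ℝ), w) (dirDeriv timeDir F) z
      + dirDeriv ((0 : ℝ), w) (spaceLaplacian F) z = dirDeriv ((0 : ℝ), w) (spaceGradSq F) z) :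
    -fderiv ℝ (spaceTimeW a F) z (0, w)
      = 2 * (a - z.1) * fderiv ℝ (fderiv ℝ F) z (1, -spaceGrad F z) (0, w)
        - fderiv ℝ F z (0, w) := by
  have h1 : dirDeriv ((0 : ℝ), w) (spaceGradSq F) z
      = 2 * fderiv ℝ (fderiv ℝ F) z (0, spaceGrad F z) (0, w) := by
    rw [dirDeriv_spaceGradSq hU hF hz, spaceGrad_eq_sum, map_sum, sum_apply]
    congr 1
    refine Finset.sum_congr rfl fun i _ => ?_
    rw [dirDeriv_dirDeriv hU hF hz, map_smul, smul_apply, smul_eq_mul,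
      fderiv_fderiv_symm hU hF hz]
  have h2 : dirDeriv ((0 : ℝ), w) (dirDeriv timeDir F) z
      = fderiv ℝ (fderiv ℝ F) z (1, 0) (0, w) := by
    rw [dirDeriv_dirDeriv hU hF hz, fderiv_fderiv_symm hU hF hz]; rfl
  have h3 : ((1 : ℝ), -spaceGrad F z) = (1, 0) - (0, spaceGrad F z) := by simp
  have h4 := dirDeriv_spaceTimeW a hU hF hz ((0 : ℝ), w)
  rw [h3, map_sub, sub_apply, ← h2]
  change -dirDeriv ((0 : ℝ), w) (spaceTimeW a F) z = _ - dirDeriv ((0 : ℝ), w) F z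
  rw [h4]
  linear_combination -(2 * (a - z.1)) * heat - (a - z.1) * h1

/-- `∇W · ν` on the boundary, by differentiation of the heat equation up to the boundary. -/
theorem perelmanW_normal_derivative {T a : ℝ} (ha : T ≤ a) {Ω₀ : Set (Space n)}
    {φ : ℝ → Space n → Space n}
    (hφ : IsSmoothDiffeoFamily T Ω₀ φ) (hΩ₀ : IsBoundedSmoothDomain Ω₀)
    {f β : ℝ → Space n → ℝ} {U : Set (ℝ × Space n)} (hU : IsOpen U)
    (hF : ContDiffOn ℝ ∞ (fun z : ℝ × Space n => f z.1 z.2) U)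
    (hflow : ∀ t ∈ Ioo 0 T, ∀ p ∈ Ω₀, deriv (fun s => φ s p) t = -∇ (f t) (φ t p))
    (hheat : ∀ t ∈ Ioo 0 T, ∀ x ∈ domainAt Ω₀ φ t,
      deriv (fun s => f s x) t + Laplacian.laplacian (f t) x
        = ‖∇ (f t) x‖ ^ 2 + (n + 1) / (2 * (a - t)))
    (hneumann : ∀ t ∈ Ioo 0 T, ∀ x ∈ frontier (domainAt Ω₀ φ t),
      ⟪∇ (f t) x, outerUnitNormal (domainAt Ω₀ φ t) x⟫ = β t x)
    {t : ℝ} (ht : t ∈ Ioo 0 T) {x : Space n} (hx : x ∈ frontier (domainAt Ω₀ φ t))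
    (hxU : (t, x) ∈ U) :
    -⟪∇ (perelmanW (f t) (a - t)) x, outerUnitNormal (domainAt Ω₀ φ t) x⟫
      = 2 * (a - t) * harnackExpr (domainAt Ω₀ φ) β f (a - t) t x := by
  have hτ : 0 < a - t := by linarith [ht.2]
  have hK := hΩ₀.isCompact_closure
  obtain ⟨F, hFf⟩ : ∃ F : ℝ × Space n → ℝ, F = fun z => f z.1 z.2 := ⟨_, rfl⟩
  have hft : f t = fun y => F (t, y) := by rw [hFf]
  set ν := outerUnitNormal (domainAt Ω₀ φ t) x with hν
  rw [← hFf] at hF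
  have hFd : ∀ z ∈ U, DifferentiableAt ℝ F z := fun z hz => differentiableAt_of_contDiffOn hU hF hz
  have hgrad : ∇ (f t) x = spaceGrad F (t, x) := by
    rw [hft, spaceGrad_eq_gradient (hFd _ hxU)]
  have hW := contDiffOn_spaceTimeW a hU hF
  have hslice : ∀ᶠ y in nhds x, (t, y) ∈ U := by
    have hc : ContinuousAt (fun y : Space n => (t, y)) x := by fun_prop
    exact hc.eventually (hU.mem_nhds hxU)
  have hWs : perelmanW (f t) (a - t) =ᶠ[nhds x] fun y => spaceTimeW a F (t, y) := by
    filter_upwards [hslice] with y hy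
    rw [hft]
    exact perelmanW_slice (z := (t, y)) a hU hF hy
  have hlhs : ⟪∇ (perelmanW (f t) (a - t)) x, ν⟫ = fderiv ℝ (spaceTimeW a F) (t, x) (0, ν) := by
    rw [inner_gradient_left, hWs.fderiv_eq, fderiv_space_slice (z := (t, x))
      (differentiableAt_of_contDiffOn hU hW hxU)]
  have hs1 := contDiffOn_dirDeriv hU hF (timeDir : ℝ × Space n)
  have hs2 := contDiffOn_spaceLaplacian hU hF
  have hs3 := contDiffOn_spaceGradSq hU hF
  set Q : ℝ × Space n → ℝ := fun z =>
    dirDeriv timeDir F z + spaceLaplacian F z - spaceGradSq F z with hQ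
  have hQs : ContDiffOn ℝ ∞ Q U := (hs1.add hs2).sub hs3
  -- The heat equation says that `Q` depends on time only, in the interior.
  have hDQ : dirDeriv ((0 : ℝ), ν) Q (t, x) = 0 := by
    refine eq_of_mem_closure_slice (frontier_subset_closure hx)
      ((contDiffOn_dirDeriv hU hQs _).continuousOn.continuousAt (hU.mem_nhds hxU)) ?_
    filter_upwards [hslice] with y hy hyD
    have h0 : (fun y => Q (t, y)) =ᶠ[nhds y] fun _ => (n + 1) / (2 * (a - t)) := by
      have hc : ContinuousAt (fun y : Space n => (t, y)) y := by fun_prop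
      filter_upwards [hc.eventually (hU.mem_nhds hy),
        (isOpen_domainAt hφ hΩ₀.isOpen hK ht).mem_nhds hyD] with q hq hqD
      have h1 := hheat t ht q hqD
      have h2 : Laplacian.laplacian (f t) q = spaceLaplacian F (t, q) := by
        rw [hft]; exact laplacian_slice (z := (t, q)) hU hF hq
      have h3 : ‖∇ (f t) q‖ ^ 2 = spaceGradSq F (t, q) := by
        rw [hft]; exact norm_gradient_slice_sq (z := (t, q)) hU hF hq
      have h4 : deriv (fun s => f s q) t = dirDeriv timeDir F (t, q) := by
        rw [hFf]; rw [hFf] at hFd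
        exact (hasDerivAt_time_slice (z := (t, q)) (hFd _ hq)).deriv
      rw [h2, h3, h4] at h1
      simp only [hQ]
      linarith
    rw [dirDeriv, ← fderiv_space_slice (z := (t, y)) (differentiableAt_of_contDiffOn hU hQs hy),
      h0.fderiv_eq]
    simp
  have hd1 := differentiableAt_of_contDiffOn hU hs1 hxU
  have hd2 := differentiableAt_of_contDiffOn hU hs2 hxU
  have hd3 := differentiableAt_of_contDiffOn hU hs3 hxU
  rw [hQ, dirDeriv_sub (hd1.fun_add hd2) hd3, dirDeriv_add hd1 hd2, sub_eq_zero] at hDQ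
  have hH := harnackExpr_eq hφ hΩ₀ hU (hFf ▸ hF) hflow hneumann ht hx hxU (a - t)
  rw [← hFf] at hH
  rw [hlhs, fderiv_spaceTimeW_of_heat hU hF hxU ν hDQ, hH, hgrad, ← hneumann t ht x hx, hgrad,
    inner_spaceGrad, ← hν]
  field_simp

/-! ### Transport of integrals over a moving domain -/

theorem contDiff_det {m : ℕ} : ContDiff ℝ ∞ (fun M : Fin m → Fin m → ℝ => (Matrix.of M).det) := by
  simp only [Matrix.det_apply']
  refine ContDiff.sum fun σ _ => contDiff_const.mul ?_
  refine contDiff_prod fun i _ => ?_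
  exact contDiff_apply_apply ℝ ℝ (σ i) i

/-- The derivative of the determinant at the identity is the trace. -/
theorem hasDerivAt_det_of_eq_one {m : ℕ} {M : ℝ → Fin m → Fin m → ℝ} {M' : Fin m → Fin m → ℝ}
    {t : ℝ} (hM : HasDerivAt M M' t) (h1 : Matrix.of (M t) = 1) :
    HasDerivAt (fun s => (Matrix.of (M s)).det) (∑ i, M' i i) t := by
  have hd := ((contDiff_det (m := m)).differentiable (by simp) (M t)).hasFDerivAt
  have h2 := hd.comp_hasDerivAt t hM
  have hl : HasDerivAt (fun r : ℝ => M t + r • M') M' 0 := by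
    simpa using ((hasDerivAt_id (0 : ℝ)).smul_const M').const_add (M t)
  have h3 := HasFDerivAt.comp_hasDerivAt (0 : ℝ) (by simpa using hd) hl
  have h4 : HasDerivAt (fun r : ℝ => (Matrix.of (M t + r • M')).det) (∑ i, M' i i) 0 := by
    have h5 : (fun r : ℝ => (Matrix.of (M t + r • M')).det) = fun r =>
        1 + (Matrix.of M').trace * r + Polynomial.eval r
          (Matrix.det (1 + (Polynomial.X : Polynomial ℝ) •
            (Matrix.of M').map Polynomial.C)).divX.divX * r ^ 2 := by
      funext r
      rw [← Matrix.det_one_add_smul, ← h1]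
      rfl
    rw [h5]
    have h6 := (((hasDerivAt_id (0 : ℝ)).const_mul (Matrix.of M').trace).const_add 1).fun_add
      (((Polynomial.hasDerivAt (Matrix.det (1 + (Polynomial.X : Polynomial ℝ) •
            (Matrix.of M').map Polynomial.C)).divX.divX (0 : ℝ))).fun_mul
        ((hasDerivAt_id (0 : ℝ)).fun_pow 2))
    simpa [Matrix.trace] using h6
  rw [h4.unique h3]
  exact h2

/-- Jacobi's formula along a curve of invertible linear maps. -/
theorem hasDerivAt_clm_det {A : ℝ → Space n →L[ℝ] Space n} {B : Space n →L[ℝ] Space n} {t : ℝ}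
    (hA : HasDerivAt A (B.comp (A t)) t) (hinj : Function.Injective (A t)) :
    HasDerivAt (fun s => (A s).det) ((∑ i, B (EuclideanSpace.single i 1) i) * (A t).det) t := by
  -- Composition with the inverse of `A t` reduces to a curve through the identity.
  let e : Space n ≃ₗ[ℝ] Space n := LinearEquiv.ofInjectiveEndo (A t : Space n →ₗ[ℝ] Space n) hinj
  have he : ∀ v, A t (e.symm v) = v := fun v => e.apply_symm_apply v
  let S : Space n →L[ℝ] Space n := LinearMap.toContinuousLinearMap (e.symm : Space n →ₗ[ℝ] Space n)
  let b := (EuclideanSpace.basisFun (Fin (n + 1)) ℝ).toBasis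
  have hAS : ∀ s, ((A s).comp S).comp (A t) = A s := by
    intro s
    ext1 v
    exact congrArg (A s) (e.symm_apply_apply v)
  have hdet : ∀ s, (A s).det = (Matrix.of fun i j => (A s (S (EuclideanSpace.single j 1))) i).det
      * (A t).det := by
    intro s
    conv_lhs => rw [← hAS s]
    rw [ContinuousLinearMap.det, ContinuousLinearMap.toLinearMap_comp, LinearMap.det_comp,
      ← LinearMap.det_toMatrix b]
    congr 2
  have hM : HasDerivAt (fun s => fun i j => (A s (S (EuclideanSpace.single j 1))) i)
      (fun i j => (B (EuclideanSpace.single j 1)) i) t := by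
    refine hasDerivAt_pi.2 fun i => hasDerivAt_pi.2 fun j => ?_
    have h1 := hA.clm_apply (hasDerivAt_const t (S (EuclideanSpace.single j 1)))
    have h2 := (EuclideanSpace.proj (𝕜 := ℝ) i).hasFDerivAt.comp_hasDerivAt t h1
    simp only [map_zero, add_zero] at h2
    rw [ContinuousLinearMap.comp_apply] at h2
    have h3 : A t (S (EuclideanSpace.single j 1)) = EuclideanSpace.single j 1 := he _
    rw [h3] at h2
    exact h2
  have h1 := hasDerivAt_det_of_eq_one hM (by
    ext i j
    have h3 : A t (S (EuclideanSpace.single j 1)) = EuclideanSpace.single j 1 := he _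
    simp only [Matrix.of_apply, h3]
    simp [Matrix.one_apply])
  have h2 := h1.mul_const (A t).det
  refine h2.congr_of_eventuallyEq (.of_forall fun s => hdet s)

/-- The derivative `Dφ_s(p)` of a smooth family moving with velocity `-∇F` satisfies
`(Dφ_s)' = -∇²F ∘ Dφ_s`. -/
theorem hasDerivAt_fderiv_flow {φ : ℝ → Space n → Space n} {V U : Set (ℝ × Space n)}
    (hV : IsOpen V) (hs : ContDiffOn ℝ ∞ (fun z : ℝ × Space n => φ z.1 z.2) V) (hU : IsOpen U)
    {F : ℝ × Space n → ℝ} (hF : ContDiffOn ℝ ∞ F U) {t : ℝ} {p : Space n} (hp : (t, p) ∈ V)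
    (hpU : (t, φ t p) ∈ U)
    (hflow : ∀ᶠ q in nhds p, deriv (fun s => φ s q) t = -spaceGrad F (t, φ t q)) :
    HasDerivAt (fun s => fderiv ℝ (φ s) p)
      ((-(fderiv ℝ (spaceGrad F) (t, φ t p)).comp (ContinuousLinearMap.inr ℝ ℝ (Space n))).comp
        (fderiv ℝ (φ t) p)) t := by
  set Φ : ℝ × Space n → Space n := fun z => φ z.1 z.2 with hΦ
  set ι := ContinuousLinearMap.inr ℝ ℝ (Space n) with hι
  have hΦd : ∀ z ∈ V, DifferentiableAt ℝ Φ z := fun z hz => differentiableAt_of_contDiffOn hV hs hz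
  have hD : ContDiffOn ℝ ∞ (fderiv ℝ Φ) V := hs.fderiv_of_isOpen hV (by simp)
  have hDd : DifferentiableAt ℝ (fderiv ℝ Φ) (t, p) := differentiableAt_of_contDiffOn hV hD hp
  have hsl : ∀ z ∈ V, fderiv ℝ (φ z.1) z.2 = (fderiv ℝ Φ z).comp ι := fun z hz =>
    (hasFDerivAt_space_slice (hΦd z hz)).fderiv
  have h1 : HasDerivAt (fun s => fderiv ℝ Φ (s, p)) (fderiv ℝ (fderiv ℝ Φ) (t, p) (1, 0)) t :=
    hasDerivAt_time_slice (z := (t, p)) hDd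
  have h2 := h1.clm_comp (hasDerivAt_const t ι)
  have h3 : (fun s => fderiv ℝ (φ s) p) =ᶠ[nhds t] fun s => (fderiv ℝ Φ (s, p)).comp ι := by
    have hc : ContinuousAt (fun s : ℝ => (s, p)) t := by fun_prop
    filter_upwards [hc.eventually (hV.mem_nhds hp)] with s hs using hsl _ hs
  refine (h2.congr_of_eventuallyEq h3).congr_deriv ?_
  have hgd : DifferentiableAt ℝ (spaceGrad F) (t, φ t p) :=
    differentiableAt_of_contDiffOn hU (contDiffOn_spaceGrad hU hF) hpU
  have hcp : ContinuousAt (fun q : Space n => (t, q)) p := by fun_prop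
  -- Mixed derivatives commute, and the time derivative of the family is known in space.
  have h4 : HasFDerivAt (fun q => fderiv ℝ Φ (t, q) (1, 0))
      (((fderiv ℝ (fderiv ℝ Φ) (t, p)).comp ι).flip (1, 0)) p := by
    have := (hasFDerivAt_space_slice (z := (t, p)) hDd).clm_apply
      (hasFDerivAt_const ((1 : ℝ), (0 : Space n)) p)
    simpa using this
  have h5 : HasFDerivAt (fun q => -spaceGrad F (t, φ t q))
      (-((fderiv ℝ (spaceGrad F) (t, φ t p)).comp ι).comp (fderiv ℝ (φ t) p)) p := by
    have k1 := hasFDerivAt_space_slice (z := (t, φ t p)) hgd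
    have k2 := (hasFDerivAt_space_slice (hΦd (t, p) hp)).differentiableAt.hasFDerivAt
    exact (HasFDerivAt.comp (g := fun y => spaceGrad F (t, y)) (f := φ t) p k1 k2).neg
  have h6 : (fun q => -spaceGrad F (t, φ t q)) =ᶠ[nhds p] fun q => fderiv ℝ Φ (t, q) (1, 0) := by
    filter_upwards [hflow, hcp.eventually (hV.mem_nhds hp)] with q hq hqV
    rw [← hq]
    exact (hasDerivAt_time_slice (hΦd (t, q) hqV)).deriv
  have h7 := (h4.congr_of_eventuallyEq h6).unique h5
  have h8 : IsSymmSndFDerivAt ℝ Φ (t, p) := (hs.contDiffAt (hV.mem_nhds hp)).isSymmSndFDerivAt (by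
    rw [minSmoothness_of_isRCLikeNormedField]
    exact ENat.LEInfty.out)
  ext1 v
  have h9 := congrArg (fun L => L v) h7
  simp only [ContinuousLinearMap.flip_apply, ContinuousLinearMap.comp_apply, neg_apply] at h9
  simp only [add_apply, ContinuousLinearMap.comp_apply, neg_apply]
  rw [← h9, h8.eq]
  simp

/-- The transport theorem for a domain moving with velocity `-∇F`. -/
theorem hasDerivAt_integral_domainAt {T : ℝ} {Ω₀ : Set (Space n)} {φ : ℝ → Space n → Space n}
    (hφ : IsSmoothDiffeoFamily T Ω₀ φ) (hΩ₀ : IsBoundedSmoothDomain Ω₀)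
    {U : Set (ℝ × Space n)} (hU : IsOpen U)
    (hΩU : ∀ s ∈ Ioo 0 T, ∀ y ∈ closure (domainAt Ω₀ φ s), (s, y) ∈ U)
    {F G : ℝ × Space n → ℝ} (hF : ContDiffOn ℝ ∞ F U) (hG : ContDiffOn ℝ ∞ G U)
    (hflow : ∀ t ∈ Ioo 0 T, ∀ p ∈ Ω₀, deriv (fun s => φ s p) t = -spaceGrad F (t, φ t p))
    {t : ℝ} (ht : t ∈ Ioo 0 T) :
    HasDerivAt (fun s => ∫ x in domainAt Ω₀ φ s, G (s, x))
      (∫ x in domainAt Ω₀ φ t, (fderiv ℝ G (t, x) (1, -spaceGrad F (t, x))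
        - G (t, x) * spaceLaplacian F (t, x))) t := by
  have hK := hΩ₀.isCompact_closure
  have ho := hΩ₀.isOpen
  obtain ⟨V, hV, hsub, hs⟩ := hφ.smooth
  set Φ : ℝ × Space n → Space n := fun z => φ z.1 z.2 with hΦ
  set C : Set (ℝ × Space n) := Ioo 0 T ×ˢ closure Ω₀ with hC
  have hΦd : ∀ z ∈ V, DifferentiableAt ℝ Φ z := fun z hz => differentiableAt_of_contDiffOn hV hs hz
  have hCU : ∀ z ∈ C, (z.1, Φ z) ∈ U := fun z hz => hΩU z.1 hz.1 _ (by
    rw [closure_domainAt hφ hK hz.1]; exact mem_image_of_mem _ hz.2)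
  have hsl : ∀ z ∈ V, fderiv ℝ (φ z.1) z.2
      = (fderiv ℝ Φ z).comp (ContinuousLinearMap.inr ℝ ℝ (Space n)) := fun z hz =>
    (hasFDerivAt_space_slice (hΦd z hz)).fderiv
  set H : ℝ × Space n → ℝ := fun z =>
    fderiv ℝ G z (1, -spaceGrad F z) - G z * spaceLaplacian F z with hH
  have hHc : ContinuousOn H U :=
    (((hG.fderiv_of_isOpen (m := ∞) hU (by simp)).continuousOn).clm_apply
      (continuousOn_const.prodMk (contDiffOn_spaceGrad hU hF).continuousOn.neg)).sub
      (hG.continuousOn.mul (contDiffOn_spaceLaplacian hU hF).continuousOn)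
  -- The integral is pulled back to the fixed domain `Ω₀`, with Jacobian `|J|`.
  set J : ℝ × Space n → ℝ := fun z => (fderiv ℝ (φ z.1) z.2).det with hJ
  have hJc : ContinuousOn J C := by
    have h1 : ContinuousOn (fun z => ((fderiv ℝ Φ z).comp
        (ContinuousLinearMap.inr ℝ ℝ (Space n))).det) C :=
      ContinuousLinearMap.continuous_det.comp_continuousOn
        ((((hs.fderiv_of_isOpen (m := ∞) hV (by simp)).continuousOn).mono hsub).clm_comp
          continuousOn_const)
    refine h1.congr fun z hz => ?_
    simp only [hJ]
    rw [hsl z (hsub hz)]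
  have hΦc : ContinuousOn (fun z : ℝ × Space n => (z.1, Φ z)) C :=
    continuousOn_fst.prodMk (hs.continuousOn.mono hsub)
  have hKc : ContinuousOn (fun z => |J z| * G (z.1, Φ z)) C :=
    hJc.abs.mul (hG.continuousOn.comp hΦc hCU)
  have hKc' : ContinuousOn (fun z => |J z| * H (z.1, Φ z)) C :=
    hJc.abs.mul (hHc.comp hΦc hCU)
  have hslice : ∀ s ∈ Ioo 0 T, ∀ k : ℝ × Space n → ℝ, ContinuousOn k C →
      IntegrableOn (fun p => k (s, p)) Ω₀ := by
    intro s hs k hk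
    have h1 : ContinuousOn (fun p => k (s, p)) (closure Ω₀) :=
      hk.comp (by fun_prop) fun p hp => ⟨hs, hp⟩
    exact (h1.integrableOn_compact hK).mono_set subset_closure
  have hcov : ∀ s ∈ Ioo 0 T, ∀ k : ℝ × Space n → ℝ,
      ∫ x in domainAt Ω₀ φ s, k (s, x) = ∫ p in Ω₀, |J (s, p)| * k (s, Φ (s, p)) := by
    intro s hsT k
    rw [domainAt]
    exact integral_image_eq_integral_abs_det_fderiv_smul volume ho.measurableSet
      (fun p hp => ((hasFDerivAt_space_slice (hΦd (s, p) (hsub ⟨hsT, subset_closure hp⟩))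
        ).differentiableAt.hasFDerivAt).hasFDerivWithinAt)
      ((hφ.injOn hsT).mono subset_closure) fun x => k (s, x)
  have hKd : ∀ s ∈ Ioo 0 T, ∀ p ∈ Ω₀, HasDerivAt (fun s => |J (s, p)| * G (s, Φ (s, p)))
      (|J (s, p)| * H (s, Φ (s, p))) s := by
    intro s hsT p hp
    have hpc := subset_closure hp
    have hpV : (s, p) ∈ V := hsub ⟨hsT, hpc⟩
    have hpU : (s, φ s p) ∈ U := hCU (s, p) ⟨hsT, hpc⟩
    have hinj := hφ.injective_fderiv ho hsT hpc
    have hfl : ∀ᶠ q in nhds p, deriv (fun s => φ s q) s = -spaceGrad F (s, φ s q) := by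
      filter_upwards [ho.mem_nhds hp] with q hq using hflow s hsT q hq
    have d1 := hasDerivAt_clm_det (hasDerivAt_fderiv_flow hV hs hU hF hpV hpU hfl) hinj
    have htr : ∑ i, (-(fderiv ℝ (spaceGrad F) (s, φ s p)).comp
        (ContinuousLinearMap.inr ℝ ℝ (Space n))) (EuclideanSpace.single i 1) i
        = -spaceLaplacian F (s, φ s p) := by
      rw [spaceLaplacian, ← Finset.sum_neg_distrib]
      refine Finset.sum_congr rfl fun i _ => ?_
      rw [dirDeriv_dirDeriv hU hF hpU]
      have k1 := inner_fderiv_spaceGrad hU hF hpU (spaceDir i) (EuclideanSpace.single i 1)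
      rw [EuclideanSpace.inner_single_right] at k1
      simp only [conj_trivial, one_mul] at k1
      change -(fderiv ℝ (spaceGrad F) (s, φ s p) (spaceDir i) i) = _
      rw [k1]; rfl
    rw [htr] at d1
    have hJ0 : J (s, p) ≠ 0 := by
      intro h0
      have h1 : LinearMap.det (fderiv ℝ (φ s) p : Space n →ₗ[ℝ] Space n) = 0 := h0
      have h2 := LinearMap.bot_lt_ker_of_det_eq_zero h1
      rw [LinearMap.ker_eq_bot.2 hinj] at h2
      exact lt_irrefl _ h2
    have d2 : HasDerivAt (fun s => |J (s, p)|) (-spaceLaplacian F (s, φ s p) * |J (s, p)|) s := by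
      refine ((hasDerivAt_abs hJ0).comp s d1).congr_deriv ?_
      change _ * (_ * J (s, p)) = _
      rw [mul_left_comm, sign_mul_self]
    have d3 : HasDerivAt (fun s => (s, Φ (s, p))) (1, -spaceGrad F (s, φ s p)) s := by
      have k1 := hasDerivAt_time_slice (z := (s, p)) (hΦd (s, p) hpV)
      have k2 := hflow s hsT p hp
      rw [k1.deriv] at k2
      refine (hasDerivAt_id s).prodMk ?_
      rw [← k2]
      exact k1
    have d4 := (differentiableAt_of_contDiffOn hU hG hpU).hasFDerivAt.comp_hasDerivAt s d3
    refine (d2.fun_mul d4).congr_deriv ?_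
    simp only [hH, hΦ, Function.comp]
    ring
  obtain ⟨ε, hε, hball⟩ := Metric.nhds_basis_closedBall.mem_iff.1 (isOpen_Ioo.mem_nhds ht)
  have hball' : Metric.closedBall t ε ×ˢ closure Ω₀ ⊆ C := prod_mono hball subset_rfl
  obtain ⟨b, hb⟩ := ((isCompact_closedBall t ε).prod hK).exists_bound_of_continuousOn
    (hKc'.mono hball')
  have hfin : IsFiniteMeasure (volume.restrict Ω₀) :=
    isFiniteMeasure_restrict.2 (hΩ₀.isBounded.measure_lt_top).ne
  have hmain := hasDerivAt_integral_of_dominated_loc_of_deriv_le (μ := volume.restrict Ω₀)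
    (F := fun s p => |J (s, p)| * G (s, Φ (s, p))) (F' := fun s p => |J (s, p)| * H (s, Φ (s, p)))
    (bound := fun _ => b) (Metric.closedBall_mem_nhds t hε)
    (by filter_upwards [isOpen_Ioo.mem_nhds ht] with s hs
        exact (hslice s hs _ hKc).aestronglyMeasurable)
    (hslice t ht _ hKc) (hslice t ht _ hKc').aestronglyMeasurable
    (by filter_upwards [ae_restrict_mem ho.measurableSet] with p hp s hs
        exact hb (s, p) ⟨hs, subset_closure hp⟩)
    (integrable_const b)
    (by filter_upwards [ae_restrict_mem ho.measurableSet] with p hp s hs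
        exact hKd s (hball hs) p hp)
  refine (hmain.2.congr_of_eventuallyEq ?_).congr_deriv (hcov t ht H).symm
  filter_upwards [isOpen_Ioo.mem_nhds ht] with s hs using hcov s hs G

/-! ### The weighted divergence theorem and the density -/

section

variable {U : Set (ℝ × Space n)} {F A B : ℝ × Space n → ℝ}

theorem fderiv_apply_spaceGrad (A B : ℝ × Space n → ℝ) (z : ℝ × Space n) :
    fderiv ℝ A z (0, spaceGrad B z) = spaceGradInner A B z := by
  rw [spaceGrad_eq_sum, map_sum]
  refine Finset.sum_congr rfl fun i _ => ?_
  rw [map_smul, smul_eq_mul, mul_comm]; rfl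

theorem spaceGrad_coord (B : ℝ × Space n → ℝ) (z : ℝ × Space n) (i : Fin (n + 1)) :
    spaceGrad B z i = dirDeriv (spaceDir i) B z := by
  rw [dirDeriv, spaceDir, ← inner_spaceGrad, EuclideanSpace.inner_single_right]; simp

theorem contDiffOn_spaceGradInner (hU : IsOpen U) (hA : ContDiffOn ℝ ∞ A U)
    (hB : ContDiffOn ℝ ∞ B U) : ContDiffOn ℝ ∞ (spaceGradInner A B) U :=
  ContDiffOn.sum fun _ _ => (contDiffOn_dirDeriv hU hA _).mul (contDiffOn_dirDeriv hU hB _)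

/-- Green's first identity in a time slice, by Gauss' formula for the functions `A ∂_i B`. -/
theorem integral_spaceLaplacian_add_spaceGradInner {D : Set (Space n)}
    (hD : IsBoundedSmoothDomain D) (hU : IsOpen U) {t : ℝ} (hDU : ∀ y ∈ closure D, (t, y) ∈ U)
    (hA : ContDiffOn ℝ ∞ A U) (hB : ContDiffOn ℝ ∞ B U) :
    ∫ x in D, (A (t, x) * spaceLaplacian B (t, x) + spaceGradInner A B (t, x))
      = ∫ x in frontier D, A (t, x) * ⟪spaceGrad B (t, x), outerUnitNormal D x⟫ ∂μHE[n] := by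
  have hcts : ∀ k : ℝ × Space n → ℝ, ContDiffOn ℝ ∞ k U →
      ContinuousOn (fun y => k (t, y)) (closure D) := fun k hk =>
    hk.continuousOn.comp (by fun_prop) hDU
  have hfc : frontier D ⊆ closure D := frontier_subset_closure
  have hBi := fun i => contDiffOn_dirDeriv hU hB (spaceDir i)
  have hUt : IsOpen ((fun y : Space n => (t, y)) ⁻¹' U) := hU.preimage (by fun_prop)
  have hstep : ∀ i : Fin (n + 1),
      ∫ x in D, dirDeriv (spaceDir i) (fun z => A z * dirDeriv (spaceDir i) B z) (t, x)
        = ∫ x in frontier D, A (t, x) * dirDeriv (spaceDir i) B (t, x) * outerUnitNormal D x i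
          ∂μHE[n] := by
    intro i
    have hg : ContDiffOn ℝ ∞ (fun z => A z * dirDeriv (spaceDir i) B z) U := hA.mul (hBi i)
    have h1 := integral_fderiv_eq_integral_frontier hD hUt (fun y hy => hDU y hy)
      (((hg.of_le (by simp)).comp (f := fun y : Space n => (t, y))
        (s := (fun y : Space n => (t, y)) ⁻¹' U)
        (by fun_prop) fun y hy => hy) : ContDiffOn ℝ 1 _ _) (EuclideanSpace.single i 1)
    simp only [EuclideanSpace.inner_single_left, map_one, one_mul] at h1
    refine Eq.trans (setIntegral_congr_fun hD.isOpen.measurableSet fun x hx => ?_) h1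
    exact (fderiv_space_slice (z := (t, x))
      (differentiableAt_of_contDiffOn hU hg (hDU x (subset_closure hx))) _).symm
  have hint1 : ∀ i : Fin (n + 1), IntegrableOn (fun x =>
      dirDeriv (spaceDir i) (fun z => A z * dirDeriv (spaceDir i) B z) (t, x)) D := fun i =>
    integrableOn_domain hD (hcts _ (contDiffOn_dirDeriv hU (hA.mul (hBi i)) _))
  have hint2 : ∀ i : Fin (n + 1), IntegrableOn (fun x =>
      A (t, x) * dirDeriv (spaceDir i) B (t, x) * outerUnitNormal D x i) (frontier D) μHE[n] :=
    fun i => integrableOn_frontier hD ((((hcts _ hA).mono hfc).mul ((hcts _ (hBi i)).mono hfc)).mul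
      ((EuclideanSpace.proj (𝕜 := ℝ) i).continuous.comp_continuousOn
        (continuousOn_outerUnitNormal hD)))
  have hl : ∫ x in D, (A (t, x) * spaceLaplacian B (t, x) + spaceGradInner A B (t, x))
      = ∫ x in D, ∑ i : Fin (n + 1),
        dirDeriv (spaceDir i) (fun z => A z * dirDeriv (spaceDir i) B z) (t, x) := by
    refine setIntegral_congr_fun hD.isOpen.measurableSet fun x hx => ?_
    have hx' := hDU x (subset_closure hx)
    simp only [spaceLaplacian, spaceGradInner]
    rw [Finset.mul_sum, ← Finset.sum_add_distrib]
    refine Finset.sum_congr rfl fun i _ => ?_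
    rw [dirDeriv_mul (differentiableAt_of_contDiffOn hU hA hx')
      (differentiableAt_of_contDiffOn hU (hBi i) hx')]
    ring
  rw [hl, integral_finsetSum _ fun i _ => hint1 i]
  simp_rw [hstep]
  rw [← integral_finsetSum _ fun i _ => hint2 i]
  refine integral_congr_ae (.of_forall fun x => ?_)
  simp only
  rw [PiLp.inner_apply, Finset.mul_sum]
  refine Finset.sum_congr rfl fun i _ => ?_
  rw [spaceGrad_coord, real_inner_comm, RCLike.inner_apply, conj_trivial, mul_assoc,
    mul_comm (dirDeriv _ _ _)]

/-- The density `u` satisfies `D_v u = (-D_v F + v_t (n + 1) / (2τ)) u`. -/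
theorem dirDeriv_spaceTimeDensity {a : ℝ} {z : ℝ × Space n} (hF : DifferentiableAt ℝ F z)
    (hz : z.1 < a) (v : ℝ × Space n) : dirDeriv v (spaceTimeDensity a F) z
      = (-dirDeriv v F z + v.1 * ((n + 1) / (2 * (a - z.1)))) * spaceTimeDensity a F z := by
  have hτ : 0 < a - z.1 := by linarith
  have hpos : 0 < 4 * Real.pi * (a - z.1) := by positivity
  have h1 : HasFDerivAt (fun z : ℝ × Space n => 4 * Real.pi * (a - z.1))
      ((4 * Real.pi) • -(ContinuousLinearMap.fst ℝ ℝ (Space n))) z :=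
    ((hasFDerivAt_fst).const_sub a).const_mul _
  have h2 := h1.rpow_const (p := -(((n : ℝ) + 1) / 2)) (.inl hpos.ne')
  have h3 := hF.hasFDerivAt.fun_neg.exp.fun_mul h2
  have h4 : spaceTimeDensity a F =ᶠ[nhds z] fun z => Real.exp (-F z)
      * (4 * Real.pi * (a - z.1)) ^ (-(((n : ℝ) + 1) / 2)) := by
    have hc : ContinuousAt (fun z : ℝ × Space n => z.1) z := continuousAt_fst
    filter_upwards [hc.eventually (gt_mem_nhds hz)] with y hy
    have : 0 < a - y.1 := by linarith
    rw [spaceTimeDensity, Real.rpow_neg (by positivity), div_eq_mul_inv]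
  rw [dirDeriv, h4.fderiv_eq, h3.fderiv, h4.self_of_nhds, Real.rpow_sub_one hpos.ne']
  simp only [add_apply, smul_apply, neg_apply, smul_eq_mul, ContinuousLinearMap.coe_fst', dirDeriv]
  field_simp
  ring

theorem contDiffOn_spaceTimeDensity {a : ℝ} (hF : ContDiffOn ℝ ∞ F U) (ha : ∀ z ∈ U, z.1 < a) :
    ContDiffOn ℝ ∞ (spaceTimeDensity a F) U := by
  have hpos : ∀ z ∈ U, 0 < 4 * Real.pi * (a - z.1) := fun z hz => by
    have := ha z hz
    have : 0 < a - z.1 := by linarith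
    positivity
  exact hF.neg.exp.div (ContDiffOn.rpow_const_of_ne
    (contDiffOn_const.mul (contDiffOn_const.sub contDiffOn_fst)) fun z hz => (hpos z hz).ne')
    fun z hz => (Real.rpow_pos_of_pos (hpos z hz) _).ne'

theorem spaceTimeDensity_pos {a : ℝ} {z : ℝ × Space n} (hz : z.1 < a) :
    0 < spaceTimeDensity a F z := by
  have : 0 < a - z.1 := by linarith
  rw [spaceTimeDensity]; positivity

/-- The divergence theorem turns the boundary term `2τ ∫ β u` of the entropy into an integral over
the domain. -/
theorem entropy_slice_eq {D : Set (Space n)} (hD : IsBoundedSmoothDomain D) (hU : IsOpen U)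
    {a t : ℝ} (hDU : ∀ y ∈ closure D, (t, y) ∈ U) (hF : ContDiffOn ℝ ∞ F U)
    (ha : ∀ z ∈ U, z.1 < a) {β : Space n → ℝ}
    (hβ : ∀ x ∈ frontier D, ⟪∇ (fun y => F (t, y)) x, outerUnitNormal D x⟫ = β x) :
    IntegrableOn (entropyIntegrand (fun y => F (t, y)) (a - t)) D ∧
      entropy β D (fun y => F (t, y)) (a - t)
        = ∫ x in D, spaceTimeW a F (t, x) * spaceTimeDensity a F (t, x) := by
  have hu := contDiffOn_spaceTimeDensity hF ha
  have hL := contDiffOn_spaceLaplacian hU hF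
  have hS := contDiffOn_spaceGradSq hU hF
  have hm := hD.isOpen.measurableSet
  have hcts : ∀ k : ℝ × Space n → ℝ, ContDiffOn ℝ ∞ k U →
      ContinuousOn (fun y => k (t, y)) (closure D) := fun k hk =>
    hk.continuousOn.comp (by fun_prop) hDU
  set E : ℝ × Space n → ℝ := fun z =>
    ((a - t) * spaceGradSq F z + F z - (n + 1)) * spaceTimeDensity a F z with hE
  have hEs : ContDiffOn ℝ ∞ E U :=
    (((contDiffOn_const.mul hS).add hF).sub contDiffOn_const).mul hu
  have hE1 : EqOn (fun y => E (t, y)) (entropyIntegrand (fun y => F (t, y)) (a - t)) D := by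
    intro y hy
    rw [entropyIntegrand, norm_gradient_slice_sq (z := (t, y)) hU hF (hDU y (subset_closure hy))]
    rfl
  have hEint : IntegrableOn (fun y => E (t, y)) D := integrableOn_domain hD (hcts E hEs)
  refine ⟨hEint.congr_fun hE1 hm, ?_⟩
  have hfront : ∫ x in frontier D, β x * density (fun y => F (t, y)) (a - t) x ∂μHE[n]
      = ∫ x in frontier D, spaceTimeDensity a F (t, x)
        * ⟪spaceGrad F (t, x), outerUnitNormal D x⟫ ∂μHE[n] := by
    refine setIntegral_congr_fun isClosed_frontier.measurableSet fun x hx => ?_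
    have hxU := hDU x (frontier_subset_closure hx)
    rw [← hβ x hx, spaceGrad_eq_gradient (differentiableAt_of_contDiffOn hU hF hxU), mul_comm]
    rfl
  have hgreen : IntegrableOn (fun x => spaceTimeDensity a F (t, x) * spaceLaplacian F (t, x)
      + spaceGradInner (spaceTimeDensity a F) F (t, x)) D :=
    integrableOn_domain hD (hcts _ ((hu.mul hL).add (contDiffOn_spaceGradInner hU hu hF)))
  rw [entropy, hfront, ← integral_spaceLaplacian_add_spaceGradInner hD hU hDU hu hF,
    ← integral_const_mul, ← setIntegral_congr_fun hm hE1, ← integral_add hEint (hgreen.const_mul _)]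
  refine setIntegral_congr_fun hm fun x hx => ?_
  have hxU := hDU x (subset_closure hx)
  have h1 : spaceGradInner (spaceTimeDensity a F) F (t, x)
      = -(spaceTimeDensity a F (t, x) * spaceGradSq F (t, x)) := by
    rw [spaceGradInner, spaceGradSq, Finset.mul_sum, ← Finset.sum_neg_distrib]
    refine Finset.sum_congr rfl fun i _ => ?_
    rw [dirDeriv_spaceTimeDensity (differentiableAt_of_contDiffOn hU hF hxU) (ha _ hxU)]
    simp only [spaceDir]
    ring
  simp only [hE, h1, spaceTimeW]
  ring

/-- Where the heat equation holds, the integrand of the derivative of `∫ W u` is, up to the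
divergence of `u ∇W`, the non-negative term `2τ |∇²F - I / (2τ)|² u`. -/
theorem transport_spaceTimeW_mul_density {a : ℝ} (hU : IsOpen U) (hF : ContDiffOn ℝ ∞ F U)
    (ha : ∀ z ∈ U, z.1 < a)
    (heat : ∀ z ∈ U, dirDeriv timeDir F z + spaceLaplacian F z
      = spaceGradSq F z + (n + 1) / (2 * (a - z.1))) {z : ℝ × Space n} (hz : z ∈ U) :
    fderiv ℝ (fun z => spaceTimeW a F z * spaceTimeDensity a F z) z (1, -spaceGrad F z)
        - spaceTimeW a F z * spaceTimeDensity a F z * spaceLaplacian F z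
      = 2 * (a - z.1) * solitonSq (a - z.1) F z * spaceTimeDensity a F z
        - (spaceTimeDensity a F z * spaceLaplacian (spaceTimeW a F) z
          + spaceGradInner (spaceTimeDensity a F) (spaceTimeW a F) z) := by
  have hd := differentiableAt_of_contDiffOn hU hF hz
  have hW := differentiableAt_of_contDiffOn hU (contDiffOn_spaceTimeW a hU hF) hz
  have hu := differentiableAt_of_contDiffOn hU (contDiffOn_spaceTimeDensity hF ha) hz
  have hev := spaceTimeW_evolution hU hF (fun z hz => (sub_pos.2 (ha z hz)).ne') heat hz
  have hvec : ((1 : ℝ), -spaceGrad F z) = timeDir - (0, spaceGrad F z) := by simp [timeDir]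
  have hdir : ∀ k : ℝ × Space n → ℝ, dirDeriv (1, -spaceGrad F z) k z
      = dirDeriv timeDir k z - spaceGradInner k F z := by
    intro k
    rw [dirDeriv, hvec, map_sub, fderiv_apply_spaceGrad]; rfl
  have hFF : spaceGradInner F F z = spaceGradSq F z := by
    simp only [spaceGradInner, spaceGradSq, sq]
  have huW : spaceGradInner (spaceTimeDensity a F) (spaceTimeW a F) z
      = -(spaceTimeDensity a F z * spaceGradInner (spaceTimeW a F) F z) := by
    rw [spaceGradInner, spaceGradInner, Finset.mul_sum, ← Finset.sum_neg_distrib]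
    refine Finset.sum_congr rfl fun i _ => ?_
    rw [dirDeriv_spaceTimeDensity hd (ha _ hz)]
    simp only [spaceDir]
    ring
  have hdu : dirDeriv (1, -spaceGrad F z) (spaceTimeDensity a F) z
      = spaceLaplacian F z * spaceTimeDensity a F z := by
    rw [dirDeriv_spaceTimeDensity hd (ha _ hz), hdir, hFF]
    linear_combination (-spaceTimeDensity a F z) * heat z hz
  change dirDeriv (1, -spaceGrad F z) _ z - _ = _
  rw [dirDeriv_mul hW hu, hdu, hdir, huW]
  linear_combination spaceTimeDensity a F z * hev

end

end EvolvingDomain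

theorem mainTheorem1 (n : ℕ) (T a : ℝ) (ha : T ≤ a)
    (Ω₀ : Set (Space n)) (hΩ₀ : IsBoundedSmoothDomain Ω₀)
    (φ : ℝ → Space n → Space n) (hφ : IsSmoothDiffeoFamily T Ω₀ φ)
    (Ω : ℝ → Set (Space n)) (hΩ : Ω = domainAt Ω₀ φ)
    (β : ℝ → Space n → ℝ) (hβ : β = normalSpeed Ω₀ φ)
    (f : ℝ → Space n → ℝ)
    (hf : SmoothUpTo (fun z : ℝ × Space n => f z.1 z.2)
      {z | z.1 ∈ Ioo 0 T ∧ z.2 ∈ closure (Ω z.1)})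
    (hflow : ∀ t ∈ Ioo 0 T, ∀ p ∈ Ω₀, deriv (fun s => φ s p) t = -∇ (f t) (φ t p))
    (hheat : ∀ t ∈ Ioo 0 T, ∀ x ∈ Ω t,
      deriv (fun s => f s x) t + Laplacian.laplacian (f t) x
        = ‖∇ (f t) x‖ ^ 2 + (n + 1) / (2 * (a - t)))
    (hneumann : ∀ t ∈ Ioo 0 T, ∀ x ∈ frontier (Ω t),
      ⟪∇ (f t) x, outerUnitNormal (Ω t) x⟫ = β t x) :
    ∀ t ∈ Ioo 0 T,
      (∀ x ∈ frontier (Ω t),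
        -⟪∇ (perelmanW (f t) (a - t)) x, outerUnitNormal (Ω t) x⟫
          = 2 * (a - t) * harnackExpr Ω β f (a - t) t x) ∧
      IntegrableOn (entropyIntegrand (f t) (a - t)) (Ω t) ∧
      IntegrableOn (fun x => β t x * density (f t) (a - t) x) (frontier (Ω t)) μHE[n] ∧
      IntegrableOn (fun x => harnackExpr Ω β f (a - t) t x * density (f t) (a - t) x)
        (frontier (Ω t)) μHE[n] ∧
      DifferentiableAt ℝ (fun s => entropy (β s) (Ω s) (f s) (a - s)) t ∧
      2 * (a - t) *
          ∫ x in frontier (Ω t), harnackExpr Ω β f (a - t) t x * density (f t) (a - t) x ∂μHE[n]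
        ≤ deriv (fun s => entropy (β s) (Ω s) (f s) (a - s)) t := by
  subst hΩ
  have hK := hΩ₀.isCompact_closure
  obtain ⟨F, rfl⟩ : ∃ F : ℝ × Space n → ℝ, f = fun t y => F (t, y) := ⟨fun z => f z.1 z.2, rfl⟩
  obtain ⟨U', hU', hsub, hF'⟩ := hf
  -- On `U` both `F` and the density, which needs `τ > 0`, are smooth.
  set U : Set (ℝ × Space n) := U' ∩ {z | z.1 < a} with hUdef
  have hU : IsOpen U := hU'.inter (isOpen_lt continuous_fst continuous_const)
  have hF : ContDiffOn ℝ ∞ F U := ContDiffOn.mono hF' inter_subset_left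
  have hUa : ∀ z ∈ U, z.1 < a := fun z hz => hz.2
  have hΩU : ∀ s ∈ Ioo 0 T, ∀ y ∈ closure (domainAt Ω₀ φ s), (s, y) ∈ U := fun s hs y hy =>
    ⟨hsub ⟨hs, hy⟩, hs.2.trans_le ha⟩
  have hFd : ∀ z ∈ U, DifferentiableAt ℝ F z := fun z hz => differentiableAt_of_contDiffOn hU hF hz
  have hflow' : ∀ t ∈ Ioo 0 T, ∀ p ∈ Ω₀,
      deriv (fun s => φ s p) t = -spaceGrad F (t, φ t p) := by
    intro t ht p hp
    rw [hflow t ht p hp, spaceGrad_eq_gradient (hFd _ (hΩU t ht _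
      (subset_closure (mem_image_of_mem _ hp))))]
  have hWs := contDiffOn_spaceTimeW a hU hF
  have hus := contDiffOn_spaceTimeDensity hF hUa
  -- The heat equation on the open space-time domain.
  set O : Set (ℝ × Space n) := {z | z.1 ∈ Ioo 0 T ∧ z.2 ∈ domainAt Ω₀ φ z.1} with hOdef
  have hO : IsOpen O := isOpen_iff_mem_nhds.2 fun z hz => Filter.inter_mem
    (continuousAt_fst.eventually (isOpen_Ioo.mem_nhds hz.1))
    (eventually_mem_domainAt hφ hΩ₀.isOpen hK hz.1 hz.2)
  have hOU : O ⊆ U := fun z hz => hΩU z.1 hz.1 z.2 (subset_closure hz.2)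
  have heat : ∀ z ∈ O, dirDeriv timeDir F z + spaceLaplacian F z
      = spaceGradSq F z + (n + 1) / (2 * (a - z.1)) := by
    intro z hz
    have h1 := hheat z.1 hz.1 z.2 hz.2
    rw [laplacian_slice hU hF (hOU hz), norm_gradient_slice_sq hU hF (hOU hz),
      (hasDerivAt_time_slice (hFd z (hOU hz))).deriv] at h1
    exact h1
  intro t ht
  have hτ : 0 < a - t := by linarith [ht.2]
  have hD := isBoundedSmoothDomain_domainAt hφ hΩ₀ ht
  have hDm := hD.isOpen.measurableSet
  have hM := (isClosed_frontier (s := domainAt Ω₀ φ t)).measurableSet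
  have hfU : ∀ x ∈ frontier (domainAt Ω₀ φ t), (t, x) ∈ U := fun x hx =>
    hΩU t ht x (frontier_subset_closure hx)
  have hcts : ∀ k : ℝ × Space n → ℝ, ContDiffOn ℝ ∞ k U →
      ContinuousOn (fun y => k (t, y)) (closure (domainAt Ω₀ φ t)) := fun k hk =>
    hk.continuousOn.comp (by fun_prop) (hΩU t ht)
  have hboundary : ∀ x ∈ frontier (domainAt Ω₀ φ t),
      -⟪∇ (perelmanW (fun y => F (t, y)) (a - t)) x, outerUnitNormal (domainAt Ω₀ φ t) x⟫
        = 2 * (a - t) * harnackExpr (domainAt Ω₀ φ) β (fun t y => F (t, y)) (a - t) t x :=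
    fun x hx => perelmanW_normal_derivative ha hφ hΩ₀ hU hF hflow hheat hneumann ht hx (hfU x hx)
  have hgradW : ∀ x ∈ frontier (domainAt Ω₀ φ t),
      ∇ (perelmanW (fun y => F (t, y)) (a - t)) x = spaceGrad (spaceTimeW a F) (t, x) := by
    intro x hx
    rw [spaceGrad_eq_gradient (differentiableAt_of_contDiffOn hU hWs (hfU x hx))]
    have hc : ContinuousAt (fun y : Space n => (t, y)) x := by fun_prop
    have h1 : perelmanW (fun y => F (t, y)) (a - t) =ᶠ[nhds x]
        fun y => spaceTimeW a F (t, y) := by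
      filter_upwards [hc.eventually (hU.mem_nhds (hfU x hx))] with y hy
      exact perelmanW_slice (z := (t, y)) a hU hF hy
    rw [gradient, gradient, h1.fderiv_eq]
  have hgradc : ∀ k : ℝ × Space n → ℝ, ContDiffOn ℝ ∞ k U → IntegrableOn (fun x =>
      spaceTimeDensity a F (t, x) * ⟪spaceGrad k (t, x), outerUnitNormal (domainAt Ω₀ φ t) x⟫)
      (frontier (domainAt Ω₀ φ t)) μHE[n] := fun k hk =>
    integrableOn_frontier hD (((hcts _ hus).mono frontier_subset_closure).mul
      (((contDiffOn_spaceGrad hU hk).continuousOn.comp (by fun_prop) hfU).inner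
        (continuousOn_outerUnitNormal hD)))
  have hβu : EqOn (fun x => spaceTimeDensity a F (t, x) * ⟪spaceGrad F (t, x),
      outerUnitNormal (domainAt Ω₀ φ t) x⟫) (fun x => β t x * density (fun y => F (t, y)) (a - t) x)
      (frontier (domainAt Ω₀ φ t)) := by
    intro x hx
    simp only
    rw [← hneumann t ht x hx, spaceGrad_eq_gradient (hFd _ (hfU x hx)), mul_comm]
    rfl
  have hHu : EqOn (fun x => -(2 * (a - t))⁻¹ * (spaceTimeDensity a F (t, x) *
      ⟪spaceGrad (spaceTimeW a F) (t, x), outerUnitNormal (domainAt Ω₀ φ t) x⟫))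
      (fun x => harnackExpr (domainAt Ω₀ φ) β (fun t y => F (t, y)) (a - t) t x
        * density (fun y => F (t, y)) (a - t) x) (frontier (domainAt Ω₀ φ t)) := by
    intro x hx
    have h1 := hboundary x hx
    rw [hgradW x hx] at h1
    have h2 : density (fun y => F (t, y)) (a - t) x = spaceTimeDensity a F (t, x) := rfl
    simp only [h2]
    rw [neg_eq_iff_eq_neg] at h1
    rw [h1]
    field_simp
  -- Near `t` the entropy is `∫ W u`, to which the transport theorem applies.
  have hent : ∀ s ∈ Ioo 0 T, entropy (β s) (domainAt Ω₀ φ s) (fun y => F (s, y)) (a - s)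
      = ∫ x in domainAt Ω₀ φ s, spaceTimeW a F (s, x) * spaceTimeDensity a F (s, x) := fun s hs =>
    (entropy_slice_eq (isBoundedSmoothDomain_domainAt hφ hΩ₀ hs) hU (hΩU s hs) hF hUa
      (hneumann s hs)).2
  have hderiv := (hasDerivAt_integral_domainAt hφ hΩ₀ hU hΩU hF (hWs.mul hus) hflow'
    ht).congr_of_eventuallyEq (f₁ := fun s =>
      entropy (β s) (domainAt Ω₀ φ s) (fun y => F (s, y)) (a - s)) (by
      filter_upwards [isOpen_Ioo.mem_nhds ht] with s hs using hent s hs)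
  refine ⟨hboundary, (entropy_slice_eq hD hU (hΩU t ht) hF hUa (hneumann t ht)).1,
    (hgradc F hF).congr_fun hβu hM, IntegrableOn.congr_fun ((hgradc _ hWs).const_mul _) hHu hM,
    hderiv.differentiableAt, ?_⟩
  have hgreen : IntegrableOn (fun x => spaceTimeDensity a F (t, x)
      * spaceLaplacian (spaceTimeW a F) (t, x)
      + spaceGradInner (spaceTimeDensity a F) (spaceTimeW a F) (t, x)) (domainAt Ω₀ φ t) :=
    integrableOn_domain hD (hcts _ ((hus.mul (contDiffOn_spaceLaplacian hU hWs)).add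
      (contDiffOn_spaceGradInner hU hus hWs)))
  have hSs : ContDiffOn ℝ ∞ (fun z => 2 * (a - t) * solitonSq (a - t) F z
      * spaceTimeDensity a F z) U :=
    (contDiffOn_const.mul (ContDiffOn.sum fun i _ => ContDiffOn.sum fun j _ =>
      ((contDiffOn_dirDeriv hU (contDiffOn_dirDeriv hU hF _) _).sub contDiffOn_const).pow 2)).mul
        hus
  -- The divergence `div (u ∇W)` integrates to the boundary integral of the Harnack expression.
  rw [hderiv.deriv, ← setIntegral_congr_fun hM hHu, integral_const_mul,
    ← integral_spaceLaplacian_add_spaceGradInner hD hU (hΩU t ht) hus hWs,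
    setIntegral_congr_fun hDm fun x hx => transport_spaceTimeW_mul_density hO (hF.mono hOU)
      (fun z hz => hUa z (hOU hz)) heat (z := (t, x)) ⟨ht, hx⟩,
    integral_sub (integrableOn_domain hD (hcts _ hSs)) hgreen]
  have hpos : 0 ≤ ∫ x in domainAt Ω₀ φ t, 2 * (a - t) * solitonSq (a - t) F (t, x)
      * spaceTimeDensity a F (t, x) := by
    refine setIntegral_nonneg hDm fun x hx => ?_
    have h1 : 0 ≤ solitonSq (a - t) F (t, x) :=
      Finset.sum_nonneg fun i _ => Finset.sum_nonneg fun j _ => sq_nonneg _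
    have h2 := (spaceTimeDensity_pos (F := F) (z := (t, x)) (ht.2.trans_le ha)).le
    positivity
  rw [← mul_assoc, mul_neg, mul_inv_cancel₀ (by positivity)]
  linarith
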